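/- Let $\mathcal C$ be a compact connected Riemann surface and let $f:\mathcal C\to\mathbb{CP}^1$ be a nonconstant meromorphic function of degree $d\ge 2$. A branch point $q\in\mathbb{CP}^1$ of $f$ is called simple if $f^{-1}(q)$ consists of exactly $d-1$ points (equivalently, there is exactly one ramification point over $q$, and it has ramification index $2$), and complicated otherwise. Suppose that $f$ has at most one complicated branch point. The planarity defect of $f$ is $$\mathrm{pdef}(f)=\min_{\nu}\bigl(\deg \nu(\mathcal C)-\deg f\bigr),$$ where $\nu$ runs over all holomorphic maps $\nu:\mathcal C\to\mathbb{CP}^2$ that are birational onto their image and satisfy $f=\pi_p\circ\nu$ for some point $p\in\mathbb{CP}^2$; here $\pi_p$ is the projection from $p$ to the pencil of lines through $p$ (identified with $\mathbb{CP}^1$), and $\deg\nu(\mathcal C)$ is the degree of the plane curve $\nu(\mathcal C)$. Write $f_*\mathcal O_{\mathcal C}\cong\mathcal O\oplus\bigoplus_{i=1}^{n}\mathcal O(a_i)$, an isomorphism of sheaves of $\mathcal O$-modules on $\mathbb{CP}^1$, with integers $a_1,\dots,a_n$. Then $$\mathrm{pdef}(f)=0\quad\Longleftrightarrow\quad \max_i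 a_i=-1 .$$ -/

import Mathlib

open scoped Manifold ContDiff LinearAlgebra.Projectivization

namespace PlanarityDefect

/-- The complex projective space `ℂℙⁿ`, the space of lines through the origin of `ℂⁿ⁺¹`. -/
abbrev CP (n : ℕ) : Type := ℙ ℂ (Fin (n + 1) → ℂ)

/-- `ℂℙⁿ` carries the quotient topology from `ℂⁿ⁺¹ ∖ {0}`. -/
noncomputable instance (n : ℕ) : TopologicalSpace (CP n) :=
  TopologicalSpace.coinduced (Projectivization.mk' ℂ) inferInstance

section Holomorphic

variable {X : Type*} [TopologicalSpace X] [ChartedSpace ℂ X]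

/-- A map to `ℂℙⁿ` is holomorphic if locally it is `x ↦ [F₀(x) : … : Fₙ(x)]` with holomorphic
functions `F₀, …, Fₙ` without common zeros. -/
def IsHolomorphic {n : ℕ} (f : X → CP n) : Prop :=
  ∀ x₀ : X, ∃ V : Set X, IsOpen V ∧ x₀ ∈ V ∧ ∃ F : X → Fin (n + 1) → ℂ,
    MDifferentiableOn 𝓘(ℂ) 𝓘(ℂ, Fin (n + 1) → ℂ) F V ∧
      ∀ x ∈ V, ∃ h : F x ≠ 0, f x = Projectivization.mk ℂ (F x) h

end Holomorphic

section Degree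

variable {X : Type*}

/-- The degree of a nonconstant holomorphic map from a compact connected Riemann surface to `ℂℙ¹`:
the number of preimages of a generic point, which is the largest number of points in a fibre
(all but finitely many fibres attain it, the fibres over the branch points have fewer points). -/
noncomputable def degree (f : X → CP 1) : ℕ∞ := ⨆ q : CP 1, (f ⁻¹' {q}).encard

/-- `q` is a complicated branch point of `f`: it is a branch point (`f⁻¹(q)` has fewer than `deg f`
points), and it is not a simple one (a branch point is simple if there is exactly one ramification
point over it and this point has ramification index `2`, in other words if `f⁻¹(q)` consists of
exactly `deg f - 1` points). -/
def IsComplicatedBranchPoint (f : X → CP 1) (q : CP 1) : Prop :=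
  (f ⁻¹' {q}).encard < degree f ∧ (f ⁻¹' {q}).encard + 1 ≠ degree f

end Degree

section PlaneModels

/-- `F` is a homogeneous equation, of degree `m`, of the plane curve `Z`. -/
def IsEquation (Z : Set (CP 2)) (m : ℕ) (F : MvPolynomial (Fin 3) ℂ) : Prop :=
  F ≠ 0 ∧ F.IsHomogeneous m ∧
    ∀ (v : Fin 3 → ℂ) (hv : v ≠ 0), Projectivization.mk ℂ v hv ∈ Z ↔ MvPolynomial.eval v F = 0

/-- The degree of a (reduced) plane curve `Z`: the least degree of a homogeneous equation of `Z`
(`⊤` if `Z` is not an algebraic curve). -/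
noncomputable def planeDegree (Z : Set (CP 2)) : ℕ∞ :=
  ⨅ (m : ℕ) (_ : ∃ F, IsEquation Z m F), (m : ℕ∞)

/-- `f = π_p ∘ ν`, where `p` is the point of `ℂℙ²` given by the one-dimensional kernel of the
surjection `A : ℂ³ → ℂ²` and `π_p : [v] ↦ [A v]` is the projection from `p`, with the pencil of
lines through `p` identified with `ℂℙ¹` by means of `A`. As `π_p` is not defined at `p`, the
equality is one of maps outside `ν⁻¹(p)`. -/
def IsProjection {X : Type*} (f : X → CP 1) (ν : X → CP 2)
    (A : (Fin 3 → ℂ) →ₗ[ℂ] (Fin 2 → ℂ)) : Prop :=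
  Function.Surjective A ∧
    ∀ (x : X) (v : Fin 3 → ℂ) (hv : v ≠ 0) (hAv : A v ≠ 0),
      ν x = Projectivization.mk ℂ v hv → f x = Projectivization.mk ℂ (A v) hAv

variable {X : Type*} [TopologicalSpace X] [ChartedSpace ℂ X]

/-- `ν` is a holomorphic map from the compact Riemann surface `X` to the projective plane which
is birational onto its image, that is, one-to-one outside a finite set. -/
def IsBirationalPlaneMap (ν : X → CP 2) : Prop :=
  IsHolomorphic ν ∧ ∃ S : Set X, S.Finite ∧ Set.InjOn ν Sᶜ

/-- The planarity defect of `f`: the minimum of `deg ν(X) - deg f` over all representations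
`f = π_p ∘ ν` with `ν : X → ℂℙ²` birational onto its image and `p ∈ ℂℙ²`
(one always has `deg ν(X) ≥ deg f` there). -/
noncomputable def planarityDefect (f : X → CP 1) : ℕ∞ :=
  ⨅ (l : ℕ) (_ : ∃ (ν : X → CP 2) (A : (Fin 3 → ℂ) →ₗ[ℂ] (Fin 2 → ℂ)),
    IsBirationalPlaneMap ν ∧ IsProjection f ν A ∧
      planeDegree (Set.range ν) = degree f + l), (l : ℕ∞)

end PlaneModels

section Sheaves

open TopologicalSpace (Opens)

/-- The cone in `ℂ² ∖ {0}` over a subset of `ℂℙ¹`. -/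
def cone (U : Set (CP 1)) : Set (Fin 2 → ℂ) :=
  {v | ∃ h : v ≠ 0, Projectivization.mk ℂ v h ∈ U}

theorem smul_mem_cone {U : Set (CP 1)} {v : Fin 2 → ℂ} {c : ℂ} (hc : c ≠ 0) (hv : v ∈ cone U) :
    c • v ∈ cone U := by
  obtain ⟨h, hU⟩ := hv
  refine ⟨smul_ne_zero hc h, ?_⟩
  have : Projectivization.mk ℂ (c • v) (smul_ne_zero hc h) = Projectivization.mk ℂ v h :=
    (Projectivization.mk_eq_mk_iff' ℂ _ _ _ _).2 ⟨c, rfl⟩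
  rwa [this]

theorem cone_mono {U V : Set (CP 1)} (h : V ⊆ U) : cone V ⊆ cone U :=
  fun _ ⟨h0, hv⟩ => ⟨h0, h hv⟩

/-- The sections over `U` of the sheaf `𝒪(k)` on `ℂℙ¹`: the holomorphic functions on the cone over
`U` that are homogeneous of degree `k`. They are represented by their extension by zero
to `ℂ²`. In particular `𝒪 = 𝒪(0)` is the structure sheaf. -/
def twist (k : ℤ) (U : Opens (CP 1)) : Submodule ℂ ((Fin 2 → ℂ) → ℂ) where
  carrier := {s | DifferentiableOn ℂ s (cone U) ∧
    (∀ v ∈ cone U, ∀ c : ℂ, c ≠ 0 → s (c • v) = c ^ k * s v) ∧ ∀ v ∉ cone U, s v = 0}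
  zero_mem' := ⟨differentiableOn_const 0, by simp, by simp⟩
  add_mem' := by
    rintro s t ⟨hs, hs', hs''⟩ ⟨ht, ht', ht''⟩
    refine ⟨hs.add ht, fun v hv c hc => ?_, fun v hv => ?_⟩
    · simp only [Pi.add_apply, hs' v hv c hc, ht' v hv c hc, mul_add]
    · simp only [Pi.add_apply, hs'' v hv, ht'' v hv, add_zero]
  smul_mem' := by
    rintro a s ⟨hs, hs', hs''⟩
    refine ⟨hs.const_smul a, fun v hv c hc => ?_, fun v hv => ?_⟩
    · simp only [Pi.smul_apply, hs' v hv c hc, smul_eq_mul]; ring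
    · simp only [Pi.smul_apply, hs'' v hv, smul_zero]

/-- Multiplication of sections of `𝒪(k)` by functions. -/
instance (k : ℤ) (U : Opens (CP 1)) : SMul (twist 0 U) (twist k U) where
  smul h s := ⟨fun v => h.1 v * s.1 v, h.2.1.mul s.2.1,
    fun v hv c hc => by
      change h.1 (c • v) * s.1 (c • v) = c ^ k * (h.1 v * s.1 v)
      rw [h.2.2.1 v hv c hc, s.2.2.1 v hv c hc, zpow_zero, one_mul]; ring,
    fun v hv => by
      change h.1 v * s.1 v = 0
      rw [s.2.2.2 v hv, mul_zero]⟩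

/-- Restriction of sections of `𝒪(k)` from `U` to `V ⊆ U`. -/
noncomputable def twistRes (k : ℤ) {U V : Opens (CP 1)} (hVU : V ≤ U) (s : twist k U) :
    twist k V :=
  ⟨(cone V).indicator s.1,
    (s.2.1.mono (cone_mono hVU)).congr fun v hv => Set.indicator_of_mem hv _,
    fun v hv c hc => by
      rw [Set.indicator_of_mem hv, Set.indicator_of_mem (smul_mem_cone hc hv),
        s.2.2.1 v (cone_mono hVU hv) c hc],
    fun v hv => Set.indicator_of_notMem hv _⟩

/-- A function on `U ⊆ ℂℙ¹`, given as a homogeneous function of degree `0` on the cone over `U`,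
is evaluated at a point by evaluating it at any vector representing the point. -/
theorem twist_zero_rep {U : Opens (CP 1)} (h : twist 0 U) (v : Fin 2 → ℂ) (hv : v ≠ 0) :
    h.1 (Projectivization.mk ℂ v hv).rep = h.1 v := by
  obtain ⟨c, hc⟩ := Projectivization.exists_smul_eq_mk_rep ℂ v hv
  rw [← hc]
  by_cases hU : v ∈ cone U
  · have := h.2.2.1 v hU c c.ne_zero
    rwa [zpow_zero, one_mul] at this
  · rw [h.2.2.2 v hU]
    refine h.2.2.2 _ fun hcv => hU ?_
    have := smul_mem_cone (inv_ne_zero c.ne_zero) hcv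
    rwa [Units.smul_def, smul_smul, inv_mul_cancel₀ c.ne_zero, one_smul] at this

variable {X : Type*} [TopologicalSpace X] [ChartedSpace ℂ X]

/-- The sections over `U` of the push-forward `f_* 𝒪_X`: the holomorphic functions on `f⁻¹(U)`,
represented by their extension by zero to `X`. -/
def pushforward (f : X → CP 1) (U : Opens (CP 1)) : Submodule ℂ (X → ℂ) where
  carrier := {s | MDifferentiableOn 𝓘(ℂ) 𝓘(ℂ) s (f ⁻¹' U) ∧ ∀ x ∉ f ⁻¹' U, s x = 0}
  zero_mem' := ⟨mdifferentiableOn_const, by simp⟩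
  add_mem' := by
    rintro s t ⟨hs, hs'⟩ ⟨ht, ht'⟩
    exact ⟨hs.add ht, fun x hx => by simp only [Pi.add_apply, hs' x hx, ht' x hx, add_zero]⟩
  smul_mem' := by
    rintro a s ⟨hs, hs'⟩
    exact ⟨hs.const_smul a, fun x hx => by simp only [Pi.smul_apply, hs' x hx, smul_zero]⟩

/-- Restriction of sections of `f_* 𝒪_X` from `U` to `V ⊆ U`. -/
noncomputable def pushforwardRes (f : X → CP 1) {U V : Opens (CP 1)} (hVU : V ≤ U)
    (s : pushforward f U) : pushforward f V :=
  ⟨(f ⁻¹' V).indicator s.1,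
    (s.2.1.mono (Set.preimage_mono hVU)).congr fun _ hx => Set.indicator_of_mem hx _,
    fun _ hx => Set.indicator_of_notMem hx _⟩

/-- Multiplication of a section `s` of `f_* 𝒪_X` over `U` by a holomorphic function `h` on `U`: the
section `x ↦ h(f(x)) s(x)`. -/
noncomputable def pushforwardSMul {f : X → CP 1} (hf : IsHolomorphic f) {U : Opens (CP 1)}
    (h : twist 0 U) (s : pushforward f U) : pushforward f U :=
  ⟨fun x => h.1 (f x).rep * s.1 x, by
    refine MDifferentiableOn.mul (fun x hx => ?_) s.2.1
    obtain ⟨V, hV, hxV, F, hF, hFf⟩ := hf x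
    have key : ∀ y ∈ f ⁻¹' U ∩ V, h.1 (f y).rep = h.1 (F y) ∧ F y ∈ cone U := by
      rintro y ⟨hyU, hyV⟩
      obtain ⟨h0, hy⟩ := hFf y hyV
      refine ⟨by rw [hy, twist_zero_rep], h0, ?_⟩
      have hyU' : f y ∈ U := hyU
      rwa [hy] at hyU'
    refine (mdifferentiableWithinAt_inter (hV.mem_nhds hxV)).1 ?_
    have hx' : x ∈ f ⁻¹' U ∩ V := ⟨hx, hxV⟩
    have hh : MDifferentiableWithinAt 𝓘(ℂ, Fin 2 → ℂ) 𝓘(ℂ) h.1 (cone U) (F x) :=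
      (h.2.1 (F x) (key x hx').2).mdifferentiableWithinAt
    have hFx : MDifferentiableWithinAt 𝓘(ℂ) 𝓘(ℂ, Fin 2 → ℂ) F (f ⁻¹' U ∩ V) x :=
      (hF x hxV).mono Set.inter_subset_right
    exact (hh.comp x hFx fun y hy => (key y hy).2).congr (fun y hy => (key y hy).1)
      (key x hx').1,
    fun x hx => by
      change h.1 (f x).rep * s.1 x = 0
      rw [s.2.2 x hx, mul_zero]⟩

/-- An isomorphism `f_* 𝒪_X ≅ ⨁ᵢ 𝒪(kᵢ)` of sheaves of `𝒪`-modules on `ℂℙ¹`: an additive bijection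
between the sections over every open set, compatible with multiplication by functions and with
restriction to smaller open sets. -/
structure PushforwardIso {f : X → CP 1} (hf : IsHolomorphic f) {ι : Type} [Fintype ι]
    (k : ι → ℤ) where
  equiv (U : Opens (CP 1)) : pushforward f U ≃+ ((i : ι) → twist (k i) U)
  map_smul (U : Opens (CP 1)) (h : twist 0 U) (s : pushforward f U) (i : ι) :
    equiv U (pushforwardSMul hf h s) i = h • equiv U s i
  map_res {U V : Opens (CP 1)} (hVU : V ≤ U) (s : pushforward f U) (i : ι) :
    equiv V (pushforwardRes f hVU s) i = twistRes (k i) hVU (equiv U s i)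

end Sheaves

end PlanarityDefect

open PlanarityDefect

/-! A splitting of the push-forward is a pair of frames of holomorphic functions on the preimages of
the two affine lines, glued by the powers `k i` of the coordinate (`framePair_isoFrame`). By the
projection formula, sections of the pull-back of 𝒪(1) on the surface are sections of ⨁ 𝒪(k i + 1) on
the projective line. The frame has `N = n + 1` members, and this is the degree of `f` (`degree_eq`).
Since global holomorphic functions are constant, the summand 𝒪 is the only one of nonnegative
weight, so all `a i ≤ -1` (`eq_of_nonneg`). Thus the maximum is -1 exactly when the pull-back of
𝒪(1) has a section that does not come from the projective line. Such a section has to be matched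
with a plane model of degree `deg f`.

From model to section: a plane model of degree `deg f` misses the centre p of the projection.
Otherwise a generic line through p would meet it in p and `deg f` further points, hence would lie in
it, and its equation would vanish identically (`eval_center_ne_zero`). As p is missed, a linear form
that is nonzero at p restricts to a section of the pull-back of 𝒪(1). Were this section pulled back
from the line, ν would factor through `f`, contradicting birationality
(`exists_section_of_planeMap`).

From section to model: let `g` be a section that is not pulled back. Put the complicated branch
point, if there is one, at infinity, so that ramification over the affine line is simple. If `g`
failed to separate generic fibres, the derivative of its characteristic polynomial would vanish at
`g` identically. Then every nearby point would have a partner with the same values of `t` and `g`,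
which forces dg = 0 at each simple ramification point (`chartDeriv_eq_zero_of_partner`). So dg/dt
would be holomorphic over the affine line. At infinity it equals g₁ - t₁ dg₁/dt₁, holomorphic for
any ramification because t₁ divided by its derivative is. Hence dg/dt is constant and `g` is linear,
a contradiction (`isLinear_of_chartDeriv`, `exists_finite_injOn`). So [R₀ : R₁ : σ], with third
coordinate given by `g`, is birational onto its image. The homogenised characteristic polynomial of
multiplication by `g` is an equation of degree `N` of the image, and generic lines through the
centre meet the image in `N` points, so no smaller degree is possible (`exists_planeMap`). -/

namespace PlanarityDefect

open Filter Topology Set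
open TopologicalSpace (Opens)

/-! ### Germs of holomorphic functions read in charts -/

section LocalTheory

variable {X : Type*} [TopologicalSpace X] [ChartedSpace ℂ X]

/-- `h` is holomorphic at `x`, read in the preferred chart at `x`. -/
def HolAt (h : X → ℂ) (x : X) : Prop :=
  AnalyticAt ℂ (h ∘ (chartAt ℂ x).symm) (chartAt ℂ x x)

/-- The derivative of `h` at `x`, read in the preferred chart at `x`. -/
noncomputable def chartDeriv (h : X → ℂ) (x : X) : ℂ :=
  deriv (h ∘ (chartAt ℂ x).symm) (chartAt ℂ x x)

/-- The local coordinate centred at `x`. -/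
noncomputable def coord (x y : X) : ℂ := chartAt ℂ x y - chartAt ℂ x x

theorem eventually_chart_iff {x : X} {p : X → Prop} :
    (∀ᶠ z in 𝓝 (chartAt ℂ x x), p ((chartAt ℂ x).symm z)) ↔ ∀ᶠ y in 𝓝 x, p y :=
  (chartAt ℂ x).eventually_nhds' p (mem_chart_source ℂ x)

theorem eventually_chart_iff' {x : X} {p : ℂ → Prop} :
    (∀ᶠ y in 𝓝 x, p (chartAt ℂ x y)) ↔ ∀ᶠ z in 𝓝 (chartAt ℂ x x), p z :=
  ((chartAt ℂ x).eventually_nhds p (mem_chart_source ℂ x)).symm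

theorem eventually_mem_source (x : X) : ∀ᶠ y in 𝓝 x, y ∈ (chartAt ℂ x).source :=
  (chartAt ℂ x).open_source.mem_nhds (mem_chart_source ℂ x)

@[simp] theorem coord_self (x : X) : coord x x = 0 := sub_self _

theorem eventually_coord_ne (x : X) : ∀ᶠ y in 𝓝[≠] x, coord x y ≠ 0 := by
  rw [eventually_nhdsWithin_iff]
  filter_upwards [eventually_mem_source x] with y hy hne h
  exact hne ((chartAt ℂ x).injOn hy (mem_chart_source ℂ x) (sub_eq_zero.1 h))

theorem eventually_punctured_chart {x : X} {p : X → Prop}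
    (h : ∀ᶠ z in 𝓝[≠] (chartAt ℂ x x), p ((chartAt ℂ x).symm z)) : ∀ᶠ y in 𝓝[≠] x, p y := by
  rw [eventually_nhdsWithin_iff] at h ⊢
  rw [← eventually_chart_iff'] at h
  filter_upwards [h, eventually_mem_source x] with y hy hs hne
  have := hy fun h' => hne ((chartAt ℂ x).injOn hs (mem_chart_source ℂ x) h')
  rwa [(chartAt ℂ x).left_inv hs] at this

/-- A chart identifies a neighbourhood of the point with an open subset of ℂ, which has no isolated
points. Every later choice of a generic nearby point rests on this. -/
instance nhdsNE_neBot (x : X) : (𝓝[≠] x).NeBot := by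
  rw [← frequently_true_iff_neBot, Filter.Frequently, not_true_eq_false]
  intro h
  rw [eventually_nhdsWithin_iff, ← eventually_chart_iff] at h
  have h2 : ∀ᶠ z in 𝓝[≠] (chartAt ℂ x x), False := by
    rw [eventually_nhdsWithin_iff]
    filter_upwards [h, (chartAt ℂ x).open_target.mem_nhds (mem_chart_target ℂ x)] with z hz ht hne
    refine hz fun h' => hne ?_
    rw [mem_singleton_iff] at h' ⊢
    have := (chartAt ℂ x).right_inv ht
    rwa [h', eq_comm] at this
  exact (h2.exists).choose_spec

namespace HolAt

variable {h g : X → ℂ} {x : X}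

theorem congr (hh : HolAt h x) (e : ∀ᶠ y in 𝓝 x, h y = g y) : HolAt g x := by
  refine AnalyticAt.congr hh ?_
  exact eventually_chart_iff.2 e

theorem const (c : ℂ) (x : X) : HolAt (fun _ => c) x := analyticAt_const

theorem add (hh : HolAt h x) (hg : HolAt g x) : HolAt (fun y => h y + g y) x :=
  AnalyticAt.add hh hg

theorem sub (hh : HolAt h x) (hg : HolAt g x) : HolAt (fun y => h y - g y) x :=
  AnalyticAt.sub hh hg

theorem mul (hh : HolAt h x) (hg : HolAt g x) : HolAt (fun y => h y * g y) x :=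
  AnalyticAt.mul hh hg

theorem pow (hh : HolAt h x) (n : ℕ) : HolAt (fun y => h y ^ n) x :=
  AnalyticAt.pow hh n

theorem comp {c : ℂ → ℂ} (hc : AnalyticAt ℂ c (h x)) (hh : HolAt h x) :
    HolAt (fun y => c (h y)) x := by
  refine AnalyticAt.comp (g := c) ?_ hh
  simpa [(chartAt ℂ x).left_inv (mem_chart_source ℂ x)] using hc

theorem inv (hh : HolAt h x) (h0 : h x ≠ 0) : HolAt (fun y => (h y)⁻¹) x :=
  comp (c := fun z => z⁻¹) (analyticAt_inv h0) hh

theorem div (hh : HolAt h x) (hg : HolAt g x) (h0 : g x ≠ 0) : HolAt (fun y => h y / g y) x := by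
  simpa only [div_eq_mul_inv] using hh.mul (hg.inv h0)

theorem sum {ι : Type*} {s : Finset ι} {f : ι → X → ℂ} (hf : ∀ i ∈ s, HolAt (f i) x) :
    HolAt (fun y => ∑ i ∈ s, f i y) x := by
  classical
  induction s using Finset.induction_on with
  | empty => simpa using const 0 x
  | insert a s ha ih =>
    simp only [Finset.sum_insert ha]
    exact (hf a (Finset.mem_insert_self a s)).add
      (ih fun i hi => hf i (Finset.mem_insert_of_mem hi))

theorem coord (x : X) : HolAt (coord x) x := by
  have : AnalyticAt ℂ (fun z : ℂ => z - chartAt ℂ x x) (chartAt ℂ x x) := by fun_prop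
  refine this.congr ?_
  filter_upwards [(chartAt ℂ x).open_target.mem_nhds (mem_chart_target ℂ x)] with z hz
  simp [PlanarityDefect.coord, (chartAt ℂ x).right_inv hz]

theorem continuousAt (hh : HolAt h x) : ContinuousAt h x := by
  have h1 : ContinuousAt (h ∘ (chartAt ℂ x).symm) (chartAt ℂ x x) := AnalyticAt.continuousAt hh
  have h2 := h1.comp ((chartAt ℂ x).continuousAt (mem_chart_source ℂ x))
  refine h2.congr ?_
  filter_upwards [eventually_mem_source x] with y hy
  simp [(chartAt ℂ x).left_inv hy]

theorem eventually_eq_zero_or (hh : HolAt h x) :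
    (∀ᶠ y in 𝓝 x, h y = 0) ∨ ∀ᶠ y in 𝓝[≠] x, h y ≠ 0 := by
  rcases AnalyticAt.eventually_eq_zero_or_eventually_ne_zero hh with h | h
  · exact Or.inl (eventually_chart_iff.1 h)
  · exact Or.inr (eventually_punctured_chart h)

/-- A germ which does not vanish identically is a power of the coordinate times a unit. -/
theorem factor (hh : HolAt h x) (h0 : ¬ ∀ᶠ y in 𝓝 x, h y = 0) :
    ∃ (m : ℕ) (k : X → ℂ), HolAt k x ∧ k x ≠ 0 ∧
      ∀ᶠ y in 𝓝 x, h y = PlanarityDefect.coord x y ^ m * k y := by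
  have h1 : ¬ ∀ᶠ z in 𝓝 (chartAt ℂ x x), (h ∘ (chartAt ℂ x).symm) z = 0 :=
    fun h' => h0 (eventually_chart_iff.1 h')
  obtain ⟨m, k, hk, hk0, e⟩ := (AnalyticAt.exists_eventuallyEq_pow_smul_nonzero_iff hh).2 h1
  refine ⟨m, fun y => k (chartAt ℂ x y), ?_, hk0, ?_⟩
  · refine hk.congr ?_
    filter_upwards [(chartAt ℂ x).open_target.mem_nhds (mem_chart_target ℂ x)] with z hz
    simp [(chartAt ℂ x).right_inv hz]
  · rw [← eventually_chart_iff'] at e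
    filter_upwards [e, eventually_mem_source x] with y hy hs
    simpa [PlanarityDefect.coord, (chartAt ℂ x).left_inv hs] using hy

theorem hasDerivAt (hh : HolAt h x) :
    HasDerivAt (h ∘ (chartAt ℂ x).symm) (chartDeriv h x) (chartAt ℂ x x) :=
  (AnalyticAt.differentiableAt hh).hasDerivAt

theorem chartDeriv_eq {c : ℂ} (hd : HasDerivAt (h ∘ (chartAt ℂ x).symm) c (chartAt ℂ x x)) :
    chartDeriv h x = c := hd.deriv

theorem chartDeriv_mul (hh : HolAt h x) (hg : HolAt g x) :
    chartDeriv (fun y => h y * g y) x = chartDeriv h x * g x + h x * chartDeriv g x := by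
  refine chartDeriv_eq ?_
  have := hh.hasDerivAt.mul hg.hasDerivAt
  change HasDerivAt (fun y => h ((chartAt ℂ x).symm y) * g ((chartAt ℂ x).symm y)) _ _ at this
  simpa [Function.comp_def, (chartAt ℂ x).left_inv (mem_chart_source ℂ x)] using this

theorem chartDeriv_sub (hh : HolAt h x) (hg : HolAt g x) :
    chartDeriv (fun y => h y - g y) x = chartDeriv h x - chartDeriv g x :=
  chartDeriv_eq (hh.hasDerivAt.sub hg.hasDerivAt)

theorem chartDeriv_comp {c : ℂ → ℂ} (hc : AnalyticAt ℂ c (h x)) (hh : HolAt h x) :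
    chartDeriv (fun y => c (h y)) x = deriv c (h x) * chartDeriv h x := by
  refine chartDeriv_eq ?_
  refine HasDerivAt.comp (h₂ := c) (h := h ∘ (chartAt ℂ x).symm) _ ?_ hh.hasDerivAt
  simpa [(chartAt ℂ x).left_inv (mem_chart_source ℂ x)] using hc.differentiableAt.hasDerivAt

theorem chartDeriv_inv (hh : HolAt h x) (h0 : h x ≠ 0) :
    chartDeriv (fun y => (h y)⁻¹) x = - chartDeriv h x / h x ^ 2 := by
  rw [chartDeriv_comp (c := fun z => z⁻¹) (analyticAt_inv h0) hh, deriv_inv]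
  ring

theorem chartDeriv_congr (e : ∀ᶠ y in 𝓝 x, h y = g y) : chartDeriv h x = chartDeriv g x :=
  Filter.EventuallyEq.deriv_eq (eventually_chart_iff.2 e)

@[simp] theorem chartDeriv_const (c : ℂ) : chartDeriv (fun _ : X => c) x = 0 :=
  chartDeriv_eq (hasDerivAt_const _ c)

@[simp] theorem chartDeriv_coord : chartDeriv (PlanarityDefect.coord x) x = 1 := by
  refine chartDeriv_eq ?_
  refine ((hasDerivAt_id (chartAt ℂ x x)).sub_const (chartAt ℂ x x)).congr_of_eventuallyEq ?_
  filter_upwards [(chartAt ℂ x).open_target.mem_nhds (mem_chart_target ℂ x)] with z hz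
  simp [PlanarityDefect.coord, (chartAt ℂ x).right_inv hz]

theorem eventually_eq_of_punctured (hh : HolAt h x) (hg : HolAt g x)
    (e : ∀ᶠ y in 𝓝[≠] x, h y = g y) : ∀ᶠ y in 𝓝 x, h y = g y := by
  rcases (hh.sub hg).eventually_eq_zero_or with h1 | h1
  · filter_upwards [h1] with y hy using sub_eq_zero.1 hy
  · exact absurd (h1.and e).exists (by simp [sub_eq_zero])

/-- Division by the local coordinate. -/
theorem exists_eq_coord_mul (hh : HolAt h x) (h0 : h x = 0) :
    ∃ k : X → ℂ, HolAt k x ∧ ∀ᶠ y in 𝓝 x, h y = PlanarityDefect.coord x y * k y := by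
  by_cases hz : ∀ᶠ y in 𝓝 x, h y = 0
  · exact ⟨fun _ => 0, const 0 x, by simpa using hz⟩
  obtain ⟨m, k, hk, hk0, e⟩ := hh.factor hz
  obtain _ | m := m
  · exact absurd (e.self_of_nhds.symm.trans h0) (by simpa using hk0)
  · exact ⟨fun y => PlanarityDefect.coord x y ^ m * k y, ((coord x).pow m).mul hk, by
      filter_upwards [e] with y hy
      rw [hy]; ring⟩

/-- Near a point where its derivative does not vanish, `h` is a local coordinate: every germ is a
holomorphic function of `h`. -/
theorem exists_eq_comp (hh : HolAt h x) (hd : chartDeriv h x ≠ 0) (hg : HolAt g x) :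
    ∃ H : ℂ → ℂ, AnalyticAt ℂ H (h x) ∧ ∀ᶠ y in 𝓝 x, g y = H (h y) := by
  set F := h ∘ (chartAt ℂ x).symm with hF
  have hFx : F (chartAt ℂ x x) = h x := by simp [hF]
  have hs : HasStrictDerivAt F (deriv F (chartAt ℂ x x)) (chartAt ℂ x x) :=
    AnalyticAt.hasStrictDerivAt hh
  have ha : AnalyticAt ℂ (hs.localInverse F _ _ hd) (F (chartAt ℂ x x)) :=
    AnalyticAt.analyticAt_localInverse hh hd
  have hl := hs.eventually_left_inverse hd
  refine ⟨(g ∘ (chartAt ℂ x).symm) ∘ hs.localInverse F _ _ hd, ?_, ?_⟩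
  · rw [← hFx]
    refine AnalyticAt.comp ?_ ha
    rw [hl.self_of_nhds]
    exact hg
  · rw [← eventually_chart_iff']  at hl
    filter_upwards [hl, eventually_mem_source x] with y hy hys
    simp only [hF, Function.comp_apply, (chartAt ℂ x).left_inv hys] at hy ⊢
    rw [hy, (chartAt ℂ x).left_inv hys]

/-- The coordinate itself is a function of `h` near `x`, so `h` separates points there. -/
theorem eventually_injective (hh : HolAt h x) (hd : chartDeriv h x ≠ 0) :
    ∃ V ∈ 𝓝 x, Set.InjOn h V := by
  obtain ⟨H, -, e⟩ := hh.exists_eq_comp hd (coord x)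
  refine ⟨_, e.and (eventually_mem_source x), ?_⟩
  rintro y ⟨hy, hys⟩ y' ⟨hy', hys'⟩ hyy
  refine (chartAt ℂ x).injOn hys hys' ?_
  rw [hyy, ← hy'] at hy
  exact sub_left_injective hy

end HolAt

theorem comp_chart_eventuallyEq {h : X → ℂ} {x x' y : X} (hy : y ∈ (chartAt ℂ x).source)
    (hy' : y ∈ (chartAt ℂ x').source) :
    (h ∘ (chartAt ℂ x').symm) ∘ (chartAt ℂ x' ∘ (chartAt ℂ x).symm)
      =ᶠ[𝓝 (chartAt ℂ x y)] h ∘ (chartAt ℂ x).symm := by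
  have : (chartAt ℂ x).symm ⁻¹' (chartAt ℂ x').source ∈ 𝓝 (chartAt ℂ x y) :=
    ((chartAt ℂ x).continuousAt_symm ((chartAt ℂ x).map_source hy)).preimage_mem_nhds
      ((chartAt ℂ x').open_source.mem_nhds (by rwa [(chartAt ℂ x).left_inv hy]))
  filter_upwards [this] with z hz
  simp [(chartAt ℂ x').left_inv hz]

/-- The derivative of `h` in the chart at `x`, as a function near `x`. -/
noncomputable def derivIn (x : X) (h : X → ℂ) (y : X) : ℂ :=
  deriv (h ∘ (chartAt ℂ x).symm) (chartAt ℂ x y)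

theorem HolAt.derivIn {h : X → ℂ} {x : X} (hh : HolAt h x) : HolAt (derivIn x h) x := by
  refine (AnalyticAt.deriv hh).congr ?_
  filter_upwards [(chartAt ℂ x).open_target.mem_nhds (mem_chart_target ℂ x)] with z hz
  simp [PlanarityDefect.derivIn, (chartAt ℂ x).right_inv hz]

theorem HolAt.eventually_const_of_derivIn {h : X → ℂ} {x : X} (hh : HolAt h x)
    (h0 : ∀ᶠ y in 𝓝 x, PlanarityDefect.derivIn x h y = 0) : ∀ᶠ y in 𝓝 x, h y = h x := by
  have h1 : ∀ᶠ z in 𝓝 (chartAt ℂ x x), deriv (h ∘ (chartAt ℂ x).symm) z = 0 :=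
    eventually_chart_iff'.1 h0
  have h2 := h1.and (AnalyticAt.eventually_analyticAt hh)
  obtain ⟨r, hr, hb⟩ := Metric.eventually_nhds_iff_ball.1 h2
  have h3 : ∀ᶠ z in 𝓝 (chartAt ℂ x x), (h ∘ (chartAt ℂ x).symm) z =
      (h ∘ (chartAt ℂ x).symm) (chartAt ℂ x x) := by
    filter_upwards [Metric.ball_mem_nhds _ hr] with z hz
    exact Metric.isOpen_ball.is_const_of_deriv_eq_zero
      (convex_ball _ r).isPreconnected
      (fun y hy => (hb y hy).2.differentiableAt.differentiableWithinAt)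
      (fun y hy => (hb y hy).1) hz (Metric.mem_ball_self hr)
  rw [← eventually_chart_iff'] at h3
  filter_upwards [h3, eventually_mem_source x] with y hy hs
  simpa [(chartAt ℂ x).left_inv hs] using hy

end LocalTheory

/-! ### Independence of charts, removable singularities, constancy of global functions -/

section Manifold

variable {X : Type*} [TopologicalSpace X] [ChartedSpace ℂ X] [IsManifold 𝓘(ℂ) ω X]

theorem analyticAt_transition {x x' y : X} (hy : y ∈ (chartAt ℂ x).source)
    (hy' : y ∈ (chartAt ℂ x').source) :
    AnalyticAt ℂ (chartAt ℂ x' ∘ (chartAt ℂ x).symm) (chartAt ℂ x y) := by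
  have h : ContDiffWithinAt ℂ ω (extChartAt 𝓘(ℂ) x' ∘ (extChartAt 𝓘(ℂ) x).symm) (range 𝓘(ℂ))
      (chartAt ℂ x y) := contDiffWithinAt_ext_coord_change x' x (by
    simp [(chartAt ℂ x).left_inv hy, hy', (chartAt ℂ x).map_source hy])
  simp only [mfld_simps] at h
  exact (contDiffWithinAt_univ.1 h).analyticAt

theorem analyticAt_chart_of {h : X → ℂ} {x x' y : X} (hy : y ∈ (chartAt ℂ x).source)
    (hy' : y ∈ (chartAt ℂ x').source)
    (hh : AnalyticAt ℂ (h ∘ (chartAt ℂ x').symm) (chartAt ℂ x' y)) :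
    AnalyticAt ℂ (h ∘ (chartAt ℂ x).symm) (chartAt ℂ x y) := by
  refine (AnalyticAt.comp ?_ (analyticAt_transition hy hy')).congr (comp_chart_eventuallyEq hy hy')
  simpa [(chartAt ℂ x).left_inv hy] using hh

theorem analyticAt_chart_iff {h : X → ℂ} {x y : X} (hy : y ∈ (chartAt ℂ x).source) :
    AnalyticAt ℂ (h ∘ (chartAt ℂ x).symm) (chartAt ℂ x y) ↔ HolAt h y :=
  ⟨analyticAt_chart_of (mem_chart_source ℂ y) hy, analyticAt_chart_of hy (mem_chart_source ℂ y)⟩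

/-- Passing from the chart at `y` to the chart at `x` multiplies all derivatives by the same
nonzero factor. -/
theorem exists_deriv_chart {x y : X} (hy : y ∈ (chartAt ℂ x).source) :
    ∃ c : ℂ, c ≠ 0 ∧ ∀ h : X → ℂ, HolAt h y →
      deriv (h ∘ (chartAt ℂ x).symm) (chartAt ℂ x y) = chartDeriv h y * c := by
  have hy' := mem_chart_source ℂ y
  have key : ∀ h : X → ℂ, HolAt h y →
      deriv (h ∘ (chartAt ℂ x).symm) (chartAt ℂ x y) =
        chartDeriv h y * deriv (chartAt ℂ y ∘ (chartAt ℂ x).symm) (chartAt ℂ x y) := by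
    intro h hh
    rw [← (comp_chart_eventuallyEq hy hy').deriv_eq]
    refine HasDerivAt.deriv (HasDerivAt.comp (h₂ := h ∘ (chartAt ℂ y).symm)
      (h := chartAt ℂ y ∘ (chartAt ℂ x).symm) _ ?_
      (analyticAt_transition hy hy').differentiableAt.hasDerivAt)
    simpa [(chartAt ℂ x).left_inv hy] using hh.hasDerivAt
  have e : (chartAt ℂ x ∘ (chartAt ℂ x).symm) =ᶠ[𝓝 (chartAt ℂ x y)] id := by
    filter_upwards [(chartAt ℂ x).open_target.mem_nhds ((chartAt ℂ x).map_source hy)] with z hz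
    simp [(chartAt ℂ x).right_inv hz]
  refine ⟨_, fun h0 => ?_, key⟩
  have h1 := key (chartAt ℂ x) ((analyticAt_chart_iff hy).1 (analyticAt_id.congr e.symm))
  rw [h0, mul_zero, e.deriv_eq] at h1
  simp at h1

theorem mdifferentiableAt_iff_chart {h : X → ℂ} {x y : X} (hy : y ∈ (chartAt ℂ x).source) :
    MDifferentiableAt 𝓘(ℂ) 𝓘(ℂ) h y ↔
      ContinuousAt h y ∧ DifferentiableAt ℂ (h ∘ (chartAt ℂ x).symm) (chartAt ℂ x y) := by
  have : IsManifold 𝓘(ℂ) 1 X := IsManifold.of_le (n := ω) le_top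
  rw [mdifferentiableAt_iff_of_mem_source (x := x) (y := 0) hy (by simp [chartAt_self_eq])]
  simp [mfld_simps, Function.comp_def, chartAt_self_eq, differentiableWithinAt_univ]

theorem HolAt.eventually {h : X → ℂ} {x : X} (hh : HolAt h x) : ∀ᶠ y in 𝓝 x, HolAt h y := by
  have h1 := AnalyticAt.eventually_analyticAt hh
  rw [← eventually_chart_iff'] at h1
  filter_upwards [h1, eventually_mem_source x] with y hy hs
  exact (analyticAt_chart_iff hs).1 hy

theorem HolAt.mdifferentiableAt {h : X → ℂ} {x : X} (hh : HolAt h x) :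
    MDifferentiableAt 𝓘(ℂ) 𝓘(ℂ) h x :=
  (mdifferentiableAt_iff_chart (mem_chart_source ℂ x)).2
    ⟨hh.continuousAt, AnalyticAt.differentiableAt hh⟩

theorem HolAt.of_eventually {h : X → ℂ} {x : X}
    (hh : ∀ᶠ y in 𝓝 x, MDifferentiableAt 𝓘(ℂ) 𝓘(ℂ) h y) : HolAt h x := by
  have h1 := eventually_chart_iff.2 (hh.and (eventually_mem_source x))
  refine Complex.analyticAt_iff_eventually_differentiableAt.2 ?_
  filter_upwards [h1, (chartAt ℂ x).open_target.mem_nhds (mem_chart_target ℂ x)] with z hz ht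
  have := ((mdifferentiableAt_iff_chart hz.2).1 hz.1).2
  rwa [(chartAt ℂ x).right_inv ht] at this

/-- Complex differentiability on an open set gives analyticity. This is the bridge between the sheaf
sections of the statement and the germs used in the proof. -/
theorem mdifferentiableOn_iff_holAt {h : X → ℂ} {V : Set X} (hV : IsOpen V) :
    MDifferentiableOn 𝓘(ℂ) 𝓘(ℂ) h V ↔ ∀ x ∈ V, HolAt h x := by
  constructor
  · intro hh x hx
    refine HolAt.of_eventually ?_
    filter_upwards [hV.mem_nhds hx] with y hy using hh.mdifferentiableAt (hV.mem_nhds hy)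
  · exact fun hh x hx => (hh x hx).mdifferentiableAt.mdifferentiableWithinAt

/-- Around each point the derivatives `chartDeriv` are those in the chart at this point, up to
a common nonvanishing factor. -/
theorem HolAt.eventually_deriv (x : X) :
    ∀ᶠ y in 𝓝 x, ∃ c : ℂ, c ≠ 0 ∧ ∀ h : X → ℂ, HolAt h y →
      deriv (h ∘ (chartAt ℂ x).symm) (chartAt ℂ x y) = chartDeriv h y * c := by
  filter_upwards [eventually_mem_source x] with y hy using exists_deriv_chart hy

/-- `chartDeriv` changes chart from point to point and need not be holomorphic, but the factor
caused by the change cancels in a quotient. So dh/dg may be computed in one fixed chart. -/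
theorem HolAt.eventually_ratio {h g : X → ℂ} {x : X} (hh : HolAt h x) (hg : HolAt g x) :
    ∀ᶠ y in 𝓝 x, chartDeriv h y / chartDeriv g y =
      PlanarityDefect.derivIn x h y / PlanarityDefect.derivIn x g y := by
  filter_upwards [HolAt.eventually_deriv x, hh.eventually, hg.eventually] with y hy h1 h2
  obtain ⟨c, hc, key⟩ := hy
  rw [PlanarityDefect.derivIn, PlanarityDefect.derivIn, key h h1, key g h2,
    mul_div_mul_right _ _ hc]

theorem HolAt.eventually_chartDeriv_ne {h : X → ℂ} {x : X} (hh : HolAt h x)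
    (hc : ¬ ∀ᶠ y in 𝓝 x, h y = h x) : ∀ᶠ y in 𝓝[≠] x, chartDeriv h y ≠ 0 := by
  rcases hh.derivIn.eventually_eq_zero_or with h1 | h1
  · exact absurd (hh.eventually_const_of_derivIn h1) hc
  · filter_upwards [h1, nhdsWithin_le_nhds hh.eventually,
      nhdsWithin_le_nhds (HolAt.eventually_deriv x)] with y hy hhy hd h0
    obtain ⟨c, -, key⟩ := hd
    exact hy (by rw [PlanarityDefect.derivIn, key h hhy, h0, zero_mul])

/-- A function which is holomorphic off a discrete set, with removable singularities, agrees off a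
discrete set with a holomorphic function. -/
theorem exists_holomorphic_of_removable [T1Space X] {κ : X → ℂ}
    (hκ : ∀ x, ∃ h : X → ℂ, HolAt h x ∧ ∀ᶠ y in 𝓝[≠] x, κ y = h y) :
    ∃ κ' : X → ℂ, (∀ x, HolAt κ' x) ∧ ∀ x, ∀ᶠ y in 𝓝[≠] x, κ y = κ' y := by
  choose h hh he using hκ
  have key : ∀ x, ∀ᶠ y in 𝓝 x, h x y = h y y := by
    intro x
    have h1 := eventually_eventually_nhdsWithin.2 (he x)
    rw [eventually_nhdsWithin_iff] at h1
    filter_upwards [h1, (hh x).eventually] with y hy hhy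
    by_cases hne : y = x
    · rw [hne]
    · have h2 : ∀ᶠ y' in 𝓝[≠] y, κ y' = h x y' := by
        have h3 := hy hne
        rw [nhdsWithin_eq_nhds.2 (isOpen_compl_singleton.mem_nhds hne)] at h3
        exact nhdsWithin_le_nhds h3
      exact ((hhy.eventually_eq_of_punctured (hh y)
        (h2.mp ((he y).mono fun _ a b => b.symm.trans a))).self_of_nhds)
  refine ⟨fun y => h y y, fun x => (hh x).congr (key x), fun x => ?_⟩
  filter_upwards [he x, nhdsWithin_le_nhds (key x)] with y h1 h2
  rw [h1, h2]

theorem exists_const_of_holAt [CompactSpace X] [ConnectedSpace X] {κ : X → ℂ}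
    (hκ : ∀ x, HolAt κ x) : ∃ c, ∀ x, κ x = c := by
  obtain ⟨c, hc⟩ := MDifferentiable.exists_eq_const_of_compactSpace (I := 𝓘(ℂ))
    (fun x => (hκ x).mdifferentiableAt)
  exact ⟨c, fun x => congrFun hc x⟩

end Manifold

/-! ### Identity principle and finiteness of discrete sets -/

section Identity

variable {X : Type*} [TopologicalSpace X]

/-- The identity principle, for a set which is locally the zero set of a holomorphic function. -/
theorem eq_univ_or_forall_punctured [PreconnectedSpace X] {Z : Set X}
    (hZ : ∀ x, (∀ᶠ y in 𝓝 x, y ∈ Z) ∨ ∀ᶠ y in 𝓝[≠] x, y ∉ Z) :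
    Z = univ ∨ ∀ x, ∀ᶠ y in 𝓝[≠] x, y ∉ Z := by
  have ho : IsOpen (interior Z) := isOpen_interior
  have hc : IsClosed (interior Z) := by
    refine isClosed_of_closure_subset fun x hx => ?_
    rcases hZ x with h | h
    · exact mem_interior_iff_mem_nhds.2 h
    · rw [eventually_nhdsWithin_iff] at h
      obtain ⟨y, hy, hyZ⟩ := mem_closure_iff_nhds.1 hx _ h
      by_cases hne : y = x
      · rwa [← hne]
      · exact absurd (interior_subset hyZ) (hy hne)
  rcases isClopen_iff.1 ⟨hc, ho⟩ with h | h
  · right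
    intro x
    refine (hZ x).resolve_left fun h' => ?_
    have : x ∈ interior Z := mem_interior_iff_mem_nhds.2 h'
    rw [h] at this
    exact this
  · left
    exact eq_univ_of_univ_subset (h ▸ interior_subset)

theorem finite_of_forall_punctured [CompactSpace X] {Z : Set X}
    (hZ : ∀ x, ∀ᶠ y in 𝓝[≠] x, y ∉ Z) : Z.Finite := by
  by_contra h
  obtain ⟨x, -, hx⟩ := Set.Infinite.exists_accPt_of_subset_isCompact h isCompact_univ
    (subset_univ _)
  rw [accPt_iff_frequently_nhdsNE] at hx
  exact hx (hZ x)

theorem eventually_notMem_of_finite [T1Space X] {Z : Set X} (hZ : Z.Finite) (x : X) :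
    ∀ᶠ y in 𝓝[≠] x, y ∉ Z := by
  have : (Z \ {x})ᶜ ∈ 𝓝 x := (hZ.subset sdiff_subset).isClosed.isOpen_compl.mem_nhds (by simp)
  rw [eventually_nhdsWithin_iff]
  filter_upwards [this] with y hy hne hyZ
  exact hy ⟨hyZ, hne⟩

end Identity

theorem exists_analyticAt_eq_sub_mul {c : ℂ → ℂ} {w : ℂ} (hc : AnalyticAt ℂ c w) (h0 : c w = 0) :
    ∃ d : ℂ → ℂ, AnalyticAt ℂ d w ∧ ∀ z, c z = (z - w) * d z := by
  refine ⟨dslope c w, ?_, fun z => ?_⟩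
  · obtain ⟨p, hp⟩ := hc
    exact ⟨_, hp.has_fpower_series_dslope_fslope⟩
  · have := sub_smul_dslope c w z
    rw [h0, sub_zero, smul_eq_mul] at this
    exact this.symm

/-! ### Frames of the push-forward, fibre counts and ramification -/

section Frame

variable {X : Type*} [TopologicalSpace X] [ChartedSpace ℂ X]

/-- The holomorphic functions `b i` form a frame of the push-forward of the structure sheaf under
the proper map `t : Y → ℂ`. -/
structure IsFrame {N : ℕ} (Y : Set X) (t : X → ℂ) (b : Fin N → X → ℂ) : Prop where
  isOpen : IsOpen Y
  hol_t : ∀ x ∈ Y, HolAt t x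
  hol_b : ∀ i, ∀ x ∈ Y, HolAt (b i) x
  finite_fibre : ∀ w, {x | x ∈ Y ∧ t x = w}.Finite
  proper : ∀ (w : ℂ) (V : Set X), IsOpen V → (∀ x ∈ Y, t x = w → x ∈ V) →
    ∃ W, IsOpen W ∧ w ∈ W ∧ ∀ x ∈ Y, t x ∈ W → x ∈ V
  span : ∀ (W : Set ℂ) (h : X → ℂ), IsOpen W → (∀ x ∈ Y, t x ∈ W → HolAt h x) →
    ∃ c : Fin N → ℂ → ℂ, (∀ i, DifferentiableOn ℂ (c i) W) ∧
      ∀ x ∈ Y, t x ∈ W → h x = ∑ i, c i (t x) * b i x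
  indep : ∀ (W : Set ℂ) (c : Fin N → ℂ → ℂ), IsOpen W → (∀ i, DifferentiableOn ℂ (c i) W) →
    (∀ x ∈ Y, t x ∈ W → ∑ i, c i (t x) * b i x = 0) → ∀ i, ∀ w ∈ W, c i w = 0

/-- At an unramified point `h` is a holomorphic function of `t`, so its zero can be divided out in
the variable `t`. -/
theorem HolAt.exists_eq_sub_mul {t h : X → ℂ} {x : X} (ht : HolAt t x) (hd : chartDeriv t x ≠ 0)
    (hh : HolAt h x) (h0 : h x = 0) :
    ∃ k, HolAt k x ∧ ∀ᶠ y in 𝓝 x, h y = (t y - t x) * k y := by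
  obtain ⟨H, hH, e⟩ := ht.exists_eq_comp hd hh
  obtain ⟨d, hd, hd'⟩ := exists_analyticAt_eq_sub_mul hH (by rw [← e.self_of_nhds, h0])
  exact ⟨fun y => d (t y), HolAt.comp hd ht, by
    filter_upwards [e] with y hy
    rw [hy, hd']⟩

/-- Evaluation at the centre kills the constant, and then the coordinate cancels. Iteration peels
off Taylor coefficients one at a time. -/
theorem HolAt.eq_zero_of_coord_mul {h k : X → ℂ} {x : X} (hh : HolAt h x) (hk : HolAt k x) {c : ℂ}
    (e : ∀ᶠ y in 𝓝 x, c + PlanarityDefect.coord x y * h y = PlanarityDefect.coord x y * k y) :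
    c = 0 ∧ ∀ᶠ y in 𝓝 x, h y = k y := by
  have hc : c = 0 := by simpa using e.self_of_nhds
  refine ⟨hc, hh.eventually_eq_of_punctured hk ?_⟩
  filter_upwards [nhdsWithin_le_nhds e, eventually_coord_ne x] with y hy hne
  rw [hc, zero_add] at hy
  exact mul_left_cancel₀ hne hy

namespace IsFrame

variable {N : ℕ} {Y : Set X} {t : X → ℂ} {b : Fin N → X → ℂ}

theorem not_eventually_const [T1Space X] (F : IsFrame Y t b) {x : X} (hx : x ∈ Y) :
    ∀ᶠ y in 𝓝[≠] x, t y ≠ t x := by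
  have := eventually_notMem_of_finite (F.finite_fibre (t x)) x
  filter_upwards [this, nhdsWithin_le_nhds (F.isOpen.mem_nhds hx)] with y hy hyY h
  exact hy ⟨hyY, h⟩

section

variable [T2Space X]

theorem exists_eq_sq_mul_of_chartDeriv (F : IsFrame Y t b) {x : X} (hx : x ∈ Y)
    (hd : chartDeriv t x = 0) :
    ∃ (m : ℕ) (k : X → ℂ), HolAt k x ∧ k x ≠ 0 ∧
      ∀ᶠ y in 𝓝 x, t y - t x = coord x y ^ (m + 2) * k y := by
  have ht := F.hol_t x hx
  have hs := ht.sub (HolAt.const (t x) x)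
  obtain ⟨m, k, hk, hk0, e⟩ := hs.factor fun h0 => by
    obtain ⟨y, h1, h2⟩ := ((F.not_eventually_const hx).and (nhdsWithin_le_nhds h0)).exists
    exact h1 (sub_eq_zero.1 h2)
  match m, e with
  | 0, e => exact absurd e.self_of_nhds (by simpa using Ne.symm hk0)
  | 1, e =>
    have h1 := HolAt.chartDeriv_congr e
    rw [ht.chartDeriv_sub (HolAt.const _ x), hd] at h1
    simp only [pow_one] at h1
    rw [(HolAt.coord x).chartDeriv_mul hk] at h1
    simp [Ne.symm hk0] at h1
  | m + 2, e => exact ⟨m, k, hk, hk0, e⟩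

/-- Without ramification the frame is linearly independent along the fibre. -/
theorem linearIndependent_fibre (F : IsFrame Y t b) (w : ℂ)
    (hd : ∀ x ∈ Y, t x = w → chartDeriv t x ≠ 0) :
    LinearIndependent ℂ fun (i : Fin N) (x : {x | x ∈ Y ∧ t x = w}) => b i x := by
  classical
  rw [Fintype.linearIndependent_iff]
  intro c hc
  have h0 : ∀ x ∈ Y, t x = w → ∑ i, c i * b i x = 0 := fun x hx hxw => by
    simpa using congrFun hc ⟨x, hx, hxw⟩
  have hh : ∀ x ∈ Y, HolAt (fun y => ∑ i, c i * b i y) x := fun x hx =>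
    HolAt.sum fun i _ => (HolAt.const _ x).mul (F.hol_b i x hx)
  have hk : ∀ x, ∃ k, x ∈ Y → t x = w → HolAt k x ∧
      ∀ᶠ y in 𝓝 x, ∑ i, c i * b i y = (t y - w) * k y := by
    intro x
    by_cases hx : x ∈ Y ∧ t x = w
    · obtain ⟨k, hk, e⟩ := (F.hol_t x hx.1).exists_eq_sub_mul (hd x hx.1 hx.2) (hh x hx.1)
        (h0 x hx.1 hx.2)
      exact ⟨k, fun _ _ => ⟨hk, by simpa only [hx.2] using e⟩⟩
    · exact ⟨0, fun h1 h2 => absurd ⟨h1, h2⟩ hx⟩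
  choose k hk using hk
  -- The combination vanishes along an unramified fibre, hence is divisible by t - w. The first
  -- branch fills in the removable singularities of the quotient.
  let K : X → ℂ := fun y => if t y = w then k y y else (∑ i, c i * b i y) / (t y - w)
  have hKe : ∀ x ∈ Y, ∑ i, c i * b i x = (t x - w) * K x := by
    intro x hx
    by_cases hxw : t x = w
    · simp [h0 x hx hxw, hxw]
    · simp only [K, if_neg hxw]
      field_simp [sub_ne_zero.2 hxw]
  have hK : ∀ x ∈ Y, HolAt K x := by
    intro x hx
    by_cases hxw : t x = w
    · refine (hk x hx hxw).1.congr ?_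
      have h1 := F.not_eventually_const hx
      rw [eventually_nhdsWithin_iff] at h1
      filter_upwards [(hk x hx hxw).2, h1, F.isOpen.mem_nhds hx] with y h2 h3 hy
      by_cases hyx : y = x
      · simp [K, hyx, hxw]
      · have h4 : t y ≠ w := hxw ▸ h3 hyx
        rw [hKe y hy] at h2
        exact (mul_left_cancel₀ (sub_ne_zero.2 h4) h2).symm
    · have h1 : ∀ᶠ y in 𝓝 x, t y ≠ w := (F.hol_t x hx).continuousAt.eventually_ne hxw
      refine ((hh x hx).div ((F.hol_t x hx).sub (HolAt.const w x)) (sub_ne_zero.2 hxw)).congr ?_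
      filter_upwards [h1] with y hy
      simp [K, hy]
  -- Expanding the quotient with coefficients d, uniqueness of coefficients gives c i = (z - w) d i
  -- z for all z; take z = w.
  obtain ⟨d, hd, e⟩ := F.span univ K isOpen_univ fun x hx _ => hK x hx
  have h1 := F.indep univ (fun i z => c i - (z - w) * d i z) isOpen_univ
    (fun i => (differentiableOn_const _).sub
      ((differentiableOn_id.sub (differentiableOn_const _)).mul (hd i))) fun x hx _ => by
      simp only [sub_mul _ _ (b _ x), Finset.sum_sub_distrib, hKe x hx, e x hx trivial,
        Finset.mul_sum]
      rw [sub_eq_zero]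
      exact Finset.sum_congr rfl fun i _ => by ring
  intro i
  simpa using h1 i w trivial

theorem le_ncard_fibre (F : IsFrame Y t b) (w : ℂ)
    (hd : ∀ x ∈ Y, t x = w → chartDeriv t x ≠ 0) : N ≤ {x | x ∈ Y ∧ t x = w}.ncard := by
  have := (F.finite_fibre w).fintype
  rw [← Nat.card_coe_set_eq, Nat.card_eq_fintype_card]
  simpa using (F.linearIndependent_fibre w hd).fintype_card_le_finrank

variable [IsManifold 𝓘(ℂ) ω X]

/-- Germs prescribed along a fibre are given by one section. -/
theorem exists_section (F : IsFrame Y t b) (w : ℂ) (h : X → X → ℂ)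
    (hh : ∀ x ∈ Y, t x = w → HolAt (h x) x) :
    ∃ c : Fin N → ℂ → ℂ, (∀ i, AnalyticAt ℂ (c i) w) ∧
      ∀ x ∈ Y, t x = w → ∀ᶠ y in 𝓝 x, h x y = ∑ i, c i (t y) * b i y := by
  classical
  obtain ⟨U, hU, hd⟩ := (F.finite_fibre w).t2_separation
  have hV : ∀ x, ∃ V, IsOpen V ∧ V ⊆ U x ∧ (x ∈ Y → t x = w → x ∈ V ∧ ∀ y ∈ V, HolAt (h x) y) := by
    intro x
    by_cases hx : x ∈ Y ∧ t x = w
    · obtain ⟨V, hV, hVo, hxV⟩ := eventually_nhds_iff.1 (hh x hx.1 hx.2).eventually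
      exact ⟨V ∩ U x, hVo.inter (hU x).2, inter_subset_right,
        fun _ _ => ⟨⟨hxV, (hU x).1⟩, fun y hy => hV y hy.1⟩⟩
    · exact ⟨∅, isOpen_empty, empty_subset _, fun h1 h2 => absurd ⟨h1, h2⟩ hx⟩
  choose V hVo hVU hV using hV
  obtain ⟨W, hWo, hwW, hW⟩ := F.proper w (⋃ x ∈ {x | x ∈ Y ∧ t x = w}, V x)
    (isOpen_biUnion fun x _ => hVo x)
    fun x hx hxw => mem_biUnion (show x ∈ {x | x ∈ Y ∧ t x = w} from ⟨hx, hxw⟩) (hV x hx hxw).1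
  -- The germs live on disjoint neighbourhoods, so the chosen x is unique. By properness the default
  -- 0 does not occur over `W`.
  let H : X → ℂ := fun y => if hy : ∃ x, (x ∈ Y ∧ t x = w) ∧ y ∈ V x then h hy.choose y else 0
  have hH : ∀ x, x ∈ Y → t x = w → ∀ y ∈ V x, H y = h x y := by
    intro x hx hxw y hy
    have hy' : ∃ x, (x ∈ Y ∧ t x = w) ∧ y ∈ V x := ⟨x, ⟨hx, hxw⟩, hy⟩
    have : hy'.choose = x := by
      by_contra hne
      exact (Set.disjoint_left.1 (hd hy'.choose_spec.1 ⟨hx, hxw⟩ hne))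
        (hVU _ hy'.choose_spec.2) (hVU _ hy)
    simp only [H, dif_pos hy', this]
  obtain ⟨c, hc, e⟩ := F.span W H hWo fun x hx hxW => by
    obtain ⟨x', hx', hxV⟩ := mem_iUnion₂.1 (hW x hx hxW)
    refine ((hV x' hx'.1 hx'.2).2 x hxV).congr ?_
    filter_upwards [(hVo x').mem_nhds hxV] with y hy
    exact (hH x' hx'.1 hx'.2 y hy).symm
  refine ⟨c, fun i => (hc i).analyticAt (hWo.mem_nhds hwW), fun x hx hxw => ?_⟩
  filter_upwards [(hVo x).mem_nhds (hV x hx hxw).1, F.isOpen.mem_nhds hx,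
    (F.hol_t x hx).continuousAt.preimage_mem_nhds (hWo.mem_nhds (hxw ▸ hwW))] with y h1 h2 h3
  rw [← hH x hx hxw y h1, e y h2 h3]

/-- Germs along a fibre which are linearly independent modulo `t - w` are at most `N` in number. -/
theorem card_le (F : IsFrame Y t b) (w : ℂ) {ι : Type*} [Fintype ι] (h : ι → X → X → ℂ)
    (hh : ∀ a, ∀ x ∈ Y, t x = w → HolAt (h a x) x)
    (hind : ∀ α : ι → ℂ, (∀ x ∈ Y, t x = w → ∃ k, HolAt k x ∧
      ∀ᶠ y in 𝓝 x, ∑ a, α a * h a x y = (t y - w) * k y) → ∀ a, α a = 0) :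
    Fintype.card ι ≤ N := by
  choose c hc e using fun a => F.exists_section w (h a) (hh a)
  -- A relation between the coefficient vectors at w makes all coefficients of the combined section
  -- divisible by z - w, so the combined germ is divisible by t - w.
  have hli : LinearIndependent ℂ fun a (i : Fin N) => c a i w := by
    rw [Fintype.linearIndependent_iff]
    intro α hα
    have hα' : ∀ i, ∑ a, α a * c a i w = 0 := fun i => by simpa using congrFun hα i
    have hd : ∀ i, ∃ d : ℂ → ℂ, AnalyticAt ℂ d w ∧
        ∀ z, ∑ a, α a * c a i z = (z - w) * d z := fun i =>
      exists_analyticAt_eq_sub_mul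
        (Finset.analyticAt_fun_sum _ fun a _ => analyticAt_const.mul (hc a i)) (hα' i)
    choose d hd hd' using hd
    refine hind α fun x hx hxw => ⟨fun y => ∑ i, d i (t y) * b i y, ?_, ?_⟩
    · exact HolAt.sum fun i _ => (HolAt.comp (hxw ▸ hd i) (F.hol_t x hx)).mul (F.hol_b i x hx)
    · have := eventually_all.2 fun a => e a x hx hxw
      filter_upwards [this] with y hy
      simp only [hy, Finset.mul_sum]
      rw [Finset.sum_comm]
      refine Finset.sum_congr rfl fun i _ => ?_
      rw [← mul_assoc, ← hd', Finset.sum_mul]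
      exact Finset.sum_congr rfl fun a _ => by ring
  simpa using hli.fintype_card_le_finrank

/-- The indicators of the fibre points, as locally constant germs, are independent modulo t - w, as
evaluation at the points shows. -/
theorem ncard_fibre_le (F : IsFrame Y t b) (w : ℂ) : {x | x ∈ Y ∧ t x = w}.ncard ≤ N := by
  classical
  have := (F.finite_fibre w).fintype
  rw [← Nat.card_coe_set_eq, Nat.card_eq_fintype_card]
  refine F.card_le w (fun (a : {x | x ∈ Y ∧ t x = w}) x _ => if x = a then 1 else 0)
    (fun a x _ _ => HolAt.const _ x) fun α hα a => ?_
  obtain ⟨k, -, e⟩ := hα a a.2.1 a.2.2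
  have := e.self_of_nhds
  simpa [a.2.2, Subtype.coe_inj] using this

/-- Germs vanishing on the fibre but not divisible by t - w measure ramification. Two independent
ones, added to the indicators, show that at least two points of the fibre are missing. -/
theorem ncard_fibre_add_two_le (F : IsFrame Y t b) (w : ℂ) (g₁ g₂ : X → X → ℂ)
    (hg₁ : ∀ x ∈ Y, t x = w → HolAt (g₁ x) x) (hg₂ : ∀ x ∈ Y, t x = w → HolAt (g₂ x) x)
    (hg₁' : ∀ x, g₁ x x = 0) (hg₂' : ∀ x, g₂ x x = 0)
    (hind : ∀ α β : ℂ, (∀ x ∈ Y, t x = w → ∃ k, HolAt k x ∧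
      ∀ᶠ y in 𝓝 x, α * g₁ x y + β * g₂ x y = (t y - w) * k y) → α = 0 ∧ β = 0) :
    {x | x ∈ Y ∧ t x = w}.ncard + 2 ≤ N := by
  classical
  have := (F.finite_fibre w).fintype
  rw [← Nat.card_coe_set_eq, Nat.card_eq_fintype_card]
  have h2 : Fintype.card {x | x ∈ Y ∧ t x = w} + 2 =
      Fintype.card ({x | x ∈ Y ∧ t x = w} ⊕ Fin 2) := by simp
  rw [h2]
  refine F.card_le w (fun a x y => Sum.elim
    (fun (a : {x | x ∈ Y ∧ t x = w}) => if x = a then 1 else 0) ![g₁ x y, g₂ x y] a) ?_ ?_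
  · rintro (a | a) x hx hxw
    · exact HolAt.const _ x
    · fin_cases a
      · exact hg₁ x hx hxw
      · exact hg₂ x hx hxw
  · intro α hα
    simp only [Fintype.sum_sum_type, Sum.elim_inl, Sum.elim_inr, Fin.sum_univ_two,
      Matrix.cons_val_zero, Matrix.cons_val_one] at hα
    have h1 : ∀ a : {x | x ∈ Y ∧ t x = w}, α (Sum.inl a) = 0 := by
      intro a
      obtain ⟨k, -, e⟩ := hα a a.2.1 a.2.2
      have := e.self_of_nhds
      simpa [a.2.2, Subtype.coe_inj, hg₁', hg₂'] using this
    simp only [h1, zero_mul, Finset.sum_const_zero, zero_add] at hα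
    obtain ⟨h3, h4⟩ := hind _ _ hα
    rintro (a | a)
    · exact h1 a
    · fin_cases a
      · exact h3
      · exact h4

/-- If at most one point of a fibre is missing then at most one point of the fibre is ramified, and
the ramification there is simple. -/
theorem simple_of_le (F : IsFrame Y t b) {x : X} (hx : x ∈ Y) (hd : chartDeriv t x = 0)
    (hN : N ≤ {x' | x' ∈ Y ∧ t x' = t x}.ncard + 1) :
    (∀ x' ∈ Y, t x' = t x → x' ≠ x → chartDeriv t x' ≠ 0) ∧
      ∃ k : X → ℂ, HolAt k x ∧ k x ≠ 0 ∧ ∀ᶠ y in 𝓝 x, t y - t x = coord x y ^ 2 * k y := by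
  classical
  constructor
  · intro x' hx' hxx hne hd'
    -- Two ramified points: the coordinate at each one, extended by 0 to the other germs, gives two
    -- independent classes modulo t - t x.
    refine absurd (F.ncard_fibre_add_two_le (t x)
      (fun z y => if z = x then coord z y else 0) (fun z y => if z = x' then coord z y else 0)
      ?_ ?_ (by simp) (by simp) ?_) (by omega)
    · intro z _ _
      by_cases h : z = x
      · simpa [h] using HolAt.coord x
      · simpa [h] using HolAt.const 0 z
    · intro z _ _
      by_cases h : z = x'
      · simpa [h] using HolAt.coord x'
      · simpa [h] using HolAt.const 0 z
    · have key : ∀ z ∈ Y, t z = t x → chartDeriv t z = 0 → ∀ α : ℂ,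
          (∃ k, HolAt k z ∧ ∀ᶠ y in 𝓝 z, α * coord z y = (t y - t x) * k y) → α = 0 := by
        rintro z hz hzx hdz α ⟨k, hk, e⟩
        obtain ⟨m, k', hk', -, e'⟩ := F.exists_eq_sq_mul_of_chartDeriv hz hdz
        have := (HolAt.const α z).eq_zero_of_coord_mul (c := 0)
          ((((HolAt.coord z).pow (m + 1)).mul hk').mul hk) (by
            filter_upwards [e, e'] with y h1 h2
            rw [hzx] at h2
            rw [zero_add, mul_comm, h1, h2]; ring)
        simpa using this.2.self_of_nhds
      intro α β h
      refine ⟨key x hx rfl hd α ?_, key x' hx' hxx hd' β ?_⟩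
      · simpa [hne.symm] using h x hx rfl
      · simpa [hne] using h x' hx' hxx
  · obtain ⟨m, k, hk, hk0, e⟩ := F.exists_eq_sq_mul_of_chartDeriv hx hd
    obtain _ | m := m
    · exact ⟨k, hk, hk0, e⟩
    -- Ramification index at least 3: the coordinate and its square are independent modulo t - t x.
    refine absurd (F.ncard_fibre_add_two_le (t x)
      (fun z y => if z = x then coord z y else 0) (fun z y => if z = x then coord z y ^ 2 else 0)
      ?_ ?_ (by simp) (by simp) ?_) (by omega)
    · intro z _ _
      by_cases h : z = x
      · simpa [h] using HolAt.coord x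
      · simpa [h] using HolAt.const 0 z
    · intro z _ _
      by_cases h : z = x
      · simpa [h] using (HolAt.coord x).pow 2
      · simpa [h] using HolAt.const 0 z
    · intro α β h
      obtain ⟨k', hk', e'⟩ := h x hx rfl
      simp only [if_true] at e'
      have hu := HolAt.coord x
      have hβ := (HolAt.const β x).mul hu
      have hr := (((hu.pow (m + 1)).mul hk).mul hk')
      have h1 := ((HolAt.const α x).add hβ).eq_zero_of_coord_mul (c := 0) (hu.mul hr) (by
        filter_upwards [e, e'] with y h1 h2
        linear_combination h2 + k' y * h1)
      have h2 := (HolAt.const β x).eq_zero_of_coord_mul (c := α) hr (by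
        filter_upwards [h1.2] with y hy
        linear_combination hy)
      exact ⟨h2.1, by simpa using h2.2.self_of_nhds⟩

theorem ncard_fibre_eq (F : IsFrame Y t b) (w : ℂ)
    (hd : ∀ x ∈ Y, t x = w → chartDeriv t x ≠ 0) : {x | x ∈ Y ∧ t x = w}.ncard = N :=
  (F.ncard_fibre_le w).antisymm (F.le_ncard_fibre w hd)

end

end IsFrame

end Frame

/-! ### Entire functions with polynomial growth: sections of 𝒪(m) -/

section Growth

/-- An entire function of polynomial growth, with holomorphic continuation to infinity, is a
polynomial. -/
theorem exists_coeff_of_growth (m : ℕ) {c c' : ℂ → ℂ} (hc : Differentiable ℂ c)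
    (hc' : Differentiable ℂ c') (h : ∀ w, w ≠ 0 → c w⁻¹ * w ^ m = c' w) :
    ∃ a : ℕ → ℂ, (∀ u, c u = ∑ l ∈ Finset.range (m + 1), a l * u ^ l) ∧
      ∀ w, c' w = ∑ l ∈ Finset.range (m + 1), a l * w ^ (m - l) := by
  induction m generalizing c c' with
  | zero =>
    have h' : ∀ w, w ≠ 0 → c w⁻¹ = c' w := by simpa using h
    -- Outside the unit disc c(u) = c'(1/u), so both regions are covered by compact images and
    -- Liouville applies.
    have hb : Bornology.IsBounded (range c) := by
      have h1 := (isCompact_closedBall (0 : ℂ) 1).image hc.continuous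
      have h2 := (isCompact_closedBall (0 : ℂ) 1).image hc'.continuous
      refine (h1.isBounded.union h2.isBounded).subset ?_
      rintro _ ⟨u, rfl⟩
      by_cases hu : ‖u‖ ≤ 1
      · exact Or.inl ⟨u, by simpa using hu, rfl⟩
      · have hu0 : u ≠ 0 := fun h0 => hu (by simp [h0])
        refine Or.inr ⟨u⁻¹, ?_, by rw [← h' _ (inv_ne_zero hu0), inv_inv]⟩
        simpa using inv_le_one_of_one_le₀ (not_le.1 hu).le
    have hconst : ∀ u, c u = c 0 := fun u => hc.apply_eq_apply_of_bounded hb u 0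
    have h1 : ∀ w, w ≠ 0 → c' w = c 0 := fun w hw => by rw [← h' w hw, hconst]
    have h2 : c' 0 = c 0 := by
      have h3 : (fun w => c' w) =ᶠ[𝓝[≠] (0 : ℂ)] fun _ => c 0 := by
        filter_upwards [self_mem_nhdsWithin] with w hw using h1 w hw
      exact tendsto_nhds_unique
        ((hc'.continuous.tendsto 0).mono_left nhdsWithin_le_nhds)
        (tendsto_const_nhds.congr' h3.symm)
    refine ⟨fun _ => c 0, fun u => by simp [hconst u], fun w => ?_⟩
    by_cases hw : w = 0
    · simp [hw, h2]
    · simp [h1 w hw]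
  | succ m ih =>
    have hd : Differentiable ℂ (dslope c 0) := by
      rw [← differentiableOn_univ] at hc ⊢
      exact (Complex.differentiableOn_dslope univ_mem).2 hc
    have hs : ∀ u, c u = c 0 + u * dslope c 0 u := fun u => by
      have := sub_smul_dslope c 0 u
      rw [sub_zero, smul_eq_mul] at this
      rw [this]; ring
    -- Splitting off the constant term, c = c(0) + u c₁(u), lowers the growth exponent of the
    -- remaining factor by one.
    obtain ⟨a, ha, ha'⟩ := ih (c := dslope c 0) (c' := fun w => c' w - c 0 * w ^ (m + 1)) hd
      (hc'.sub ((differentiable_const _).mul (differentiable_id.pow _))) fun w hw => by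
        rw [← h w hw, hs w⁻¹]
        field_simp
        ring
    refine ⟨fun l => if l = 0 then c 0 else a (l - 1), fun u => ?_, fun w => ?_⟩
    · rw [Finset.sum_range_succ', hs u, ha u, Finset.mul_sum, add_comm]
      simp only [Nat.succ_ne_zero, if_false, if_true, Nat.add_sub_cancel, pow_zero, mul_one]
      congr 1
      exact Finset.sum_congr rfl fun l _ => by ring
    · rw [Finset.sum_range_succ']
      simp only [Nat.succ_ne_zero, if_false, if_true, Nat.add_sub_cancel, Nat.add_sub_add_right,
        Nat.sub_zero, ← ha' w]
      ring

/-- The growth lemma for exponent 0 makes c and w ^ m * c' the same constant, and the latter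
vanishes at 0. This says that 𝒪(-m) has no global sections. -/
theorem eq_zero_of_growth {m : ℕ} (hm : 0 < m) {c c' : ℂ → ℂ} (hc : Differentiable ℂ c)
    (hc' : Differentiable ℂ c') (h : ∀ w, w ≠ 0 → c w⁻¹ = w ^ m * c' w) : ∀ u, c u = 0 := by
  obtain ⟨a, ha, ha'⟩ := exists_coeff_of_growth 0 (c' := fun w => w ^ m * c' w) hc
    ((differentiable_id.pow m).mul hc') fun w hw => by simpa using h w hw
  have h0 := ha' 0
  simp only [zero_pow hm.ne', zero_mul] at h0
  intro u
  rw [ha u]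
  simpa using h0.symm

end Growth

/-! ### Glued frames and sections of the pull-back of 𝒪(1) -/

section Pair

variable {X : Type*} [TopologicalSpace X] [ChartedSpace ℂ X]

/-- Frames over the two standard affine lines of `ℂℙ¹`, with diagonal transition functions
given by the powers `k i` of the coordinate. -/
structure FramePair {N : ℕ} (k : Fin N → ℤ) (Y : Fin 2 → Set X) (t : Fin 2 → X → ℂ)
    (b : Fin 2 → Fin N → X → ℂ) : Prop where
  frame : ∀ j, IsFrame (Y j) (t j) (b j)
  cover : ∀ x, x ∈ Y 0 ∨ x ∈ Y 1
  mem_zero_iff : ∀ x ∈ Y 1, (x ∈ Y 0 ↔ t 1 x ≠ 0)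
  inv : ∀ x ∈ Y 0, x ∈ Y 1 → t 0 x = (t 1 x)⁻¹
  glue : ∀ i, ∀ x ∈ Y 0, x ∈ Y 1 → b 0 i x = t 1 x ^ k i * b 1 i x

/-- A global section of the pull-back of `𝒪(1)`, in the two standard trivializations. -/
structure IsSection (Y : Fin 2 → Set X) (t : Fin 2 → X → ℂ) (g : Fin 2 → X → ℂ) : Prop where
  hol : ∀ j, ∀ x ∈ Y j, HolAt (g j) x
  glue : ∀ x ∈ Y 0, x ∈ Y 1 → g 0 x = t 0 x * g 1 x

/-- A section which is the pull-back of a section of `𝒪(1)` on `ℂℙ¹`. -/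
def IsLinear (Y : Fin 2 → Set X) (t : Fin 2 → X → ℂ) (g : Fin 2 → X → ℂ) : Prop :=
  ∃ α β : ℂ, (∀ x ∈ Y 0, g 0 x = α + β * t 0 x) ∧ ∀ x ∈ Y 1, g 1 x = α * t 1 x + β

namespace FramePair

variable {N : ℕ} {k : Fin N → ℤ} {Y : Fin 2 → Set X} {t : Fin 2 → X → ℂ}
  {b : Fin 2 → Fin N → X → ℂ}

/-- Comparison of the coefficients of a section with respect to the two frames. -/
theorem coeff_eq (P : FramePair k Y t b) {c c' : Fin N → ℂ → ℂ}
    (hc : ∀ i, Differentiable ℂ (c i)) (hc' : ∀ i, Differentiable ℂ (c' i)) (e : ℤ)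
    (h : ∀ x ∈ Y 0, x ∈ Y 1 →
      ∑ i, c i (t 0 x) * b 0 i x = t 1 x ^ e * ∑ i, c' i (t 1 x) * b 1 i x) (i : Fin N) :
    ∀ w, w ≠ 0 → c i w⁻¹ * w ^ k i = w ^ e * c' i w := by
  intro w hw
  have hz : ∀ e : ℤ, DifferentiableOn ℂ (fun w : ℂ => w ^ e) {0}ᶜ := fun e w hw =>
    (differentiableAt_zpow.2 (Or.inl hw)).differentiableWithinAt
  have := (P.frame 1).indep {0}ᶜ (fun i w => c i w⁻¹ * w ^ k i - w ^ e * c' i w)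
    isOpen_compl_singleton (fun i => ?_) ?_ i w hw
  · exact sub_eq_zero.1 this
  · refine DifferentiableOn.sub (DifferentiableOn.mul ?_ (hz _))
      ((hz e).mul (hc' i).differentiableOn)
    exact (hc i).differentiableOn.comp (t := univ)
      (fun w hw => (differentiableAt_inv hw).differentiableWithinAt) (fun _ _ => trivial)
  · intro x hx hw
    have hx0 := (P.mem_zero_iff x hx).2 hw
    have h1 := h x hx0 hx
    simp only [sub_mul, Finset.sum_sub_distrib]
    rw [sub_eq_zero, ← P.inv x hx0 hx]
    simp only [mul_assoc, ← Finset.mul_sum]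
    rw [← h1]
    exact Finset.sum_congr rfl fun i _ => by rw [P.glue i x hx0 hx]

/-- The gluing rule gives the formula in the second trivialization where t₁ ≠ 0. The points with t₁
= 0 are isolated, and continuation reaches them. -/
theorem isLinear_of_zero (P : FramePair k Y t b) [T2Space X] {g : Fin 2 → X → ℂ}
    (hg : IsSection Y t g) {α β : ℂ} (h : ∀ x ∈ Y 0, g 0 x = α + β * t 0 x) :
    IsLinear Y t g := by
  refine ⟨α, β, h, fun x hx => ?_⟩
  have h1 : ∀ x ∈ Y 1, x ∈ Y 0 → g 1 x = α * t 1 x + β := by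
    intro x hx hx0
    have h2 := h x hx0
    have h3 := (P.mem_zero_iff x hx).1 hx0
    rw [hg.glue x hx0 hx, P.inv x hx0 hx] at h2
    field_simp at h2
    linear_combination h2
  have ht := (P.frame 1).hol_t x hx
  refine HolAt.eventually_eq_of_punctured (hg.hol 1 x hx)
    (((HolAt.const α x).mul ht).add (HolAt.const β x)) ?_ |>.self_of_nhds
  by_cases h0 : t 1 x = 0
  · filter_upwards [(P.frame 1).not_eventually_const hx,
      nhdsWithin_le_nhds ((P.frame 1).isOpen.mem_nhds hx)] with y h2 hy
    exact h1 y hy ((P.mem_zero_iff y hy).2 (h0 ▸ h2))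
  · filter_upwards [nhdsWithin_le_nhds (ht.continuousAt.eventually_ne h0),
      nhdsWithin_le_nhds ((P.frame 1).isOpen.mem_nhds hx)] with y h2 hy
    exact h1 y hy ((P.mem_zero_iff y hy).2 h2)

theorem not_all_zero (P : FramePair k Y t b) (i : Fin N) : ¬ ∀ x ∈ Y 0, b 0 i x = 0 := by
  classical
  intro h
  have := (P.frame 0).indep univ (fun l _ => if l = i then 1 else 0) isOpen_univ
    (fun l => differentiableOn_const _) (fun x hx _ => by simp [h x hx]) i 0 trivial
  simp at this

variable [IsManifold 𝓘(ℂ) ω X]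

/-- A frame element of nonnegative weight is constant over the first affine line. -/
theorem exists_const_of_nonneg [CompactSpace X] [ConnectedSpace X] (P : FramePair k Y t b)
    {i : Fin N} (hk : 0 ≤ k i) : ∃ β : ℂ, ∀ x ∈ Y 0, b 0 i x = β := by
  classical
  obtain ⟨m, hm⟩ := Int.eq_ofNat_of_zero_le hk
  -- For weight m ≥ 0 the gluing factor has no pole at t₁ = 0, so the frame element extends to a
  -- holomorphic function on the whole compact surface.
  let γ : X → ℂ := fun x => if x ∈ Y 0 then b 0 i x else t 1 x ^ m * b 1 i x
  have h0 : ∀ x ∈ Y 0, γ x = b 0 i x := fun x hx => if_pos hx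
  have h1 : ∀ x ∈ Y 1, γ x = t 1 x ^ m * b 1 i x := by
    intro x hx
    by_cases hx0 : x ∈ Y 0
    · rw [h0 x hx0, P.glue i x hx0 hx, hm, zpow_natCast]
    · exact if_neg hx0
  obtain ⟨β, hβ⟩ := exists_const_of_holAt (κ := γ) fun x => by
    rcases P.cover x with hx | hx
    · refine ((P.frame 0).hol_b i x hx).congr ?_
      filter_upwards [(P.frame 0).isOpen.mem_nhds hx] with y hy using (h0 y hy).symm
    · refine ((((P.frame 1).hol_t x hx).pow m).mul ((P.frame 1).hol_b i x hx)).congr ?_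
      filter_upwards [(P.frame 1).isOpen.mem_nhds hx] with y hy using (h1 y hy).symm
  exact ⟨β, fun x hx => by rw [← h0 x hx, hβ]⟩

/-- Frame elements of nonnegative weight are constants over `Y 0`, and two constants are linearly
dependent. -/
theorem eq_of_nonneg [CompactSpace X] [ConnectedSpace X] (P : FramePair k Y t b)
    {i i' : Fin N} (hk : 0 ≤ k i) (hk' : 0 ≤ k i') : i = i' := by
  classical
  by_contra hne
  obtain ⟨β, hβ⟩ := P.exists_const_of_nonneg hk
  obtain ⟨β', hβ'⟩ := P.exists_const_of_nonneg hk'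
  have := (P.frame 0).indep univ (fun l _ => if l = i then β' else if l = i' then -β else 0)
    isOpen_univ (fun l => differentiableOn_const _) (fun x hx _ => by
      rw [← Finset.sum_subset (Finset.subset_univ {i, i'}) (fun l _ hl => by
        simp only [Finset.mem_insert, Finset.mem_singleton, not_or] at hl
        simp [hl.1, hl.2])]
      rw [Finset.sum_pair hne]
      simp [hβ x hx, hβ' x hx, Ne.symm hne, mul_comm]) i 0 trivial
  simp only [if_true] at this
  exact P.not_all_zero i' fun x hx => by rw [hβ' x hx, this]

/-- A frame element of weight -1 glues by 1/t₁ = t₀, the rule of 𝒪(1), so it is itself such a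
section. The element of weight 0 is a nonzero constant, so linearity would give a relation between
two distinct frame elements. -/
theorem exists_not_isLinear [CompactSpace X] [ConnectedSpace X] (P : FramePair k Y t b)
    {i₀ i : Fin N} (h₀ : k i₀ = 0) (hi : k i = -1) :
    ∃ g, IsSection Y t g ∧ ¬ IsLinear Y t g := by
  classical
  have hne : i ≠ i₀ := by rintro rfl; omega
  refine ⟨fun j => b j i, ⟨fun j => (P.frame j).hol_b i, fun x h0 h1 => ?_⟩, ?_⟩
  · rw [P.glue i x h0 h1, hi, P.inv x h0 h1, zpow_neg_one]
  · rintro ⟨α, β, h, -⟩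
    obtain ⟨γ, hγ⟩ := P.exists_const_of_nonneg h₀.ge
    have hγ0 : γ ≠ 0 := fun h0 => P.not_all_zero i₀ fun x hx => by rw [hγ x hx, h0]
    have := (P.frame 0).indep univ
      (fun l z => if l = i then 1 else if l = i₀ then -(α + β * z) / γ else 0)
      isOpen_univ (fun l => by
        split_ifs
        · exact differentiableOn_const _
        · fun_prop
        · exact differentiableOn_const _) (fun x hx _ => by
        rw [← Finset.sum_subset (Finset.subset_univ {i, i₀}) (fun l _ hl => by
          simp only [Finset.mem_insert, Finset.mem_singleton, not_or] at hl
          simp [hl.1, hl.2])]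
        rw [Finset.sum_pair hne]
        simp only [if_true, if_neg hne.symm, h x hx, hγ x hx]
        field_simp
        ring) i 0 trivial
    simp at this

/-- Tensoring with 𝒪(1) raises weights by one: weights at most -2 stay negative and contribute
nothing, and the summand of weight 0 contributes polynomials of degree at most one times a constant.
-/
theorem isLinear_of_le_neg_two [CompactSpace X] [ConnectedSpace X] [T2Space X]
    (P : FramePair k Y t b) {i₀ : Fin N} (h₀ : k i₀ = 0) (hk : ∀ i, i ≠ i₀ → k i ≤ -2)
    {g : Fin 2 → X → ℂ} (hg : IsSection Y t g) : IsLinear Y t g := by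
  have hs : ∀ j, ∃ c : Fin N → ℂ → ℂ, (∀ i, Differentiable ℂ (c i)) ∧
      ∀ x ∈ Y j, g j x = ∑ i, c i (t j x) * b j i x := fun j => by
    obtain ⟨c, hc, e⟩ := (P.frame j).span univ (g j) isOpen_univ fun x hx _ => hg.hol j x hx
    exact ⟨c, fun i => differentiableOn_univ.1 (hc i), fun x hx => e x hx trivial⟩
  choose c hc e using hs
  have key := P.coeff_eq (hc 0) (hc 1) (-1) fun x h0 h1 => by
    rw [← e 0 x h0, ← e 1 x h1, hg.glue x h0 h1, P.inv x h0 h1, zpow_neg_one]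
  have hz : ∀ i, i ≠ i₀ → ∀ u, c 0 i u = 0 := by
    intro i hi
    have hki := hk i hi
    obtain ⟨m, hm⟩ := Int.eq_ofNat_of_zero_le (show 0 ≤ -1 - k i by omega)
    refine eq_zero_of_growth (m := m) (by omega) (hc 0 i) (hc 1 i) fun w hw => ?_
    have h1 := key i w hw
    rw [← zpow_natCast, show ((m : ℕ) : ℤ) = -1 - k i from hm.symm, zpow_sub₀ hw, div_mul_eq_mul_div, ← h1,
      mul_div_cancel_right₀ _ (zpow_ne_zero _ hw)]
  obtain ⟨a, ha, -⟩ := exists_coeff_of_growth 1 (hc 0 i₀) (hc 1 i₀) fun w hw => by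
    have h1 := key i₀ w hw
    rw [h₀, zpow_zero, mul_one, zpow_neg_one] at h1
    rw [h1]; field_simp
  obtain ⟨γ, hγ⟩ := P.exists_const_of_nonneg h₀.ge
  refine P.isLinear_of_zero hg (α := a 0 * γ) (β := a 1 * γ) fun x hx => ?_
  rw [e 0 x hx, Finset.sum_eq_single i₀ (fun i _ hi => by rw [hz i hi, zero_mul])
    (by simp), ha, hγ x hx]
  simp [Finset.sum_range_succ]
  ring

end FramePair
end Pair

/-! ### Characteristic polynomials of matrices of entire functions -/

section Charpoly

/-- The ring of entire functions. -/
def entireSubring : Subring (ℂ → ℂ) where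
  carrier := {c | Differentiable ℂ c}
  mul_mem' := fun ha hb => Differentiable.mul ha hb
  one_mem' := differentiable_const 1
  add_mem' := fun ha hb => Differentiable.add ha hb
  zero_mem' := differentiable_const 0
  neg_mem' := fun ha => Differentiable.neg ha

/-- The characteristic polynomial commutes with ring homomorphisms, so its coefficients can be
computed once in the ring of entire functions and then evaluated. -/
theorem differentiable_charpoly_coeff {N : ℕ} {M : Fin N → Fin N → ℂ → ℂ}
    (hM : ∀ i l, Differentiable ℂ (M i l)) (l : ℕ) :
    Differentiable ℂ fun w => (Matrix.of fun i l => M i l w).charpoly.coeff l := by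
  let A : Matrix (Fin N) (Fin N) entireSubring := Matrix.of fun i l => ⟨M i l, hM i l⟩
  have h : ∀ w, (Matrix.of fun i l => M i l w).charpoly.coeff l = (A.charpoly.coeff l).1 w := by
    intro w
    let ev : entireSubring →+* ℂ := (Pi.evalRingHom (fun _ : ℂ => ℂ) w).comp entireSubring.subtype
    have h1 : (Matrix.of fun i l => M i l w) = A.map ev := rfl
    rw [h1, Matrix.charpoly_map, Polynomial.coeff_map]
    rfl
  simp only [h]
  exact (A.charpoly.coeff l).2

theorem eval_charpoly_mul {N : ℕ} (A Q D : Matrix (Fin N) (Fin N) ℂ) (hQ : Q.det ≠ 0)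
    (h : Q * A = D * Q) : A.charpoly = D.charpoly := by
  refine Polynomial.funext fun T => ?_
  rw [Matrix.eval_charpoly, Matrix.eval_charpoly]
  have h1 : Q * (Matrix.scalar (Fin N) T - A) = (Matrix.scalar (Fin N) T - D) * Q := by
    rw [mul_sub, sub_mul, h, ((Matrix.scalar_commute T (fun _ => mul_comm _ _) Q).eq)]
  have h2 := congrArg Matrix.det h1
  rw [Matrix.det_mul, Matrix.det_mul, mul_comm] at h2
  exact mul_right_cancel₀ hQ h2

end Charpoly

/-! ### Multiplication by a section, and the equation of the plane curve -/

section Mul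

variable {X : Type*} [TopologicalSpace X] [ChartedSpace ℂ X] {N : ℕ}

/-- The matrix of multiplication by `g` with respect to the frame `b`. -/
structure IsMulMatrix (Y : Set X) (t : X → ℂ) (b : Fin N → X → ℂ) (g : X → ℂ)
    (M : ℂ → Matrix (Fin N) (Fin N) ℂ) : Prop where
  diff : ∀ i l, Differentiable ℂ fun w => M w i l
  mul_eq : ∀ x ∈ Y, ∀ l, g x * b l x = ∑ i, M (t x) i l * b i x

namespace IsFrame

variable {Y : Set X} {t : X → ℂ} {b : Fin N → X → ℂ} {g : X → ℂ}

theorem exists_mulMatrix (F : IsFrame Y t b) (hg : ∀ x ∈ Y, HolAt g x) :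
    ∃ M, IsMulMatrix Y t b g M := by
  have h : ∀ l, ∃ c : Fin N → ℂ → ℂ, (∀ i, Differentiable ℂ (c i)) ∧
      ∀ x ∈ Y, g x * b l x = ∑ i, c i (t x) * b i x := fun l => by
    obtain ⟨c, hc, e⟩ := F.span univ (fun x => g x * b l x) isOpen_univ
      fun x hx _ => (hg x hx).mul (F.hol_b l x hx)
    exact ⟨c, fun i => differentiableOn_univ.1 (hc i), fun x hx => e x hx trivial⟩
  choose c hc e using h
  exact ⟨fun w => Matrix.of fun i l => c l i w, fun i l => hc l i, fun x hx l => e l x hx⟩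

theorem exists_ne_zero (F : IsFrame Y t b) {x : X} (hx : x ∈ Y) : ∃ i, b i x ≠ 0 := by
  by_contra! h
  obtain ⟨c, -, e⟩ := F.span univ (fun _ => 1) isOpen_univ fun x _ _ => HolAt.const 1 x
  have := e x hx trivial
  simp [h] at this

/-- The eigenvalues of multiplication by `g` are the values of `g` along the fibre. -/
theorem isRoot_iff [IsManifold 𝓘(ℂ) ω X] (F : IsFrame Y t b) (hg : ∀ x ∈ Y, HolAt g x)
    {M : ℂ → Matrix (Fin N) (Fin N) ℂ} (hM : IsMulMatrix Y t b g M) (w τ : ℂ) :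
    (M w).charpoly.eval τ = 0 ↔ ∃ x ∈ Y, t x = w ∧ g x = τ := by
  rw [Matrix.eval_charpoly]
  constructor
  · intro hdet
    -- If τ is not a value of `g` on the fibre, g - τ is invertible near it by properness. The
    -- coefficients of b l / (g - τ) form, up to sign, an inverse of τ - M w.
    by_contra! hno
    have hV : IsOpen (Y ∩ g ⁻¹' {τ}ᶜ) :=
      ContinuousOn.isOpen_inter_preimage
        (fun x hx => (hg x hx).continuousAt.continuousWithinAt) F.isOpen isOpen_compl_singleton
    obtain ⟨W, hWo, hwW, hW⟩ := F.proper w _ hV fun x hx hxw => ⟨hx, hno x hx hxw⟩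
    have hne : ∀ x ∈ Y, t x ∈ W → g x - τ ≠ 0 := fun x hx hxW => sub_ne_zero.2 (hW x hx hxW).2
    choose B hB e using fun l => F.span W (fun x => b l x / (g x - τ)) hWo fun x hx hxW =>
      (F.hol_b l x hx).div ((hg x hx).sub (HolAt.const τ x)) (hne x hx hxW)
    have key : ∀ l i, ∑ j, (τ * (1 : Matrix (Fin N) (Fin N) ℂ) i j - M w i j) * B l j w =
        -(1 : Matrix (Fin N) (Fin N) ℂ) i l := by
      intro l i
      have := F.indep W (fun i z => (∑ j, (τ * (1 : Matrix (Fin N) (Fin N) ℂ) i j - M z i j) *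
        B l j z) + (1 : Matrix (Fin N) (Fin N) ℂ) i l) hWo (fun i => ?_) ?_ i w hwW
      · linear_combination this
      · refine DifferentiableOn.add (DifferentiableOn.fun_sum fun j _ => DifferentiableOn.mul
          ((differentiableOn_const _).sub (hM.diff i j).differentiableOn) (hB l j))
          (differentiableOn_const _)
      · intro x hx hxW
        have h1 := e l x hx hxW
        have h2 : ∑ j, B l j (t x) * ((g x - τ) * b j x) = b l x := by
          rw [div_eq_iff (hne x hx hxW), Finset.sum_mul] at h1
          rw [h1]
          exact Finset.sum_congr rfl fun j _ => by ring
        have h3 : ∀ j, (g x - τ) * b j x =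
            - ∑ i, (τ * (1 : Matrix (Fin N) (Fin N) ℂ) i j - M (t x) i j) * b i x := by
          intro j
          rw [sub_mul, hM.mul_eq x hx j]
          simp [sub_mul, Finset.sum_sub_distrib, Matrix.one_apply]
        simp only [h3] at h2
        simp only [add_mul, Finset.sum_add_distrib, Finset.sum_mul]
        rw [Finset.sum_comm]
        have h4 : ∑ i, (1 : Matrix (Fin N) (Fin N) ℂ) i l * b i x = b l x := by
          simp [Matrix.one_apply]
        rw [h4, ← h2, ← Finset.sum_add_distrib]
        refine Finset.sum_eq_zero fun j _ => ?_
        rw [mul_neg, Finset.mul_sum, ← sub_eq_add_neg, sub_eq_zero]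
        exact Finset.sum_congr rfl fun i _ => by ring
    have hprod : (Matrix.scalar (Fin N) τ - M w) * (Matrix.of fun j l => B l j w) = -1 := by
      ext i l
      rw [Matrix.neg_apply, ← key l i, Matrix.mul_apply]
      refine Finset.sum_congr rfl fun j _ => ?_
      simp [Matrix.scalar_apply, Matrix.diagonal_apply, Matrix.one_apply]
    have := congrArg Matrix.det hprod
    rw [Matrix.det_mul, hdet, zero_mul, Matrix.det_neg, Matrix.det_one, mul_one] at this
    exact pow_ne_zero _ (by norm_num) this.symm
  · rintro ⟨x, hx, rfl, rfl⟩
    -- The values of the frame at a point form a left eigenvector of M with eigenvalue g x.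
    obtain ⟨i, hi⟩ := F.exists_ne_zero hx
    refine Matrix.exists_vecMul_eq_zero_iff.1 ⟨fun i => b i x, fun h => hi (congrFun h i), ?_⟩
    ext l
    simp only [Matrix.vecMul, dotProduct, Matrix.sub_apply, Pi.zero_apply, mul_sub,
      Finset.sum_sub_distrib]
    rw [sub_eq_zero]
    have := hM.mul_eq x hx l
    simp only [mul_comm (b _ x)]
    rw [← this]
    simp [Matrix.scalar_apply, Matrix.diagonal_apply]

/-- Along an unramified fibre, multiplication by `g` is diagonalizable. -/
theorem charpoly_eq_prod [T2Space X] (F : IsFrame Y t b)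
    {M : ℂ → Matrix (Fin N) (Fin N) ℂ} (hM : IsMulMatrix Y t b g M) (w : ℂ)
    (hd : ∀ x ∈ Y, t x = w → chartDeriv t x ≠ 0)
    (e : Fin N ≃ {x | x ∈ Y ∧ t x = w}) :
    (M w).charpoly = ∏ a, (Polynomial.X - Polynomial.C (g (e a))) := by
  have hli := (F.linearIndependent_fibre w hd)
  -- Evaluation of the frame along the fibre intertwines M w with the diagonal matrix of the values
  -- of `g`; it is invertible because the fibre is unramified.
  let Q : Matrix (Fin N) (Fin N) ℂ := Matrix.of fun a i => b i (e a)
  have hQ : Q.det ≠ 0 := by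
    intro h0
    obtain ⟨v, hv, hv0⟩ := Matrix.exists_mulVec_eq_zero_iff.2 h0
    refine hv (funext ((Fintype.linearIndependent_iff.1 hli) v ?_))
    ext x
    have := congrFun hv0 (e.symm x)
    simp only [Matrix.mulVec, dotProduct, Q, Matrix.of_apply, Equiv.apply_symm_apply,
      Pi.zero_apply] at this
    simpa [mul_comm] using this
  rw [eval_charpoly_mul (M w) Q (Matrix.diagonal fun a => g (e a)) hQ ?_,
    Matrix.charpoly_diagonal]
  ext a l
  rw [Matrix.diagonal_mul, Matrix.mul_apply]
  have := hM.mul_eq (e a) (e a).2.1 l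
  rw [(e a).2.2] at this
  simp only [Q, Matrix.of_apply]
  rw [this]
  exact Finset.sum_congr rfl fun i _ => mul_comm _ _

end IsFrame

namespace FramePair

variable {k : Fin N → ℤ} {Y : Fin 2 → Set X} {t : Fin 2 → X → ℂ}
  {b : Fin 2 → Fin N → X → ℂ} {g : Fin 2 → X → ℂ}
  {M : Fin 2 → ℂ → Matrix (Fin N) (Fin N) ℂ}

/-- Both sides expand `g` times the l-th frame element. The weight k l comes from that element, and
the shift by -1 from `g` being a section of the pull-back of 𝒪(1). -/
theorem mulMatrix_glue (P : FramePair k Y t b) (hg : IsSection Y t g)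
    (hM : ∀ j, IsMulMatrix (Y j) (t j) (b j) (g j) (M j)) {w : ℂ} (hw : w ≠ 0) (i l : Fin N) :
    M 0 w⁻¹ i l * w ^ k i = w ^ (k l - 1) * M 1 w i l := by
  refine P.coeff_eq (c := fun i w => M 0 w i l) (c' := fun i w => M 1 w i l)
    (fun i => (hM 0).diff i l) (fun i => (hM 1).diff i l) (k l - 1) (fun x h0 h1 => ?_) i w hw
  rw [← (hM 0).mul_eq x h0, ← (hM 1).mul_eq x h1, P.glue l x h0 h1, hg.glue x h0 h1,
    P.inv x h0 h1, zpow_sub_one₀ ((P.mem_zero_iff x h1).1 h0)]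
  ring

/-- The diagonal matrix of the gluing factors w ^ k i conjugates w • M 0 w⁻¹ into M 1 w, so the
weights disappear from the characteristic polynomial. -/
theorem charpoly_glue (P : FramePair k Y t b) (hg : IsSection Y t g)
    (hM : ∀ j, IsMulMatrix (Y j) (t j) (b j) (g j) (M j)) {w : ℂ} (hw : w ≠ 0) :
    (M 1 w).charpoly = Polynomial.C (w ^ N) *
      (M 0 w⁻¹).charpoly.comp (Polynomial.C w⁻¹ * Polynomial.X) := by
  have h1 : (M 1 w).charpoly = (w • M 0 w⁻¹).charpoly := by
    symm
    refine eval_charpoly_mul _ (Matrix.diagonal fun i => w ^ k i) _ ?_ ?_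
    · rw [Matrix.det_diagonal]
      exact Finset.prod_ne_zero_iff.2 fun i _ => zpow_ne_zero _ hw
    · ext i l
      rw [Matrix.diagonal_mul, Matrix.mul_diagonal, Matrix.smul_apply, smul_eq_mul]
      have := P.mulMatrix_glue hg hM hw i l
      rw [zpow_sub_one₀ hw] at this
      linear_combination w * this + w ^ k l * M 1 w i l * (mul_inv_cancel₀ hw)
  rw [h1]
  refine Polynomial.funext fun T => ?_
  rw [Matrix.eval_charpoly, Polynomial.eval_mul, Polynomial.eval_comp, Polynomial.eval_C,
    Matrix.eval_charpoly]
  have : Matrix.scalar (Fin N) T - w • M 0 w⁻¹ =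
      w • (Matrix.scalar (Fin N) (Polynomial.eval T (Polynomial.C w⁻¹ * Polynomial.X)) -
        M 0 w⁻¹) := by
    ext i l
    simp only [Matrix.sub_apply, Matrix.smul_apply, smul_eq_mul, Matrix.scalar_apply,
      Matrix.diagonal_apply, Polynomial.eval_mul, Polynomial.eval_C, Polynomial.eval_X]
    split_ifs
    · field_simp
    · ring
  rw [this, Matrix.det_smul, Fintype.card_fin]

/-- The l-th coefficient is a section of 𝒪(N - l), so it is a form of degree N - l in the
homogeneous coordinates. -/
theorem charpoly_coeff (P : FramePair k Y t b) (hg : IsSection Y t g)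
    (hM : ∀ j, IsMulMatrix (Y j) (t j) (b j) (g j) (M j)) (l : Fin (N + 1)) :
    ∃ a : ℕ → ℂ,
      (∀ u, (M 0 u).charpoly.coeff l = ∑ i ∈ Finset.range (N - l + 1), a i * u ^ i) ∧
      ∀ w, (M 1 w).charpoly.coeff l = ∑ i ∈ Finset.range (N - l + 1), a i * w ^ (N - l - i) := by
  refine exists_coeff_of_growth (N - l) (differentiable_charpoly_coeff (hM 0).diff l)
    (differentiable_charpoly_coeff (hM 1).diff l) fun w hw => ?_
  rw [P.charpoly_glue hg hM hw, Polynomial.coeff_C_mul, Polynomial.comp_C_mul_X_coeff,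
    inv_pow, pow_sub₀ _ hw (Nat.lt_succ_iff.1 l.2)]
  ring

/-- The homogeneous equation of the curve `[R₀ : R₁ : σ]`. -/
theorem exists_equation [IsManifold 𝓘(ℂ) ω X] (P : FramePair k Y t b) (hg : IsSection Y t g)
    (hM : ∀ j, IsMulMatrix (Y j) (t j) (b j) (g j) (M j)) :
    ∃ F : MvPolynomial (Fin 3) ℂ, F.IsHomogeneous N ∧
      (∀ T, MvPolynomial.eval ![0, 0, T] F = T ^ N) ∧
      (∀ z₀ z₁ T, z₀ ≠ 0 → MvPolynomial.eval ![z₀, z₁, T] F =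
        z₀ ^ N * (M 0 (z₁ / z₀)).charpoly.eval (T / z₀)) ∧
      (∀ z₀ z₁ T, z₁ ≠ 0 → MvPolynomial.eval ![z₀, z₁, T] F =
        z₁ ^ N * (M 1 (z₀ / z₁)).charpoly.eval (T / z₁)) := by
  choose a ha ha' using P.charpoly_coeff hg hM
  -- The characteristic polynomial with its coefficients homogenised: degree N - l in the first two
  -- variables against T ^ l, so total degree N.
  let F : MvPolynomial (Fin 3) ℂ := ∑ l : Fin (N + 1), ∑ i ∈ Finset.range (N - l + 1),
    MvPolynomial.C (a l i) * (MvPolynomial.X 1 ^ i * MvPolynomial.X 0 ^ (N - l - i) *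
      MvPolynomial.X 2 ^ (l : ℕ))
  have hF : ∀ z₀ z₁ T, MvPolynomial.eval ![z₀, z₁, T] F = ∑ l : Fin (N + 1),
      (∑ i ∈ Finset.range (N - l + 1), a l i * (z₁ ^ i * z₀ ^ (N - l - i))) * T ^ (l : ℕ) := by
    intro z₀ z₁ T
    simp [F, Finset.sum_mul, mul_assoc]
  have hev : ∀ (A : Matrix (Fin N) (Fin N) ℂ) T, A.charpoly.eval T =
      ∑ l : Fin (N + 1), A.charpoly.coeff l * T ^ (l : ℕ) := by
    intro A T
    rw [Polynomial.eval_eq_sum_range, Matrix.charpoly_natDegree_eq_dim, Fintype.card_fin,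
      Finset.sum_range]
  refine ⟨F, ?_, fun T => ?_, fun z₀ z₁ T hz => ?_, fun z₀ z₁ T hz => ?_⟩
  · refine MvPolynomial.IsHomogeneous.sum _ _ _ fun l _ =>
      MvPolynomial.IsHomogeneous.sum _ _ _ fun i hi => ?_
    have hl := Nat.lt_succ_iff.1 l.2
    have hi' := Nat.lt_succ_iff.1 (Finset.mem_range.1 hi)
    have := (MvPolynomial.isHomogeneous_C (Fin 3) (a l i)).mul
      ((((MvPolynomial.isHomogeneous_X ℂ (1 : Fin 3)).pow i).mul
        ((MvPolynomial.isHomogeneous_X ℂ (0 : Fin 3)).pow (N - l - i))).mul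
        ((MvPolynomial.isHomogeneous_X ℂ (2 : Fin 3)).pow (l : ℕ)))
    convert this using 1
    omega
  · rw [hF, Finset.sum_eq_single (Fin.last N)]
    · have h1 := ha (Fin.last N) 0
      have h2 := (M 0 0).charpoly_monic
      rw [Polynomial.Monic, Polynomial.leadingCoeff, Matrix.charpoly_natDegree_eq_dim,
        Fintype.card_fin] at h2
      simp only [Fin.val_last, h2, Nat.sub_self, zero_add, Finset.sum_range_one, pow_zero,
        mul_one] at h1
      simp [← h1]
    · intro l _ hl
      have hl' : (l : ℕ) < N := lt_of_le_of_ne (Nat.lt_succ_iff.1 l.2)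
        fun h => hl (Fin.ext h)
      rw [Finset.sum_eq_zero fun i hi => ?_, zero_mul]
      have hi' := Nat.lt_succ_iff.1 (Finset.mem_range.1 hi)
      by_cases h0 : i = 0
      · rw [h0, zero_pow (by omega : N - l - 0 ≠ 0)]; ring
      · rw [zero_pow h0]; ring
    · simp
  · rw [hF, hev, Finset.mul_sum]
    refine Finset.sum_congr rfl fun l _ => ?_
    have hl := Nat.lt_succ_iff.1 l.2
    rw [ha, Finset.sum_mul, Finset.sum_mul, Finset.mul_sum]
    refine Finset.sum_congr rfl fun i hi => ?_
    have hi' := Nat.lt_succ_iff.1 (Finset.mem_range.1 hi)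
    have : z₀ ^ N = z₀ ^ (N - l - i) * z₀ ^ i * z₀ ^ (l : ℕ) := by
      rw [← pow_add, ← pow_add]; congr 1; omega
    rw [this, div_pow, div_pow]
    field_simp
  · rw [hF, hev, Finset.mul_sum]
    refine Finset.sum_congr rfl fun l _ => ?_
    have hl := Nat.lt_succ_iff.1 l.2
    rw [ha', Finset.sum_mul, Finset.sum_mul, Finset.mul_sum]
    refine Finset.sum_congr rfl fun i hi => ?_
    have hi' := Nat.lt_succ_iff.1 (Finset.mem_range.1 hi)
    have : z₁ ^ N = z₁ ^ (N - l - i) * z₁ ^ i * z₁ ^ (l : ℕ) := by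
      rw [← pow_add, ← pow_add]; congr 1; omega
    rw [this, div_pow, div_pow]
    field_simp

end FramePair

end Mul

/-! ### Orders of derivatives and removable quotients -/

section Derivative

variable {X : Type*} [TopologicalSpace X] [ChartedSpace ℂ X]

theorem HolAt.eventually_derivIn_mul {h g : X → ℂ} {x : X} (hh : HolAt h x) (hg : HolAt g x) :
    ∀ᶠ y in 𝓝 x, PlanarityDefect.derivIn x (fun y => h y * g y) y =
      PlanarityDefect.derivIn x h y * g y + h y * PlanarityDefect.derivIn x g y := by
  have h1 := (AnalyticAt.eventually_analyticAt hh).and (AnalyticAt.eventually_analyticAt hg)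
  rw [← eventually_chart_iff'] at h1
  filter_upwards [h1, eventually_mem_source x] with y hy hs
  have := hy.1.differentiableAt.hasDerivAt.mul hy.2.differentiableAt.hasDerivAt
  change HasDerivAt (fun y => h ((chartAt ℂ x).symm y) * g ((chartAt ℂ x).symm y)) _ _ at this
  have h2 := this.deriv
  simp only [Function.comp_apply, (chartAt ℂ x).left_inv hs] at h2
  exact h2

theorem HolAt.eventually_derivIn_coord (x : X) :
    ∀ᶠ y in 𝓝 x, PlanarityDefect.derivIn x (PlanarityDefect.coord x) y = 1 := by
  filter_upwards [eventually_mem_source x] with y hy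
  refine HasDerivAt.deriv (((hasDerivAt_id (chartAt ℂ x y)).sub_const
    (chartAt ℂ x x)).congr_of_eventuallyEq ?_)
  filter_upwards [(chartAt ℂ x).open_target.mem_nhds ((chartAt ℂ x).map_source hy)] with z hz
  simp [PlanarityDefect.coord, (chartAt ℂ x).right_inv hz]

theorem eventually_derivIn_congr {h g : X → ℂ} {x : X} (e : ∀ᶠ y in 𝓝 x, h y = g y) :
    ∀ᶠ y in 𝓝 x, derivIn x h y = derivIn x g y := by
  have h1 : ∀ᶠ z in 𝓝 (chartAt ℂ x x), h ((chartAt ℂ x).symm z) = g ((chartAt ℂ x).symm z) :=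
    eventually_chart_iff.2 e
  have h2 := h1.eventually_nhds
  rw [← eventually_chart_iff'] at h2
  filter_upwards [h2] with y hy using Filter.EventuallyEq.deriv_eq hy

theorem derivIn_sub_const {h : X → ℂ} {x : X} (c : ℂ) (y : X) :
    derivIn x (fun y => h y - c) y = derivIn x h y := by
  exact deriv_sub_const c

/-- Differentiation lowers the order of a zero by exactly one: when k does not vanish at the centre,
the cofactor is again a unit, with value (m + 1) k x. -/
theorem HolAt.eventually_derivIn_pow_mul {k : X → ℂ} {x : X} (hk : HolAt k x) (m : ℕ) :
    ∀ᶠ y in 𝓝 x, PlanarityDefect.derivIn x (fun y => PlanarityDefect.coord x y ^ (m + 1) * k y) y =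
      PlanarityDefect.coord x y ^ m *
        ((m + 1) * k y + PlanarityDefect.coord x y * PlanarityDefect.derivIn x k y) := by
  induction m generalizing k with
  | zero =>
    filter_upwards [(HolAt.coord x).eventually_derivIn_mul hk,
      HolAt.eventually_derivIn_coord x] with y h1 h2
    simp only [zero_add, pow_one, pow_zero, Nat.cast_zero, one_mul]
    rw [h1, h2]; ring
  | succ m ih =>
    have h0 : (fun y => PlanarityDefect.coord x y ^ (m + 1 + 1) * k y) =
        fun y => PlanarityDefect.coord x y ^ (m + 1) * (PlanarityDefect.coord x y * k y) := by
      ext y; ring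
    filter_upwards [ih ((HolAt.coord x).mul hk), (HolAt.coord x).eventually_derivIn_mul hk,
      HolAt.eventually_derivIn_coord x] with y h1 h2 h3
    rw [h0, h1, h2, h3]
    push_cast
    ring

/-- The quotient of the derivatives of `g` and of a function of order two with critical point of
`g` has a removable singularity. -/
theorem HolAt.removable_div {g t k : X → ℂ} {x : X} (hg : HolAt g x)
    (hg0 : chartDeriv g x = 0) (hk : HolAt k x) (hk0 : k x ≠ 0)
    (e : ∀ᶠ y in 𝓝 x, t y - t x = PlanarityDefect.coord x y ^ 2 * k y) :
    ∃ h, HolAt h x ∧ ∀ᶠ y in 𝓝[≠] x,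
      PlanarityDefect.derivIn x g y / PlanarityDefect.derivIn x t y = h y := by
  obtain ⟨k₁, hk₁, e₁⟩ := hg.derivIn.exists_eq_coord_mul hg0
  have h2 : HolAt (fun y => ((1 : ℕ) + 1 : ℂ) * k y + PlanarityDefect.coord x y *
      PlanarityDefect.derivIn x k y) x :=
    ((HolAt.const _ x).mul hk).add ((HolAt.coord x).mul hk.derivIn)
  have h20 : ((1 : ℕ) + 1 : ℂ) * k x + PlanarityDefect.coord x x *
      PlanarityDefect.derivIn x k x ≠ 0 := by
    simp only [coord_self, zero_mul, add_zero, Nat.cast_one]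
    exact mul_ne_zero (by norm_num) hk0
  refine ⟨_, hk₁.div h2 h20, ?_⟩
  have e' := eventually_derivIn_congr e
  filter_upwards [nhdsWithin_le_nhds e₁, nhdsWithin_le_nhds e',
    nhdsWithin_le_nhds (hk.eventually_derivIn_pow_mul 1), eventually_coord_ne x] with y h3 h4 h5 h6
  rw [derivIn_sub_const] at h4
  rw [h3, h4, h5, pow_one, mul_div_mul_left _ _ h6]

/-- The logarithmic derivative has a simple pole. -/
theorem HolAt.removable_div_derivIn {t : X → ℂ} {x : X} (ht : HolAt t x) (h0 : t x = 0)
    (hne : ¬ ∀ᶠ y in 𝓝 x, t y = 0) :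
    ∃ h, HolAt h x ∧ ∀ᶠ y in 𝓝[≠] x, t y / PlanarityDefect.derivIn x t y = h y := by
  obtain ⟨m, k, hk, hk0, e⟩ := ht.factor hne
  obtain _ | m := m
  · exact absurd (e.self_of_nhds.symm.trans h0) (by simpa using hk0)
  have h2 : HolAt (fun y => ((m : ℂ) + 1) * k y + PlanarityDefect.coord x y *
      PlanarityDefect.derivIn x k y) x :=
    ((HolAt.const _ x).mul hk).add ((HolAt.coord x).mul hk.derivIn)
  have h20 : ((m : ℂ) + 1) * k x + PlanarityDefect.coord x x *
      PlanarityDefect.derivIn x k x ≠ 0 := by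
    simp only [coord_self, zero_mul, add_zero]
    exact mul_ne_zero (Nat.cast_add_one_ne_zero m) hk0
  refine ⟨_, ((HolAt.coord x).mul hk).div h2 h20, ?_⟩
  filter_upwards [nhdsWithin_le_nhds e, nhdsWithin_le_nhds (eventually_derivIn_congr e),
    nhdsWithin_le_nhds (hk.eventually_derivIn_pow_mul m), eventually_coord_ne x] with y h3 h4 h5 h6
  rw [h4, h5, h3, pow_succ, mul_assoc, mul_div_mul_left _ _ (pow_ne_zero _ h6)]

end Derivative

/-! ### A nonlinear section separates generic fibres -/

section Separation

theorem eval_derivative_prod {ι : Type*} [Fintype ι] [DecidableEq ι] (v : ι → ℂ) (a : ι) :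
    (Polynomial.derivative (∏ i, (Polynomial.X - Polynomial.C (v i)))).eval (v a) =
      ∏ i ∈ Finset.univ.erase a, (v a - v i) := by
  rw [← Finset.mul_prod_erase _ _ (Finset.mem_univ a), Polynomial.derivative_mul]
  simp [Polynomial.eval_prod]

variable {X : Type*} [TopologicalSpace X] [ChartedSpace ℂ X] {N : ℕ}
variable {k : Fin N → ℤ} {Y : Fin 2 → Set X} {t : Fin 2 → X → ℂ}
  {b : Fin 2 → Fin N → X → ℂ} {g : Fin 2 → X → ℂ}
  {M : Fin 2 → ℂ → Matrix (Fin N) (Fin N) ℂ}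

/-- The derivative of the characteristic polynomial of multiplication by `g`, at `g`. -/
noncomputable def different (t g : X → ℂ) (M : ℂ → Matrix (Fin N) (Fin N) ℂ) (x : X) : ℂ :=
  (Polynomial.derivative (M (t x)).charpoly).eval (g x)

theorem IsMulMatrix.holAt_different {Y : Set X} {t : X → ℂ} {b : Fin N → X → ℂ} {g : X → ℂ}
    {M : ℂ → Matrix (Fin N) (Fin N) ℂ} (hM : IsMulMatrix Y t b g M) {x : X} (ht : HolAt t x)
    (hg : HolAt g x) : HolAt (different t g M) x := by
  have h : different t g M = fun y => ∑ l ∈ Finset.range (N + 1),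
      (M (t y)).charpoly.coeff (l + 1) * (l + 1) * g y ^ l := by
    ext y
    rw [different, Polynomial.eval_eq_sum_range' (n := N + 1)]
    · simp [Polynomial.coeff_derivative]
    · refine Nat.lt_succ_of_le ((Polynomial.natDegree_derivative_le _).trans ?_)
      rw [Matrix.charpoly_natDegree_eq_dim, Fintype.card_fin]
      omega
  rw [h]
  refine HolAt.sum fun l _ => HolAt.mul (HolAt.mul ?_ (HolAt.const _ x)) (hg.pow l)
  exact HolAt.comp (c := fun w => (M w).charpoly.coeff (l + 1))
    ((differentiable_charpoly_coeff hM.diff (l + 1)).analyticAt _) ht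

namespace IsFrame

variable {Y : Set X} {t : X → ℂ} {b : Fin N → X → ℂ} {g : X → ℂ}
  {M : ℂ → Matrix (Fin N) (Fin N) ℂ}

/-- Over an unramified value the characteristic polynomial is the product of T - g(y) over the
fibre, and its derivative at g(x) is the product of the differences with the other points. -/
theorem different_eq_zero_iff [T2Space X] [IsManifold 𝓘(ℂ) ω X] (F : IsFrame Y t b)
    (hM : IsMulMatrix Y t b g M)
    {x : X} (hx : x ∈ Y) (hd : ∀ y ∈ Y, t y = t x → chartDeriv t y ≠ 0) :
    different t g M x = 0 ↔ ∃ y ∈ Y, t y = t x ∧ g y = g x ∧ y ≠ x := by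
  have := (F.finite_fibre (t x)).fintype
  have hc := F.ncard_fibre_eq (t x) hd
  rw [← Nat.card_coe_set_eq, Nat.card_eq_fintype_card] at hc
  let e : Fin N ≃ {y | y ∈ Y ∧ t y = t x} := (Fintype.equivFinOfCardEq hc).symm
  obtain ⟨a, ha⟩ := e.surjective ⟨x, hx, rfl⟩
  have hgx : g x = g (e a) := by rw [ha]
  rw [different, F.charpoly_eq_prod hM (t x) hd e, hgx,
    eval_derivative_prod (fun a => g (e a)) a, Finset.prod_eq_zero_iff]
  constructor
  · rintro ⟨a', ha', h0⟩
    refine ⟨e a', (e a').2.1, (e a').2.2, (sub_eq_zero.1 h0).symm, fun h => ?_⟩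
    refine (Finset.mem_erase.1 ha').1 (e.injective (Subtype.ext ?_))
    rw [h, ha]
  · rintro ⟨y, hy, hty, hgy, hne⟩
    obtain ⟨a', ha'⟩ := e.surjective ⟨y, hy, hty⟩
    refine ⟨a', Finset.mem_erase.2 ⟨fun h => hne ?_, Finset.mem_univ _⟩, ?_⟩
    · rw [h, ha] at ha'
      exact (congrArg Subtype.val ha').symm
    · rw [ha']
      exact sub_eq_zero.2 hgy.symm

/-- If `g` does not separate the points of the unramified fibres then its differential vanishes at
the simple ramification points. -/
theorem chartDeriv_eq_zero_of_partner [T2Space X] [IsManifold 𝓘(ℂ) ω X] (F : IsFrame Y t b)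
    (hg : ∀ x ∈ Y, HolAt g x) {R : Set X} (hR : R.Finite)
    (hp : ∀ x ∈ Y, x ∉ R → ∃ y ∈ Y, t y = t x ∧ g y = g x ∧ y ≠ x) {x : X} (hx : x ∈ Y)
    (hd : chartDeriv t x = 0) (hN : N ≤ {x' | x' ∈ Y ∧ t x' = t x}.ncard + 1) :
    chartDeriv g x = 0 := by
  by_contra hgx
  obtain ⟨hun, -⟩ := F.simple_of_le hx hd hN
  obtain ⟨V, hV, hinj⟩ := (hg x hx).eventually_injective hgx
  have hH : ∀ z, ∃ H : ℂ → ℂ, z ∈ Y → t z = t x → z ≠ x →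
      AnalyticAt ℂ H (t z) ∧ ∀ᶠ y in 𝓝 z, g y = H (t y) := by
    intro z
    by_cases hz : z ∈ Y ∧ t z = t x ∧ z ≠ x
    · obtain ⟨H, h1, h2⟩ := (F.hol_t z hz.1).exists_eq_comp (hun z hz.1 hz.2.1 hz.2.2) (hg z hz.1)
      exact ⟨H, fun _ _ _ => ⟨h1, h2⟩⟩
    · exact ⟨0, fun h1 h2 h3 => absurd ⟨h1, h2, h3⟩ hz⟩
  choose H hH using hH
  -- Near another fibre point z, unramified, `g` is a function H of t. If g = H(t) also held near x,
  -- then dg = H' dt would vanish at x.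
  have hne : ∀ z ∈ {z | z ∈ Y ∧ t z = t x} \ {x}, ∀ᶠ y in 𝓝[≠] x, g y ≠ H z (t y) := by
    rintro z ⟨⟨hz, hzx⟩, hne⟩
    have hH1 := (hH z hz hzx hne).1
    rw [hzx] at hH1
    rcases ((hg x hx).sub (HolAt.comp hH1 (F.hol_t x hx))).eventually_eq_zero_or with h | h
    · refine absurd ?_ hgx
      rw [HolAt.chartDeriv_congr (g := fun y => H z (t y))
        (by filter_upwards [h] with y hy using sub_eq_zero.1 hy),
        HolAt.chartDeriv_comp hH1 (F.hol_t x hx), hd, mul_zero]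
    · filter_upwards [h] with y hy h' using hy (sub_eq_zero.2 h')
  have hfin : ({z | z ∈ Y ∧ t z = t x} \ {x}).Finite := (F.finite_fibre _).subset sdiff_subset
  obtain ⟨W, hWo, hxW, hW⟩ := F.proper (t x)
    (interior V ∪ ⋃ z ∈ {z | z ∈ Y ∧ t z = t x} \ {x}, interior {y | g y = H z (t y)})
    (isOpen_interior.union (isOpen_biUnion fun _ _ => isOpen_interior)) fun z hz hzx => by
      by_cases h : z = x
      · exact Or.inl (mem_interior_iff_mem_nhds.2 (h ▸ hV))
      · exact Or.inr (mem_biUnion (show z ∈ {z | z ∈ Y ∧ t z = t x} \ {x} from ⟨⟨hz, hzx⟩, h⟩)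
          (mem_interior_iff_mem_nhds.2 (hH z hz hzx h).2))
  obtain ⟨y, ⟨⟨⟨hyne, hyR⟩, hyW⟩, hyY⟩, hyV⟩ :=
    (((((hfin.eventually_all).2 hne).and (eventually_notMem_of_finite hR x)).and
      (nhdsWithin_le_nhds ((F.hol_t x hx).continuousAt.preimage_mem_nhds
        (hWo.mem_nhds hxW)))).and (nhdsWithin_le_nhds (F.isOpen.mem_nhds hx))).and
      (nhdsWithin_le_nhds hV) |>.exists
  -- By properness the partner of y is near x, against local injectivity of `g`, or near another
  -- fibre point z, where g = H(t) forces g y = H(t y).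
  obtain ⟨y', hy'Y, hty, hgy, hne'⟩ := hp y hyY hyR
  rcases hW y' hy'Y (by rw [hty]; exact hyW) with h | h
  · exact hne' (hinj (interior_subset h) hyV hgy)
  · obtain ⟨z, hz, hzy⟩ := mem_iUnion₂.1 h
    have h1 : y' ∈ {y | g y = H z (t y)} := interior_subset hzy
    change g y' = H z (t y') at h1
    rw [hgy, hty] at h1
    exact hyne z hz h1

end IsFrame

namespace FramePair

theorem notMem_zero (P : FramePair k Y t b) {x : X} (hx : x ∉ Y 0) : x ∈ Y 1 ∧ t 1 x = 0 := by
  have h1 := (P.cover x).resolve_left hx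
  exact ⟨h1, by_contra fun h => hx ((P.mem_zero_iff x h1).2 h)⟩

theorem finite_compl (P : FramePair k Y t b) : (Y 0)ᶜ.Finite :=
  ((P.frame 1).finite_fibre 0).subset fun _ hx => P.notMem_zero hx

theorem eventually_mem (P : FramePair k Y t b) [T2Space X] (x : X) : ∀ᶠ y in 𝓝[≠] x, y ∈ Y 0 := by
  filter_upwards [eventually_notMem_of_finite P.finite_compl x] with y hy
  exact not_not.1 hy

/-- The identity principle for a function given in the two trivializations. -/
theorem forall_or_finite [T2Space X] [CompactSpace X] [ConnectedSpace X]
    (P : FramePair k Y t b) {d : Fin 2 → X → ℂ} (hd : ∀ j, ∀ x ∈ Y j, HolAt (d j) x)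
    (h : ∀ x ∈ Y 0, x ∈ Y 1 → (d 0 x = 0 ↔ d 1 x = 0)) :
    (∀ x ∈ Y 0, d 0 x = 0) ∨ {x | x ∈ Y 0 ∧ d 0 x = 0}.Finite := by
  have key : ∀ x, (∀ᶠ y in 𝓝 x, y ∈ {x | x ∈ Y 0 → d 0 x = 0}) ∨
      ∀ᶠ y in 𝓝[≠] x, y ∉ {x | x ∈ Y 0 → d 0 x = 0} := by
    intro x
    rcases P.cover x with hx | hx
    · rcases (hd 0 x hx).eventually_eq_zero_or with h1 | h1
      · exact Or.inl (h1.mono fun y hy _ => hy)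
      · right
        filter_upwards [h1, nhdsWithin_le_nhds ((P.frame 0).isOpen.mem_nhds hx)] with y hy hyY h2
        exact hy (h2 hyY)
    · have hY := (P.frame 1).isOpen.mem_nhds hx
      rcases (hd 1 x hx).eventually_eq_zero_or with h1 | h1
      · left
        filter_upwards [h1, hY] with y hy hy1 hy0
        exact (h y hy0 hy1).2 hy
      · right
        filter_upwards [h1, nhdsWithin_le_nhds hY, P.eventually_mem x] with y hy hy1 hy0 h2
        exact hy ((h y hy0 hy1).1 (h2 hy0))
  rcases eq_univ_or_forall_punctured key with h1 | h1
  · exact Or.inl fun x hx => (h1 ▸ mem_univ x : x ∈ {x | x ∈ Y 0 → d 0 x = 0}) hx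
  · exact Or.inr ((finite_of_forall_punctured h1).subset fun x hx _ => hx.2)

theorem eventually_inv (P : FramePair k Y t b) {x : X} (h0 : x ∈ Y 0) (h1 : x ∈ Y 1) :
    ∀ᶠ y in 𝓝 x, t 0 y = (t 1 y)⁻¹ := by
  filter_upwards [(P.frame 0).isOpen.mem_nhds h0, (P.frame 1).isOpen.mem_nhds h1] with y hy0 hy1
  exact P.inv y hy0 hy1

theorem chartDeriv_inv (P : FramePair k Y t b) {x : X} (h0 : x ∈ Y 0) (h1 : x ∈ Y 1) :
    chartDeriv (t 0) x = - chartDeriv (t 1) x / t 1 x ^ 2 := by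
  rw [HolAt.chartDeriv_congr (P.eventually_inv h0 h1),
    ((P.frame 1).hol_t x h1).chartDeriv_inv ((P.mem_zero_iff x h1).1 h0)]

variable [IsManifold 𝓘(ℂ) ω X]

theorem eventually_chartDeriv_ne [T2Space X] (P : FramePair k Y t b) (j : Fin 2) {x : X}
    (hx : x ∈ Y j) : ∀ᶠ y in 𝓝[≠] x, chartDeriv (t j) y ≠ 0 := by
  refine ((P.frame j).hol_t x hx).eventually_chartDeriv_ne fun h => ?_
  obtain ⟨y, h1, h2⟩ := (((P.frame j).not_eventually_const hx).and (nhdsWithin_le_nhds h)).exists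
  exact h1 h2

theorem finite_ramified [T2Space X] [CompactSpace X] (P : FramePair k Y t b) :
    {x | x ∈ Y 0 ∧ chartDeriv (t 0) x = 0}.Finite := by
  refine finite_of_forall_punctured fun x => ?_
  rcases P.cover x with hx | hx
  · filter_upwards [P.eventually_chartDeriv_ne 0 hx] with y hy h using hy h.2
  · filter_upwards [P.eventually_chartDeriv_ne 1 hx,
      nhdsWithin_le_nhds ((P.frame 1).isOpen.mem_nhds hx)] with y hy hy1 h
    rw [P.chartDeriv_inv h.1 hy1] at h
    exact div_ne_zero (neg_ne_zero.2 hy)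
      (pow_ne_zero _ ((P.mem_zero_iff y hy1).1 h.1)) h.2

/-- The points of the fibres with ramification form a finite set. -/
theorem finite_branched [T2Space X] [CompactSpace X] (P : FramePair k Y t b) :
    {x | x ∈ Y 0 ∧ ∃ z ∈ Y 0, t 0 z = t 0 x ∧ chartDeriv (t 0) z = 0}.Finite := by
  refine (P.finite_ramified.biUnion fun z _ => (P.frame 0).finite_fibre (t 0 z)).subset ?_
  rintro x ⟨hx, z, hz, hzx, hd⟩
  exact mem_biUnion (show z ∈ {x | x ∈ Y 0 ∧ chartDeriv (t 0) x = 0} from ⟨hz, hd⟩)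
    ⟨hx, hzx.symm⟩

/-- If the differential of `g` vanishes at all ramification points, then `dg / dt` is holomorphic
everywhere, hence constant, and `g` is linear. -/
theorem isLinear_of_chartDeriv [T2Space X] [CompactSpace X] [ConnectedSpace X]
    (P : FramePair k Y t b) (hg : IsSection Y t g)
    (hs : ∀ x ∈ Y 0, chartDeriv (t 0) x = 0 → chartDeriv (g 0) x = 0 ∧
      ∃ k : X → ℂ, HolAt k x ∧ k x ≠ 0 ∧ ∀ᶠ y in 𝓝 x, t 0 y - t 0 x = coord x y ^ 2 * k y) :
    IsLinear Y t g := by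
  obtain ⟨κ', hκ', he⟩ := exists_holomorphic_of_removable
    (κ := fun y => chartDeriv (g 0) y / chartDeriv (t 0) y) fun x => by
    by_cases hx : x ∈ Y 0
    · have ht := (P.frame 0).hol_t x hx
      have hgx := hg.hol 0 x hx
      by_cases hd : chartDeriv (t 0) x = 0
      · obtain ⟨hg0, k, hk, hk0, e⟩ := hs x hx hd
        obtain ⟨h, hh, e'⟩ := hgx.removable_div hg0 hk hk0 e
        refine ⟨h, hh, ?_⟩
        filter_upwards [e', nhdsWithin_le_nhds (hgx.eventually_ratio ht)] with y h1 h2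
        rw [h2, h1]
      · exact ⟨_, hgx.derivIn.div ht.derivIn hd, nhdsWithin_le_nhds (hgx.eventually_ratio ht)⟩
    -- Over infinity g₀ = g₁ / t₁ and t₀ = 1 / t₁ give dg₀/dt₀ = g₁ - t₁ dg₁/dt₁. The quotient of t₁
    -- by its derivative is holomorphic for any ramification index, so no hypothesis on this fibre
    -- is needed.
    · obtain ⟨hx1, hx0⟩ := P.notMem_zero hx
      have ht := (P.frame 1).hol_t x hx1
      have hgx := hg.hol 1 x hx1
      obtain ⟨h, hh, e⟩ := ht.removable_div_derivIn hx0 fun h => by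
        obtain ⟨y, h1, h2⟩ :=
          (((P.frame 1).not_eventually_const hx1).and (nhdsWithin_le_nhds h)).exists
        exact h1 (h2.trans hx0.symm)
      refine ⟨_, hgx.sub (hgx.derivIn.mul hh), ?_⟩
      filter_upwards [e, nhdsWithin_le_nhds (hgx.eventually_ratio ht), P.eventually_mem x,
        nhdsWithin_le_nhds ((P.frame 1).isOpen.mem_nhds hx1),
        P.eventually_chartDeriv_ne 1 hx1] with y h1 h2 hy0 hy1 hd
      have hty := (P.frame 1).hol_t y hy1
      have hgy := hg.hol 1 y hy1
      have hne := (P.mem_zero_iff y hy1).1 hy0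
      have e1 : chartDeriv (g 0) y = chartDeriv (fun y => (t 1 y)⁻¹ * g 1 y) y := by
        refine HolAt.chartDeriv_congr ?_
        filter_upwards [(P.frame 0).isOpen.mem_nhds hy0, (P.frame 1).isOpen.mem_nhds hy1] with
          z hz0 hz1
        rw [hg.glue z hz0 hz1, P.inv z hz0 hz1]
      rw [e1, P.chartDeriv_inv hy0 hy1, (hty.inv hne).chartDeriv_mul hgy,
        hty.chartDeriv_inv hne, ← h1, mul_div_assoc', mul_comm _ (t 1 y), mul_div_assoc, ← h2]
      field_simp
      ring
  obtain ⟨c, hc⟩ := exists_const_of_holAt hκ'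
  by_cases hY : ∃ x₀, x₀ ∈ Y 0
  swap
  · push Not at hY
    exact P.isLinear_of_zero hg (α := 0) (β := 0) fun x hx => absurd hx (hY x)
  obtain ⟨x₀, hx₀⟩ := hY
  have ht := (P.frame 0).hol_t x₀ hx₀
  have hg₀ := hg.hol 0 x₀ hx₀
  have hG : HolAt (fun y => g 0 y - c * t 0 y) x₀ := hg₀.sub ((HolAt.const c x₀).mul ht)
  have hG' : ∀ᶠ y in 𝓝[≠] x₀, derivIn x₀ (fun y => g 0 y - c * t 0 y) y = 0 := by
    filter_upwards [he x₀, P.eventually_chartDeriv_ne 0 hx₀,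
      nhdsWithin_le_nhds (HolAt.eventually_deriv x₀),
      nhdsWithin_le_nhds ((P.frame 0).isOpen.mem_nhds hx₀)] with y h1 h2 h3 hy
    obtain ⟨e, -, h3⟩ := h3
    have hty := (P.frame 0).hol_t y hy
    have hgy := hg.hol 0 y hy
    rw [derivIn, h3 _ (hgy.sub ((HolAt.const c y).mul hty)),
      hgy.chartDeriv_sub ((HolAt.const c y).mul hty), (HolAt.const c y).chartDeriv_mul hty]
    rw [hc, div_eq_iff h2] at h1
    simp [h1]
  have hconst := hG.eventually_const_of_derivIn
    (hG.derivIn.eventually_eq_of_punctured (HolAt.const 0 x₀) hG')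
  set α := g 0 x₀ - c * t 0 x₀
  -- The defect of linearity in both trivializations; it vanishes near x₀, so the identity principle
  -- makes it vanish everywhere.
  let d : Fin 2 → X → ℂ := fun j y => if j = 0 then g 0 y - c * t 0 y - α else
    g 1 y - c - α * t 1 y
  have hd : ∀ j, ∀ x ∈ Y j, HolAt (d j) x := by
    intro j x hx
    fin_cases j
    · exact ((hg.hol 0 x hx).sub ((HolAt.const c x).mul ((P.frame 0).hol_t x hx))).sub
        (HolAt.const α x)
    · exact ((hg.hol 1 x hx).sub (HolAt.const c x)).sub
        ((HolAt.const α x).mul ((P.frame 1).hol_t x hx))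
  have hd' : ∀ x ∈ Y 0, x ∈ Y 1 → (d 0 x = 0 ↔ d 1 x = 0) := by
    intro x h0 h1
    have hne := (P.mem_zero_iff x h1).1 h0
    have : g 0 x - c * t 0 x - α = (t 1 x)⁻¹ * (g 1 x - c - α * t 1 x) := by
      rw [hg.glue x h0 h1, P.inv x h0 h1]
      field_simp
    simp only [d, if_true, one_ne_zero, if_false, this, mul_eq_zero, inv_eq_zero, hne, false_or]
  rcases P.forall_or_finite hd hd' with h | h
  · refine P.isLinear_of_zero hg (α := α) (β := c) fun x hx => ?_
    have := h x hx
    simp only [d, if_true] at this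
    linear_combination this
  · obtain ⟨y, ⟨h1, h2⟩, h3⟩ := (((eventually_notMem_of_finite h x₀).and
      (nhdsWithin_le_nhds hconst)).and
      (nhdsWithin_le_nhds ((P.frame 0).isOpen.mem_nhds hx₀))).exists
    exact absurd ⟨h3, by simp [d, h2]⟩ h1

/-- A section which is not linear separates the points of almost all fibres, if the ramification
over the first affine line is simple. -/
theorem exists_finite_injOn [T2Space X] [CompactSpace X] [ConnectedSpace X]
    (P : FramePair k Y t b) (hg : IsSection Y t g) (hlin : ¬ IsLinear Y t g)
    (hN : ∀ x ∈ Y 0, N ≤ {x' | x' ∈ Y 0 ∧ t 0 x' = t 0 x}.ncard + 1) :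
    ∃ S : Set X, S.Finite ∧ (Y 0)ᶜ ⊆ S ∧ InjOn (fun x => (t 0 x, g 0 x)) Sᶜ := by
  choose M hM using fun j => (P.frame j).exists_mulMatrix (hg.hol j)
  have hfin := P.finite_branched
  have hD : ∀ j, ∀ x ∈ Y j, HolAt (different (t j) (g j) (M j)) x := fun j x hx =>
    (hM j).holAt_different ((P.frame j).hol_t x hx) (hg.hol j x hx)
  have hun : ∀ x, x ∉ {x | x ∈ Y 0 ∧ ∃ z ∈ Y 0, t 0 z = t 0 x ∧ chartDeriv (t 0) z = 0} →
      x ∈ Y 0 → ∀ y ∈ Y 0, t 0 y = t 0 x → chartDeriv (t 0) y ≠ 0 :=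
    fun x hx hx0 y hy hyx h0 => hx ⟨hx0, y, hy, hyx, h0⟩
  -- Between the two trivializations the different changes only by a power of t₁, so its zeros agree
  -- on the overlap. Identical vanishing leads to linearity; otherwise its finitely many zeros, the
  -- branched fibres and the points at infinity are removed.
  rcases P.forall_or_finite hD fun x h0 h1 => by
    have hne := (P.mem_zero_iff x h1).1 h0
    rw [different, different, P.charpoly_glue hg hM hne, Polynomial.derivative_C_mul,
      P.inv x h0 h1, hg.glue x h0 h1, P.inv x h0 h1]
    simp [Polynomial.derivative_comp, hne]
    with h | h
  · refine absurd (P.isLinear_of_chartDeriv hg fun x hx hd => ⟨?_, ?_⟩) hlin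
    · refine (P.frame 0).chartDeriv_eq_zero_of_partner (hg.hol 0) hfin (fun y hy hyR => ?_) hx hd
        (hN x hx)
      exact ((P.frame 0).different_eq_zero_iff (hM 0) hy (hun y hyR hy)).1 (h y hy)
    · exact ((P.frame 0).simple_of_le hx hd (hN x hx)).2
  · refine ⟨_, (P.finite_compl.union hfin).union h, fun x hx => Or.inl (Or.inl hx), ?_⟩
    intro x hx y hy hxy
    simp only [mem_compl_iff, mem_union, not_or, not_not] at hx hy
    by_contra hne
    refine hx.2 ⟨hx.1.1, ((P.frame 0).different_eq_zero_iff (hM 0) hx.1.1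
      (hun x hx.1.2 hx.1.1)).2 ⟨y, hy.1.1, ?_, ?_, Ne.symm hne⟩⟩
    · exact (congrArg Prod.fst hxy).symm
    · exact (congrArg Prod.snd hxy).symm

end FramePair
end Separation

/-! ### Sections of 𝒪(k) over open subsets of an affine line -/

section Chart

variable (L : (Fin 2 → ℂ) ≃ₗ[ℂ] (Fin 2 → ℂ))

/-- The open subset of the `j`-th affine line, with respect to the linear coordinates `L`, given by
an open set of values of the affine coordinate. -/
def affineOpen (j : Fin 2) (W : Opens ℂ) : Opens (CP 1) where
  carrier := {q | L q.rep j ≠ 0 ∧ L q.rep (1 - j) / L q.rep j ∈ W}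
  is_open' := by
    refine isOpen_coinduced.2 ?_
    have h : Projectivization.mk' ℂ ⁻¹' {q | L q.rep j ≠ 0 ∧ L q.rep (1 - j) / L q.rep j ∈ W} =
        {v : {v : Fin 2 → ℂ // v ≠ 0} | L v j ≠ 0 ∧ L v (1 - j) / L v j ∈ W} := by
      ext v
      obtain ⟨c, hc⟩ := Projectivization.exists_smul_eq_mk_rep ℂ v.1 v.2
      simp only [mem_preimage, mem_ofPred_eq, Projectivization.mk'_eq_mk, ← hc, Units.smul_def,
        map_smul, Pi.smul_apply, smul_eq_mul, mul_ne_zero_iff, c.ne_zero, true_and, ne_eq,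
        not_false_eq_true, mul_div_mul_left _ _ c.ne_zero]
    rw [h]
    have hL : ∀ i, Continuous fun v : {v : Fin 2 → ℂ // v ≠ 0} => L v i := fun i =>
      (continuous_apply i).comp ((LinearMap.continuous_of_finiteDimensional
        (L : (Fin 2 → ℂ) →ₗ[ℂ] (Fin 2 → ℂ))).comp continuous_subtype_val)
    have ho : IsOpen {v : {v : Fin 2 → ℂ // v ≠ 0} | L v j ≠ 0} :=
      isOpen_ne_fun (hL j) continuous_const
    exact ContinuousOn.isOpen_inter_preimage
      (ContinuousOn.div (hL (1 - j)).continuousOn (hL j).continuousOn fun v hv => hv) ho W.2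

theorem mem_cone_affineOpen {j : Fin 2} {W : Opens ℂ} {v : Fin 2 → ℂ} :
    v ∈ cone (affineOpen L j W) ↔ L v j ≠ 0 ∧ L v (1 - j) / L v j ∈ W := by
  constructor
  · rintro ⟨h0, h1, h2⟩
    obtain ⟨c, hc⟩ := Projectivization.exists_smul_eq_mk_rep ℂ v h0
    rw [← hc] at h1 h2
    simpa [Units.smul_def, mul_div_mul_left _ _ c.ne_zero] using And.intro h1 h2
  · intro h
    have h0 : v ≠ 0 := by
      rintro rfl
      simp at h
    refine ⟨h0, ?_⟩
    obtain ⟨c, hc⟩ := Projectivization.exists_smul_eq_mk_rep ℂ v h0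
    change L _ j ≠ 0 ∧ L _ (1 - j) / L _ j ∈ W
    rw [← hc]
    simpa [Units.smul_def, mul_div_mul_left _ _ c.ne_zero] using h

/-- The vector with affine coordinate `w` on the `j`-th affine line. -/
noncomputable def affineVec (j : Fin 2) (w : ℂ) : Fin 2 → ℂ :=
  L.symm (Function.update (fun _ => w) j 1)

theorem fin_two_sub_ne (j : Fin 2) : 1 - j ≠ j := by
  fin_cases j <;> simp

@[simp] theorem apply_affineVec_self (j : Fin 2) (w : ℂ) : L (affineVec L j w) j = 1 := by
  simp [affineVec]

@[simp] theorem apply_affineVec_sub (j : Fin 2) (w : ℂ) : L (affineVec L j w) (1 - j) = w := by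
  simp [affineVec, fin_two_sub_ne]

theorem smul_affineVec {j : Fin 2} {v : Fin 2 → ℂ} (hv : L v j ≠ 0) :
    L v j • affineVec L j (L v (1 - j) / L v j) = v := by
  apply L.injective
  rw [map_smul]
  ext i
  by_cases hi : i = j
  · subst hi; simp
  · have : i = 1 - j := by fin_cases i <;> fin_cases j <;> simp_all
    subst this
    simp [mul_div_cancel₀ _ hv]

theorem differentiable_affineVec (j : Fin 2) : Differentiable ℂ (affineVec L j) := by
  refine (LinearMap.toContinuousLinearMap
    (L.symm : (Fin 2 → ℂ) →ₗ[ℂ] (Fin 2 → ℂ))).differentiable.comp ?_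
  rw [differentiable_pi]
  intro i
  by_cases hi : i = j
  · subst hi; simp
  · simp [Function.update_of_ne hi, differentiable_fun_id]

theorem differentiable_coordinate (i : Fin 2) : Differentiable ℂ fun v => L v i :=
  (differentiable_pi.1 (LinearMap.toContinuousLinearMap
    (L : (Fin 2 → ℂ) →ₗ[ℂ] (Fin 2 → ℂ))).differentiable) i

/-- The section of `𝒪(k)` with coefficient `c` with respect to the `k`-th power of the
`j`-th coordinate. -/
noncomputable def toTwist (k : ℤ) (j : Fin 2) (W : Opens ℂ) (c : ℂ → ℂ)
    (hc : DifferentiableOn ℂ c W) : twist k (affineOpen L j W) :=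
  ⟨(cone (affineOpen L j W)).indicator fun v => L v j ^ k * c (L v (1 - j) / L v j), by
    refine ⟨?_, fun v hv a ha => ?_, fun v hv => indicator_of_notMem hv _⟩
    · refine DifferentiableOn.congr ?_ fun v hv => indicator_of_mem hv _
      refine DifferentiableOn.mul (fun v hv => ?_) ?_
      · have h0 := ((mem_cone_affineOpen L).1 hv).1
        exact (((differentiableAt_zpow (m := k)).2 (Or.inl h0)).comp v
          (differentiable_coordinate L j v)).differentiableWithinAt
      · refine hc.comp ?_ fun v hv => ((mem_cone_affineOpen L).1 hv).2
        simp only [div_eq_mul_inv]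
        exact (differentiable_coordinate L (1 - j)).differentiableOn.mul
          ((differentiable_coordinate L j).differentiableOn.fun_inv
            fun v hv => ((mem_cone_affineOpen L).1 hv).1)
    · rw [indicator_of_mem hv, indicator_of_mem (smul_mem_cone ha hv)]
      simp only [map_smul, Pi.smul_apply, smul_eq_mul, mul_zpow, mul_div_mul_left _ _ ha]
      ring⟩

theorem toTwist_apply {k : ℤ} {j : Fin 2} {W : Opens ℂ} {c : ℂ → ℂ}
    (hc : DifferentiableOn ℂ c W) {v : Fin 2 → ℂ} (hv : v ∈ cone (affineOpen L j W)) :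
    (toTwist L k j W c hc).1 v = L v j ^ k * c (L v (1 - j) / L v j) :=
  indicator_of_mem hv fun v => L v j ^ k * c (L v (1 - j) / L v j)

theorem affineVec_mem_cone {j : Fin 2} {W : Opens ℂ} {w : ℂ} (hw : w ∈ W) :
    affineVec L j w ∈ cone (affineOpen L j W) :=
  (mem_cone_affineOpen L).2 (by simpa using hw)

/-- By homogeneity a section is determined by its restriction to the affine slice where the j-th
coordinate is 1. -/
theorem exists_toTwist {k : ℤ} {j : Fin 2} {W : Opens ℂ} (s : twist k (affineOpen L j W)) :
    ∃ (c : ℂ → ℂ) (hc : DifferentiableOn ℂ c W), s = toTwist L k j W c hc := by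
  refine ⟨fun w => s.1 (affineVec L j w), s.2.1.comp (differentiable_affineVec L j).differentiableOn
    fun w hw => affineVec_mem_cone L hw, ?_⟩
  ext v
  by_cases hv : v ∈ cone (affineOpen L j W)
  · rw [toTwist_apply L _ hv]
    have h := (mem_cone_affineOpen L).1 hv
    rw [← s.2.2.1 _ (affineVec_mem_cone L h.2) _ h.1, smul_affineVec L h.1]
  · rw [s.2.2.2 v hv]
    exact ((toTwist L k j W _ _).2.2.2 v hv).symm

theorem toTwist_eq_zero {k : ℤ} {j : Fin 2} {W : Opens ℂ} {c : ℂ → ℂ}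
    (hc : DifferentiableOn ℂ c W) (h : toTwist L k j W c hc = 0) : ∀ w ∈ W, c w = 0 := by
  intro w hw
  have := toTwist_apply L (k := k) hc (affineVec_mem_cone L (j := j) hw)
  rw [h] at this
  simpa using this.symm

end Chart

theorem twist_smul_apply {k : ℤ} {U : Opens (CP 1)} (h : twist 0 U) (s : twist k U)
    (v : Fin 2 → ℂ) : (h • s).1 v = h.1 v * s.1 v := rfl

theorem twistRes_apply {k : ℤ} {U V : Opens (CP 1)} (hVU : V ≤ U) (s : twist k U)
    {v : Fin 2 → ℂ} (hv : v ∈ cone V) : (twistRes k hVU s).1 v = s.1 v :=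
  indicator_of_mem hv _

/-! ### The frame attached to a splitting of the push-forward -/

section Iso

variable {X : Type*}
variable (L : (Fin 2 → ℂ) ≃ₗ[ℂ] (Fin 2 → ℂ)) (f : X → CP 1)

/-- Homogeneous coordinates of `f x`. -/
noncomputable def homCoord (x : X) : Fin 2 → ℂ := L (f x).rep

/-- The part of `X` over the `j`-th affine line. -/
def affinePart (j : Fin 2) : Set X := {x | homCoord L f x j ≠ 0}

/-- The affine coordinate on the `j`-th affine line. -/
noncomputable def affineCoord (j : Fin 2) (x : X) : ℂ :=
  homCoord L f x (1 - j) / homCoord L f x j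

variable {f}

theorem rep_mem_cone {U : Opens (CP 1)} {x : X} (hx : x ∈ f ⁻¹' U) : (f x).rep ∈ cone U :=
  ⟨Projectivization.rep_nonzero _, by rwa [Projectivization.mk_rep]⟩

theorem affineOpen_mono {j : Fin 2} {W W' : Opens ℂ} (h : W ≤ W') :
    affineOpen L j W ≤ affineOpen L j W' := fun _ hq => ⟨hq.1, h hq.2⟩

variable [TopologicalSpace X] [ChartedSpace ℂ X] {N : ℕ} {k : Fin N → ℤ} {hf : IsHolomorphic f}

/-- The frame of the push-forward over the `j`-th affine line. -/
noncomputable def isoFrame (e : PushforwardIso hf k) (j : Fin 2) (i : Fin N) :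
    pushforward f (affineOpen L j ⊤) :=
  (e.equiv _).symm (Pi.single i (toTwist L (k i) j ⊤ (fun _ => 1) (differentiableOn_const _)))

/-- Linearity over functions and compatibility with restriction carry a combination of the frame to
its tuple of coefficients. Bijectivity of `e` then yields both spanning and independence. -/
theorem equiv_sum (e : PushforwardIso hf k) (j : Fin 2) (W : Opens ℂ) (c : Fin N → ℂ → ℂ)
    (hc : ∀ i, DifferentiableOn ℂ (c i) W) (l : Fin N) :
    e.equiv _ (∑ i, pushforwardSMul hf (toTwist L 0 j W (c i) (hc i))
      (pushforwardRes f (affineOpen_mono L le_top) (isoFrame L e j i))) l =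
      toTwist L (k l) j W (c l) (hc l) := by
  rw [map_sum, Finset.sum_apply]
  have h : ∀ i, e.equiv _ (pushforwardSMul hf (toTwist L 0 j W (c i) (hc i))
      (pushforwardRes f (affineOpen_mono L le_top) (isoFrame L e j i))) l =
      if i = l then toTwist L (k l) j W (c l) (hc l) else 0 := by
    intro i
    rw [e.map_smul, e.map_res, isoFrame, AddEquiv.apply_symm_apply]
    ext v
    rw [twist_smul_apply]
    by_cases hv : v ∈ cone (affineOpen L j W)
    · rw [twistRes_apply _ _ hv]
      split_ifs with hil
      · subst hil
        rw [Pi.single_eq_same, toTwist_apply L _ hv, toTwist_apply L _ hv,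
          toTwist_apply L _ (cone_mono (affineOpen_mono L le_top) hv)]
        simp [mul_comm]
      · rw [Pi.single_eq_of_ne (Ne.symm hil)]
        simp
    · rw [(toTwist L 0 j W (c i) (hc i)).2.2.2 v hv, zero_mul]
      split_ifs with hil
      · exact ((toTwist L (k l) j W (c l) (hc l)).2.2.2 v hv).symm
      · rfl
  simp only [h, Finset.sum_ite_eq', Finset.mem_univ, if_true]

theorem sum_apply_eq (e : PushforwardIso hf k) (j : Fin 2) (W : Opens ℂ) (c : Fin N → ℂ → ℂ)
    (hc : ∀ i, DifferentiableOn ℂ (c i) W) {x : X} (hx : x ∈ f ⁻¹' (affineOpen L j W)) :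
    (∑ i, pushforwardSMul hf (toTwist L 0 j W (c i) (hc i))
      (pushforwardRes f (affineOpen_mono L le_top) (isoFrame L e j i))).1 x =
      ∑ i, c i (affineCoord L f j x) * (isoFrame L e j i).1 x := by
  rw [AddSubmonoidClass.coe_finsetSum, Finset.sum_apply]
  refine Finset.sum_congr rfl fun i _ => ?_
  change (toTwist L 0 j W (c i) (hc i)).1 (f x).rep * (f ⁻¹' _).indicator _ x = _
  rw [indicator_of_mem hx, toTwist_apply L _ (rep_mem_cone hx), zpow_zero, one_mul]
  rfl

end Iso

/-! ### Affine coordinates of the map, finite fibres and properness -/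

section Coord

variable {X : Type*} (L : (Fin 2 → ℂ) ≃ₗ[ℂ] (Fin 2 → ℂ)) {f : X → CP 1}

theorem homCoord_ne_zero (x : X) : homCoord L f x ≠ 0 := fun h =>
  Projectivization.rep_nonzero (f x) (L.map_eq_zero_iff.1 h)

theorem affine_cover (x : X) : x ∈ affinePart L f 0 ∨ x ∈ affinePart L f 1 := by
  by_contra! h
  refine homCoord_ne_zero L (f := f) x (funext fun i => ?_)
  fin_cases i
  · exact not_not.1 h.1
  · exact not_not.1 h.2

theorem affineCoord_eq_iff {j : Fin 2} {x : X} (hx : x ∈ affinePart L f j) {w : ℂ} :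
    affineCoord L f j x = w ↔ homCoord L f x (1 - j) - w * homCoord L f x j = 0 := by
  rw [affineCoord, div_eq_iff hx, sub_eq_zero]

theorem mem_affinePart_of {j : Fin 2} {x : X} {w : ℂ}
    (h : homCoord L f x (1 - j) - w * homCoord L f x j = 0) : x ∈ affinePart L f j := by
  intro h0
  refine homCoord_ne_zero L (f := f) x (funext fun i => ?_)
  rw [h0, mul_zero, sub_zero] at h
  by_cases hi : i = j
  · rw [hi, h0]; rfl
  · have : i = 1 - j := by fin_cases i <;> fin_cases j <;> simp_all
    rw [this, h]; rfl

theorem eq_iff_affineCoord_eq {j : Fin 2} {x : X} {q : CP 1} (hx : x ∈ affinePart L f j)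
    (hq : L q.rep j ≠ 0) :
    f x = q ↔ affineCoord L f j x = L q.rep (1 - j) / L q.rep j := by
  constructor
  · rintro rfl; rfl
  · intro h
    have h1 := smul_affineVec L (j := j) (v := (f x).rep) hx
    have h2 := smul_affineVec L hq
    change homCoord L f x j • affineVec L j (affineCoord L f j x) = _ at h1
    rw [h] at h1
    rw [← Projectivization.mk_rep (f x), ← Projectivization.mk_rep q,
      Projectivization.mk_eq_mk_iff' ℂ]
    refine ⟨homCoord L f x j / L q.rep j, ?_⟩
    rw [← h1]
    nth_rewrite 2 [← h2]
    rw [smul_smul, div_mul_cancel₀ _ hq]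

theorem preimage_singleton {j : Fin 2} {q : CP 1} (hq : L q.rep j ≠ 0) :
    f ⁻¹' {q} = {x | x ∈ affinePart L f j ∧
      affineCoord L f j x = L q.rep (1 - j) / L q.rep j} := by
  ext x
  constructor
  · intro h
    have hx : x ∈ affinePart L f j := by
      change L (f x).rep j ≠ 0
      rwa [show f x = q from h]
    exact ⟨hx, (eq_iff_affineCoord_eq L hx hq).1 h⟩
  · rintro ⟨hx, h⟩
    exact (eq_iff_affineCoord_eq L hx hq).2 h

variable [TopologicalSpace X] [ChartedSpace ℂ X] [IsManifold 𝓘(ℂ) ω X]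

/-- Locally the homogeneous coordinates are holomorphic, up to a common factor. -/
theorem exists_lift (hf : IsHolomorphic f) (x₀ : X) :
    ∃ G : Fin 2 → X → ℂ, (∀ i, HolAt (G i) x₀) ∧
      ∀ᶠ y in 𝓝 x₀, ∃ c : ℂ, c ≠ 0 ∧ ∀ i, homCoord L f y i = c * G i y := by
  obtain ⟨V, hV, hxV, F, hF, e⟩ := hf x₀
  refine ⟨fun i x => L (F x) i, fun i => ?_, ?_⟩
  · refine (mdifferentiableOn_iff_holAt hV).1 ?_ x₀ hxV
    intro x hx
    exact ((differentiable_coordinate L i).mdifferentiable _).comp_mdifferentiableWithinAt x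
      (hF x hx)
  · filter_upwards [hV.mem_nhds hxV] with y hy
    obtain ⟨h0, hy⟩ := e y hy
    obtain ⟨c, hc⟩ := Projectivization.exists_smul_eq_mk_rep ℂ (F y) h0
    refine ⟨c, c.ne_zero, fun i => ?_⟩
    rw [homCoord, hy, ← hc, Units.smul_def, map_smul]
    rfl

theorem isOpen_affinePart (hf : IsHolomorphic f) (j : Fin 2) : IsOpen (affinePart L f j) := by
  rw [isOpen_iff_mem_nhds]
  intro x hx
  obtain ⟨G, hG, e⟩ := exists_lift L hf x
  obtain ⟨c, hc, hcx⟩ := e.self_of_nhds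
  have h0 : G j x ≠ 0 := fun h => hx (by rw [hcx, h, mul_zero])
  filter_upwards [(hG j).continuousAt.eventually_ne h0, e] with y hy ⟨c, hc, hcy⟩
  change homCoord L f y j ≠ 0
  rw [hcy]
  exact mul_ne_zero hc hy

theorem holAt_affineCoord (hf : IsHolomorphic f) {j : Fin 2} {x : X}
    (hx : x ∈ affinePart L f j) : HolAt (affineCoord L f j) x := by
  obtain ⟨G, hG, e⟩ := exists_lift L hf x
  obtain ⟨c, hc, hcx⟩ := e.self_of_nhds
  have h0 : G j x ≠ 0 := fun h => hx (by rw [hcx, h, mul_zero])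
  refine ((hG (1 - j)).div (hG j) h0).congr ?_
  filter_upwards [e] with y ⟨c, hc, hcy⟩
  rw [affineCoord, hcy, hcy, mul_div_mul_left _ _ hc]

/-- The fibre is cut out on all of the surface by a homogeneous linear expression, so the identity
principle applies without leaving the affine part; if the fibre were everything, `f` would be
constant. -/
theorem finite_affine_fibre [CompactSpace X] [ConnectedSpace X] (hf : IsHolomorphic f)
    (hnc : ∃ x y, f x ≠ f y) (j : Fin 2) (w : ℂ) :
    {x | x ∈ affinePart L f j ∧ affineCoord L f j x = w}.Finite := by
  have hZ : {x | x ∈ affinePart L f j ∧ affineCoord L f j x = w} =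
      {x | homCoord L f x (1 - j) - w * homCoord L f x j = 0} := by
    ext x
    exact ⟨fun h => (affineCoord_eq_iff L h.1).1 h.2,
      fun h => ⟨mem_affinePart_of L h, (affineCoord_eq_iff L (mem_affinePart_of L h)).2 h⟩⟩
  rcases eq_univ_or_forall_punctured
    (Z := {x | homCoord L f x (1 - j) - w * homCoord L f x j = 0}) (fun x => by
      obtain ⟨G, hG, e⟩ := exists_lift L hf x
      have h : ∀ᶠ y in 𝓝 x, homCoord L f y (1 - j) - w * homCoord L f y j = 0 ↔
          G (1 - j) y - w * G j y = 0 := by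
        filter_upwards [e] with y ⟨c, hc, hcy⟩
        rw [hcy, hcy, show c * G (1 - j) y - w * (c * G j y) = c * (G (1 - j) y - w * G j y) by ring,
          mul_eq_zero]
        simp [hc]
      rcases ((hG (1 - j)).sub ((HolAt.const w x).mul (hG j))).eventually_eq_zero_or with h1 | h1
      · exact Or.inl (by filter_upwards [h, h1] with y h2 h3 using h2.2 h3)
      · exact Or.inr (by
          filter_upwards [nhdsWithin_le_nhds h, h1] with y h2 h3 h4 using h3 (h2.1 h4))) with h | h
  · obtain ⟨x, y, hxy⟩ := hnc
    rw [← hZ] at h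
    have hx : x ∈ {x | x ∈ affinePart L f j ∧ affineCoord L f j x = w} := h ▸ mem_univ x
    have hy : y ∈ {x | x ∈ affinePart L f j ∧ affineCoord L f j x = w} := h ▸ mem_univ y
    exact absurd ((eq_iff_affineCoord_eq L hx.1 hy.1).2 (hx.2.trans hy.2.symm)) hxy
  · rw [hZ]
    exact finite_of_forall_punctured h

/-- The normalised size ψ of R₁₋ⱼ - w Rⱼ does not depend on the choice of representatives, so it is
continuous on the compact surface. It has no zero off V and is bounded below there by some δ, the
radius of the neighbourhood. -/
theorem affine_proper [CompactSpace X] (hf : IsHolomorphic f) (j : Fin 2) (w : ℂ) {V : Set X}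
    (hV : IsOpen V) (h : ∀ x ∈ affinePart L f j, affineCoord L f j x = w → x ∈ V) :
    ∃ W, IsOpen W ∧ w ∈ W ∧ ∀ x ∈ affinePart L f j, affineCoord L f j x ∈ W → x ∈ V := by
  let ψ : X → ℝ := fun x => ‖homCoord L f x (1 - j) - w * homCoord L f x j‖ / ‖homCoord L f x‖
  have hψ : Continuous ψ := by
    rw [continuous_iff_continuousAt]
    intro x
    obtain ⟨G, hG, e⟩ := exists_lift L hf x
    have hGc : ContinuousAt (fun y i => G i y) x :=
      continuousAt_pi.2 fun i => (hG i).continuousAt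
    have hvec : ∀ᶠ y in 𝓝 x, ∃ c : ℂ, c ≠ 0 ∧ homCoord L f y = c • fun i => G i y := by
      filter_upwards [e] with y ⟨c, hc, hcy⟩
      exact ⟨c, hc, funext fun i => hcy i⟩
    have h0 : (fun i => G i x) ≠ 0 := by
      obtain ⟨c, hc, hcx⟩ := hvec.self_of_nhds
      intro h
      rw [h, smul_zero] at hcx
      exact homCoord_ne_zero L x hcx
    have hcont : ContinuousAt (fun y => ‖G (1 - j) y - w * G j y‖ / ‖fun i => G i y‖) x :=
      (((hG (1 - j)).sub ((HolAt.const w x).mul (hG j))).continuousAt.norm).div hGc.norm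
        (norm_ne_zero_iff.2 h0)
    refine hcont.congr ?_
    filter_upwards [hvec] with y ⟨c, hc, hcy⟩
    simp only [ψ, hcy, Pi.smul_apply, smul_eq_mul, norm_smul]
    rw [show c * G (1 - j) y - w * (c * G j y) = c * (G (1 - j) y - w * G j y) by ring, norm_mul,
      mul_div_mul_left _ _ (norm_ne_zero_iff.2 hc)]
  have hpos : ∀ x ∈ Vᶜ, 0 < ψ x := by
    intro x hx
    refine div_pos (norm_pos_iff.2 fun h0 => hx ?_) (norm_pos_iff.2 (homCoord_ne_zero L x))
    exact h x (mem_affinePart_of L h0) ((affineCoord_eq_iff L (mem_affinePart_of L h0)).2 h0)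
  obtain ⟨δ, hδ, hδ'⟩ : ∃ δ > 0, ∀ x ∈ Vᶜ, δ ≤ ψ x := by
    rcases (Vᶜ).eq_empty_or_nonempty with h0 | h0
    · exact ⟨1, one_pos, by simp [h0]⟩
    · obtain ⟨x, hx, hmin⟩ := hV.isClosed_compl.isCompact.exists_isMinOn h0 hψ.continuousOn
      exact ⟨ψ x, hpos x hx, fun y hy => hmin hy⟩
  refine ⟨Metric.ball w δ, Metric.isOpen_ball, Metric.mem_ball_self hδ, fun x hx hxw => ?_⟩
  by_contra hxV
  refine absurd (hδ' x hxV) (not_le.2 ?_)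
  have h1 : homCoord L f x (1 - j) - w * homCoord L f x j =
      (affineCoord L f j x - w) * homCoord L f x j := by
    rw [affineCoord, sub_mul, div_mul_cancel₀ _ hx]
  have h2 : ‖homCoord L f x j‖ ≤ ‖homCoord L f x‖ := norm_le_pi_norm _ j
  have h3 : 0 < ‖homCoord L f x‖ := norm_pos_iff.2 (homCoord_ne_zero L x)
  simp only [ψ]
  rw [div_lt_iff₀ h3, h1, norm_mul]
  rw [Metric.mem_ball, dist_eq_norm] at hxw
  exact (mul_le_mul_of_nonneg_left h2 (norm_nonneg _)).trans_lt
    (mul_lt_mul_of_pos_right hxw h3)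

variable {N : ℕ} {k : Fin N → ℤ} {hf : IsHolomorphic f}

theorem isFrame_isoFrame [CompactSpace X] [ConnectedSpace X] (hnc : ∃ x y, f x ≠ f y)
    (e : PushforwardIso hf k) (j : Fin 2) :
    IsFrame (affinePart L f j) (affineCoord L f j) fun i => (isoFrame L e j i).1 where
  isOpen := isOpen_affinePart L hf j
  hol_t _ hx := holAt_affineCoord L hf hx
  hol_b i x hx := by
    have h := (isoFrame L e j i).2.1
    have h1 : f ⁻¹' (affineOpen L j ⊤ : Opens (CP 1)) = affinePart L f j := by
      ext x
      exact ⟨fun h => h.1, fun h => ⟨h, trivial⟩⟩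
    rw [h1] at h
    exact (mdifferentiableOn_iff_holAt (isOpen_affinePart L hf j)).1 h x hx
  finite_fibre := finite_affine_fibre L hf hnc j
  proper _ _ := affine_proper L hf j _
  span W h hW hh := by
    let s : pushforward f (affineOpen L j ⟨W, hW⟩) :=
      ⟨(f ⁻¹' (affineOpen L j ⟨W, hW⟩)).indicator h, fun x hx => by
        refine ((hh x hx.1 hx.2).mdifferentiableAt.mdifferentiableWithinAt).congr
          (fun y hy => indicator_of_mem hy _) (indicator_of_mem hx _),
        fun x hx => indicator_of_notMem hx _⟩
    choose c hc hs using fun i => exists_toTwist L (e.equiv _ s i)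
    refine ⟨c, hc, fun x hx hxW => ?_⟩
    have hx' : x ∈ f ⁻¹' (affineOpen L j ⟨W, hW⟩) := ⟨hx, hxW⟩
    have h1 : s = ∑ i, pushforwardSMul hf (toTwist L 0 j ⟨W, hW⟩ (c i) (hc i))
        (pushforwardRes f (affineOpen_mono L le_top) (isoFrame L e j i)) := by
      apply (e.equiv _).injective
      funext l
      rw [equiv_sum, hs l]
    rw [← sum_apply_eq L e j ⟨W, hW⟩ c hc hx', ← h1]
    exact (indicator_of_mem hx' _).symm
  indep W c hW hc h i w hw := by
    have h1 : ∑ i, pushforwardSMul hf (toTwist L 0 j ⟨W, hW⟩ (c i) (hc i))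
        (pushforwardRes f (affineOpen_mono L le_top) (isoFrame L e j i)) = 0 := by
      ext x
      by_cases hx : x ∈ f ⁻¹' (affineOpen L j ⟨W, hW⟩)
      · rw [sum_apply_eq L e j ⟨W, hW⟩ c hc hx]
        exact h x hx.1 hx.2
      · exact (∑ i, pushforwardSMul hf (toTwist L 0 j ⟨W, hW⟩ (c i) (hc i))
          (pushforwardRes f (affineOpen_mono L le_top) (isoFrame L e j i))).2.2 x hx
    have h2 := equiv_sum L e j ⟨W, hW⟩ c hc i
    rw [h1, map_zero] at h2
    exact toTwist_eq_zero L (W := ⟨W, hW⟩) (hc i) h2.symm w hw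

/-- The frames over the two standard affine lines given by a splitting of the push-forward. -/
theorem framePair_isoFrame [CompactSpace X] [ConnectedSpace X] (hnc : ∃ x y, f x ≠ f y)
    (e : PushforwardIso hf k) :
    FramePair k (affinePart L f) (affineCoord L f) fun j i => (isoFrame L e j i).1 where
  frame := isFrame_isoFrame L hnc e
  cover := affine_cover L
  mem_zero_iff x hx := by
    change homCoord L f x 0 ≠ 0 ↔ homCoord L f x 0 / homCoord L f x 1 ≠ 0
    rw [ne_eq, ne_eq, div_eq_zero_iff]
    simp [show homCoord L f x 1 ≠ 0 from hx]
  inv x _ _ := by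
    change homCoord L f x 1 / homCoord L f x 0 = (homCoord L f x 0 / homCoord L f x 1)⁻¹
    rw [inv_div]
  glue i x h0 h1 := by
    -- The overlap of the affine lines. There the generators of 𝒪(k) are related by L₀ ^ k = (L₀ /
    -- L₁) ^ k · L₁ ^ k, and `e` transports this to the frames.
    let W : Opens ℂ := ⟨{0}ᶜ, isOpen_compl_singleton⟩
    have hU : affineOpen L 1 W ≤ affineOpen L 0 ⊤ := by
      rintro q ⟨hq1, hq2⟩
      have hq3 : L q.rep 0 / L q.rep 1 ≠ 0 := hq2
      exact ⟨fun h => hq3 (by rw [h, zero_div]), trivial⟩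
    have hc : DifferentiableOn ℂ (fun w : ℂ => w ^ k i) W := fun w hw =>
      (differentiableAt_zpow.2 (Or.inl hw)).differentiableWithinAt
    have key : pushforwardRes f hU (isoFrame L e 0 i) =
        pushforwardSMul hf (toTwist L 0 1 W _ hc)
          (pushforwardRes f (affineOpen_mono L le_top) (isoFrame L e 1 i)) := by
      apply (e.equiv _).injective
      funext l
      rw [e.map_smul, e.map_res, e.map_res, isoFrame, isoFrame, AddEquiv.apply_symm_apply,
        AddEquiv.apply_symm_apply]
      ext v
      rw [twist_smul_apply]
      by_cases hv : v ∈ cone (affineOpen L 1 W)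
      · rw [twistRes_apply _ _ hv, twistRes_apply _ _ hv, toTwist_apply L _ hv]
        by_cases hil : l = i
        · subst hil
          rw [Pi.single_eq_same, Pi.single_eq_same, toTwist_apply L _ (cone_mono hU hv),
            toTwist_apply L _ (cone_mono (affineOpen_mono L le_top) hv)]
          have h1 := ((mem_cone_affineOpen L).1 hv).1
          change L v 0 ^ k l * 1 = L v 1 ^ (0 : ℤ) * (L v 0 / L v 1) ^ k l * (L v 1 ^ k l * 1)
          rw [div_zpow, zpow_zero, one_mul, mul_one, mul_one,
            div_mul_cancel₀ _ (zpow_ne_zero _ h1)]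
        · rw [Pi.single_eq_of_ne hil, Pi.single_eq_of_ne hil]
          simp
      · rw [(toTwist L 0 1 W _ hc).2.2.2 v hv, zero_mul]
        exact (twistRes _ hU _).2.2.2 v hv
    have hx : x ∈ f ⁻¹' (affineOpen L 1 W) :=
      ⟨h1, div_ne_zero (show homCoord L f x 0 ≠ 0 from h0) h1⟩
    have h2 := congrArg (fun s => s.1 x) key
    change (f ⁻¹' _).indicator _ x = (toTwist L 0 1 W _ hc).1 (f x).rep * (f ⁻¹' _).indicator _ x
      at h2
    rw [indicator_of_mem hx, indicator_of_mem hx, toTwist_apply L _ (rep_mem_cone hx), zpow_zero,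
      one_mul] at h2
    exact h2

end Coord

/-! ### Restriction of a ternary form to a line -/

section Line

theorem eval_smul_of_isHomogeneous {m : ℕ} {G : MvPolynomial (Fin 3) ℂ} (hG : G.IsHomogeneous m)
    (c : ℂ) (x : Fin 3 → ℂ) :
    MvPolynomial.eval (c • x) G = c ^ m * MvPolynomial.eval x G := by
  rw [MvPolynomial.eval_eq', MvPolynomial.eval_eq', Finset.mul_sum]
  refine Finset.sum_congr rfl fun d hd => ?_
  have h1 : ∑ i, d i = m := by
    have := hG (MvPolynomial.mem_support_iff.1 hd)
    rw [← this, Finsupp.weight_apply, Finsupp.sum_fintype _ _ (by simp)]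
    simp
  simp only [Pi.smul_apply, smul_eq_mul, mul_pow, Finset.prod_mul_distrib, Finset.prod_pow_eq_pow_sum,
    h1]
  ring

theorem exists_linePolynomial {m : ℕ} {G : MvPolynomial (Fin 3) ℂ} (hG : G.IsHomogeneous m)
    (u p : Fin 3 → ℂ) :
    ∃ P : Polynomial ℂ, P.natDegree ≤ m ∧ ∀ T, P.eval T = MvPolynomial.eval (u + T • p) G := by
  refine ⟨MvPolynomial.aeval (fun i => Polynomial.C (u i) + Polynomial.C (p i) * Polynomial.X) G,
    ?_, fun T => ?_⟩
  · have := MvPolynomial.aeval_natDegree_le G (m := m) (n := 1) hG.totalDegree_le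
      (fun i => Polynomial.C (u i) + Polynomial.C (p i) * Polynomial.X) fun i => by
        rw [add_comm]
        exact Polynomial.natDegree_linear_le
    simpa using this
  · rw [← Polynomial.coe_evalRingHom, MvPolynomial.map_aeval, MvPolynomial.coe_eval₂Hom]
    have h1 : (Polynomial.evalRingHom T).comp (algebraMap ℂ (Polynomial ℂ)) = RingHom.id ℂ := by
      ext; simp
    rw [h1, MvPolynomial.eval₂_id]
    refine congrArg (fun v => MvPolynomial.eval v G) (funext fun i => ?_)
    change Polynomial.eval T _ = u i + T * p i
    rw [Polynomial.eval_add, Polynomial.eval_mul, Polynomial.eval_C, Polynomial.eval_C,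
      Polynomial.eval_X, mul_comm]

/-- By homogeneity, exchanging u and p reverses the polynomial, so its top coefficient is the value
at p, the point at infinity of the line. -/
theorem exists_linePolynomial' {m : ℕ} {G : MvPolynomial (Fin 3) ℂ} (hG : G.IsHomogeneous m)
    (u p : Fin 3 → ℂ) :
    ∃ P : Polynomial ℂ, P.natDegree ≤ m ∧ P.coeff m = MvPolynomial.eval p G ∧
      ∀ T, P.eval T = MvPolynomial.eval (u + T • p) G := by
  obtain ⟨P, hP, eP⟩ := exists_linePolynomial hG u p
  obtain ⟨Q, hQ, eQ⟩ := exists_linePolynomial hG p u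
  refine ⟨P, hP, ?_, eP⟩
  have h : P = Q.reflect m := by
    refine Polynomial.eq_of_infinite_eval_eq _ _
      ((Set.finite_singleton (0 : ℂ)).infinite_compl.mono fun T hT => ?_)
    have hT : T ≠ 0 := hT
    have := invertibleOfNonzero (inv_ne_zero hT)
    have h1 := Polynomial.eval₂_reflect_mul_pow (RingHom.id ℂ) T⁻¹ m Q hQ
    rw [invOf_eq_inv, inv_inv, ← Polynomial.eval, ← Polynomial.eval, eQ] at h1
    change P.eval T = (Q.reflect m).eval T
    rw [eP, show u + T • p = T • (p + T⁻¹ • u) by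
      rw [smul_add, smul_smul, mul_inv_cancel₀ hT, one_smul, add_comm],
      eval_smul_of_isHomogeneous hG, ← h1, inv_pow, mul_comm, mul_assoc,
      inv_mul_cancel₀ (pow_ne_zero _ hT), mul_one]
  rw [h, Polynomial.coeff_reflect, Polynomial.revAt_le le_rfl, Nat.sub_self,
    Polynomial.coeff_zero_eq_eval_zero, eQ]
  simp

/-- A finite infimum of natural numbers is attained. This turns the values of `planeDegree` and
`planarityDefect` into an actual equation and an actual model. -/
theorem exists_of_iInf_eq {p : ℕ → Prop} {m : ℕ} (h : (⨅ (l : ℕ) (_ : p l), (l : ℕ∞)) = m) :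
    p m := by
  classical
  by_cases hp : ∃ l, p l
  · have : (⨅ (l : ℕ) (_ : p l), (l : ℕ∞)) = (Nat.find hp : ℕ) := by
      refine le_antisymm (iInf₂_le _ (Nat.find_spec hp)) (le_iInf₂ fun l hl => ?_)
      exact_mod_cast Nat.find_min' hp hl
    rw [h] at this
    rw [show m = Nat.find hp by exact_mod_cast this]
    exact Nat.find_spec hp
  · push Not at hp
    simp [hp] at h

end Line

/-! ### Lines through the centre of the projection and fibres of the map -/

section Fibre

variable {X : Type*} {f : X → CP 1} {ν : X → CP 2} {A : (Fin 3 → ℂ) →ₗ[ℂ] (Fin 2 → ℂ)}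

theorem exists_ker_generator (hA : Function.Surjective A) :
    ∃ p : Fin 3 → ℂ, p ≠ 0 ∧ A p = 0 ∧ ∀ v, A v = 0 → ∃ c : ℂ, v = c • p := by
  have h1 : Module.finrank ℂ (LinearMap.ker A) = 1 := by
    have := A.finrank_range_add_finrank_ker
    rw [LinearMap.range_eq_top.2 hA, finrank_top] at this
    simp only [Module.finrank_fin_fun] at this
    omega
  obtain ⟨⟨p, hp⟩, h0, h⟩ := finrank_eq_one_iff'.1 h1
  refine ⟨p, fun h' => h0 (Subtype.ext h'), hp, fun v hv => ?_⟩
  obtain ⟨c, hc⟩ := h ⟨v, hv⟩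
  exact ⟨c, (congrArg Subtype.val hc).symm⟩

variable {p : Fin 3 → ℂ}

/-- Points of the fibre of `f` over `q` lie on the line through `p` corresponding to `q`. -/
theorem exists_line_coordinate (hν : IsProjection f ν A) (hp : p ≠ 0)
    (hker : ∀ v, A v = 0 → ∃ c : ℂ, v = c • p) {u : Fin 3 → ℂ} {q : CP 1} (hu : A u = q.rep)
    {y : X} (hy : f y = q) (hνy : ν y ≠ Projectivization.mk ℂ p hp) :
    ∃ (T : ℂ) (h : u + T • p ≠ 0), ν y = Projectivization.mk ℂ (u + T • p) h := by
  have hv0 := Projectivization.rep_nonzero (ν y)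
  have hAv : A (ν y).rep ≠ 0 := by
    intro h
    obtain ⟨c, hc⟩ := hker _ h
    refine hνy ?_
    rw [← Projectivization.mk_rep (ν y), Projectivization.mk_eq_mk_iff' ℂ]
    exact ⟨c, hc.symm⟩
  have h1 := hν.2 y _ hv0 hAv (Projectivization.mk_rep _).symm
  rw [hy, ← Projectivization.mk_rep q, Projectivization.mk_eq_mk_iff' ℂ] at h1
  obtain ⟨a, ha⟩ := h1
  have ha0 : a ≠ 0 := by
    rintro rfl
    rw [zero_smul] at ha
    exact Projectivization.rep_nonzero q ha.symm
  obtain ⟨T, hT⟩ := hker (a • (ν y).rep - u) (by rw [map_sub, map_smul, ha, hu, sub_self])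
  have h2 : u + T • p = a • (ν y).rep := by rw [← hT]; abel
  have h3 : u + T • p ≠ 0 := by rw [h2]; exact smul_ne_zero ha0 hv0
  refine ⟨T, h3, ?_⟩
  nth_rewrite 1 [← Projectivization.mk_rep (ν y)]
  rw [Projectivization.mk_eq_mk_iff' ℂ]
  exact ⟨a⁻¹, by rw [h2, smul_smul, inv_mul_cancel₀ ha0, one_smul]⟩

/-- The line through `p` over `q` meets the curve in as many points as the fibre over `q` has, if
`ν` is injective there. -/
theorem exists_roots (hν : IsProjection f ν A) (hp : p ≠ 0)
    (hker : ∀ v, A v = 0 → ∃ c : ℂ, v = c • p) {u : Fin 3 → ℂ} {q : CP 1} (hu : A u = q.rep)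
    (hfin : (f ⁻¹' {q}).Finite) (hinj : InjOn ν (f ⁻¹' {q}))
    (hνp : ∀ y ∈ f ⁻¹' {q}, ν y ≠ Projectivization.mk ℂ p hp)
    {m : ℕ} {G : MvPolynomial (Fin 3) ℂ} (hG : IsEquation (range ν) m G) :
    ∃ s : Finset ℂ, s.card = (f ⁻¹' {q}).ncard ∧
      ∀ T ∈ s, MvPolynomial.eval (u + T • p) G = 0 := by
  classical
  have hT : ∀ y, ∃ T : ℂ, y ∈ f ⁻¹' {q} →
      ∃ h : u + T • p ≠ 0, ν y = Projectivization.mk ℂ (u + T • p) h := by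
    intro y
    by_cases hy : y ∈ f ⁻¹' {q}
    · obtain ⟨T, hT⟩ := exists_line_coordinate hν hp hker hu hy (hνp y hy)
      exact ⟨T, fun _ => hT⟩
    · exact ⟨0, fun h => absurd h hy⟩
  choose T hT using hT
  have hTinj : InjOn T (f ⁻¹' {q}) := by
    intro y hy y' hy' h
    obtain ⟨h1, h2⟩ := hT y hy
    obtain ⟨h3, h4⟩ := hT y' hy'
    refine hinj hy hy' ?_
    rw [h2, h4]
    congr 2
    rw [h]
  refine ⟨hfin.toFinset.image T, ?_, fun z hz => ?_⟩
  · rw [Finset.card_image_of_injOn (by simpa using hTinj), Set.ncard_eq_toFinset_card _ hfin]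
  · obtain ⟨y, hy, rfl⟩ := Finset.mem_image.1 hz
    obtain ⟨h1, h2⟩ := hT y (by simpa using hy)
    exact (hG.2.2 _ h1).1 ⟨y, h2⟩

/-- A plane curve of degree `m` not passing through `p` meets lines through `p` in at most
`m` points. -/
theorem ncard_le_of_eval_ne_zero {m : ℕ} {G : MvPolynomial (Fin 3) ℂ} (hG : G.IsHomogeneous m)
    {u p : Fin 3 → ℂ} (h0 : MvPolynomial.eval p G ≠ 0) {s : Finset ℂ}
    (hs : ∀ T ∈ s, MvPolynomial.eval (u + T • p) G = 0) : s.card ≤ m := by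
  obtain ⟨P, hP, hc, eP⟩ := exists_linePolynomial' hG u p
  by_contra hlt
  refine h0 ?_
  rw [← hc, Polynomial.eq_zero_of_natDegree_lt_card_of_eval_eq_zero' P s
    (fun T hT => by rw [eP, hs T hT]) (by omega), Polynomial.coeff_zero]

/-- A plane curve of degree `m` through `p` contains the lines through `p` which meet it in `m`
further points. -/
theorem eval_eq_zero_of_card {m : ℕ} {G : MvPolynomial (Fin 3) ℂ} (hG : G.IsHomogeneous m)
    {u p : Fin 3 → ℂ} (h0 : MvPolynomial.eval p G = 0) (hm : 0 < m) {s : Finset ℂ}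
    (hs : ∀ T ∈ s, MvPolynomial.eval (u + T • p) G = 0) (hcard : m ≤ s.card) (T : ℂ) :
    MvPolynomial.eval (u + T • p) G = 0 := by
  obtain ⟨P, hP, hc, eP⟩ := exists_linePolynomial' hG u p
  -- The coefficient of degree m is the value at p, which is zero; so m further roots are already
  -- too many.
  have hlt : P.natDegree < m := by
    refine lt_of_le_of_ne hP fun h => ?_
    have h1 : P.leadingCoeff = 0 := by rw [Polynomial.leadingCoeff, h, hc, h0]
    rw [Polynomial.leadingCoeff_eq_zero.1 h1, Polynomial.natDegree_zero] at h
    omega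
  rw [← eP, Polynomial.eq_zero_of_natDegree_lt_card_of_eval_eq_zero' P s
    (fun T hT => by rw [eP, hs T hT]) (by omega), Polynomial.eval_zero]

end Fibre

/-! ### Holomorphic maps to projective space in terms of germs -/

section Hol

variable {X : Type*} [TopologicalSpace X] [ChartedSpace ℂ X] [IsManifold 𝓘(ℂ) ω X]

theorem mdifferentiableAt_pi_of_holAt {n : ℕ} {F : X → Fin n → ℂ} {x : X}
    (h : ∀ i, HolAt (fun y => F y i) x) : MDifferentiableAt 𝓘(ℂ) 𝓘(ℂ, Fin n → ℂ) F x := by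
  have : IsManifold 𝓘(ℂ) 1 X := IsManifold.of_le (n := ω) le_top
  rw [mdifferentiableAt_iff_of_mem_source (x := x) (y := 0) (mem_chart_source ℂ x)
    (by simp [chartAt_self_eq])]
  refine ⟨continuousAt_pi.2 fun i => (h i).continuousAt, ?_⟩
  simp only [mfld_simps, chartAt_self_eq, differentiableWithinAt_univ]
  exact differentiableAt_pi.2 fun i => AnalyticAt.differentiableAt (h i)

theorem isHolomorphic_of_holAt {n : ℕ} {ν : X → CP n}
    (h : ∀ x₀, ∃ F : X → Fin (n + 1) → ℂ, (∀ i, HolAt (fun y => F y i) x₀) ∧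
      ∀ᶠ y in 𝓝 x₀, ∃ h : F y ≠ 0, ν y = Projectivization.mk ℂ (F y) h) : IsHolomorphic ν := by
  intro x₀
  obtain ⟨F, hF, e⟩ := h x₀
  obtain ⟨V, hV, hVo, hxV⟩ := eventually_nhds_iff.1
    (e.and (eventually_all.2 fun i => (hF i).eventually))
  exact ⟨V, hVo, hxV, F, fun x hx =>
    (mdifferentiableAt_pi_of_holAt (hV x hx).2).mdifferentiableWithinAt, fun x hx => (hV x hx).1⟩

theorem IsHolomorphic.exists_holAt {n : ℕ} {ν : X → CP n} (hν : IsHolomorphic ν) (x₀ : X) :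
    ∃ F : X → Fin (n + 1) → ℂ, (∀ ℓ : (Fin (n + 1) → ℂ) →ₗ[ℂ] ℂ, HolAt (fun y => ℓ (F y)) x₀) ∧
      ∀ᶠ y in 𝓝 x₀, ∃ h : F y ≠ 0, ν y = Projectivization.mk ℂ (F y) h := by
  obtain ⟨V, hV, hxV, F, hF, e⟩ := hν x₀
  refine ⟨F, fun ℓ => ?_, Filter.mem_of_superset (hV.mem_nhds hxV) e⟩
  refine (mdifferentiableOn_iff_holAt hV).1 ?_ x₀ hxV
  intro x hx
  exact ((LinearMap.toContinuousLinearMap ℓ).differentiable.mdifferentiable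
    _).comp_mdifferentiableWithinAt x (hF x hx)

end Hol

/-! ### Vanishing of forms and choice of coordinates -/

section Vanishing

/-- A form vanishing on infinitely many planes of a pencil is zero. -/
theorem eq_zero_of_eval_eq_zero {m : ℕ} {G : MvPolynomial (Fin 3) ℂ} (hG : G.IsHomogeneous m)
    {A : (Fin 3 → ℂ) →ₗ[ℂ] (Fin 2 → ℂ)} (hA : Function.Surjective A) {D : Set ℂ}
    (hD : D.Infinite) (h : ∀ w ∈ D, ∀ v, A v = ![1, w] → MvPolynomial.eval v G = 0) : G = 0 := by
  obtain ⟨e₀, he₀⟩ := hA ![1, 0]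
  obtain ⟨e₁, he₁⟩ := hA ![0, 1]
  -- Moving along e₁ changes only the second coordinate of A z, so the line meets infinitely many of
  -- the given planes. Scaling and then moving along e₀ reach all other vectors.
  have h1 : ∀ z, A z 0 = 1 → MvPolynomial.eval z G = 0 := by
    intro z hz
    obtain ⟨P, -, hP⟩ := exists_linePolynomial hG z e₁
    have h0 : P = 0 := by
      refine Polynomial.eq_zero_of_infinite_isRoot P
        ((hD.image (sub_left_injective (b := A z 1)).injOn).mono ?_)
      rintro _ ⟨w, hw, rfl⟩
      change P.eval _ = 0
      rw [hP]
      refine h w hw _ ?_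
      rw [map_add, map_smul, he₁]
      ext i
      fin_cases i <;> simp [hz]
    have := hP 0
    rw [h0] at this
    simpa using this.symm
  have h2 : ∀ z, A z 0 ≠ 0 → MvPolynomial.eval z G = 0 := by
    intro z hz
    rw [show z = A z 0 • ((A z 0)⁻¹ • z) by rw [smul_smul, mul_inv_cancel₀ hz, one_smul],
      eval_smul_of_isHomogeneous hG, h1, mul_zero]
    simp [hz]
  refine MvPolynomial.funext fun z => ?_
  obtain ⟨P, -, hP⟩ := exists_linePolynomial hG z e₀
  have h0 : P = 0 := by
    refine Polynomial.eq_zero_of_infinite_isRoot P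
      ((Set.finite_singleton (-A z 0)).infinite_compl.mono fun s hs => ?_)
    change P.eval _ = 0
    rw [hP]
    refine h2 _ ?_
    rw [map_add, map_smul, he₀]
    simp only [Pi.add_apply, Pi.smul_apply, smul_eq_mul, Matrix.cons_val_zero, mul_one]
    exact fun h => hs (eq_neg_of_add_eq_zero_right h)
  have := hP 0
  rw [h0] at this
  simpa using this.symm

theorem mk_eq_mk_iff_div {n : ℕ} {r v : Fin n → ℂ} (hr : r ≠ 0) (hv : v ≠ 0) {i : Fin n}
    (hi : r i ≠ 0) : Projectivization.mk ℂ r hr = Projectivization.mk ℂ v hv ↔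
      v i ≠ 0 ∧ ∀ l, r l / r i = v l / v i := by
  rw [Projectivization.mk_eq_mk_iff' ℂ]
  constructor
  · rintro ⟨a, rfl⟩
    have h := mul_ne_zero_iff.1 (show a * v i ≠ 0 from hi)
    exact ⟨h.2, fun l => mul_div_mul_left _ _ h.1⟩
  · rintro ⟨h, e⟩
    refine ⟨r i / v i, funext fun l => ?_⟩
    have := e l
    simp only [Pi.smul_apply, smul_eq_mul]
    field_simp at this ⊢
    linear_combination -this

theorem exists_linearEquiv_apply_eq_zero (q : CP 1) :
    ∃ L : (Fin 2 → ℂ) ≃ₗ[ℂ] (Fin 2 → ℂ), L q.rep 0 = 0 := by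
  obtain ⟨L, hL⟩ := SeparatingDual.exists_continuousLinearEquiv_apply_eq (R := ℂ)
    (Projectivization.rep_nonzero q) (y := ![0, 1]) (by
      intro h
      simpa using congrFun h 1)
  exact ⟨L.toLinearEquiv, by simp [hL]⟩

end Vanishing

/-! ### Generic fibres and the degree -/

section Fibres

theorem infinite_univ {X : Type*} [TopologicalSpace X] [T1Space X] [Nonempty X]
    [ChartedSpace ℂ X] : (univ : Set X).Infinite := by
  intro h
  obtain ⟨x⟩ := (inferInstance : Nonempty X)
  obtain ⟨y, hy⟩ := (eventually_notMem_of_finite h x).exists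
  exact hy trivial

variable {X : Type*} [TopologicalSpace X] [T2Space X] [CompactSpace X]
  [ConnectedSpace X] [ChartedSpace ℂ X] [IsManifold 𝓘(ℂ) ω X]
  {f : X → CP 1} {hf : IsHolomorphic f} {N : ℕ} {k : Fin N → ℤ}

theorem fibre_finite_and_ncard_le (hnc : ∃ x y, f x ≠ f y) (e : PushforwardIso hf k) (q : CP 1) :
    (f ⁻¹' {q}).Finite ∧ (f ⁻¹' {q}).ncard ≤ N := by
  have P := framePair_isoFrame (LinearEquiv.refl ℂ _) hnc e
  have h : ∃ j, q.rep j ≠ 0 := by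
    by_contra! h
    exact Projectivization.rep_nonzero q (funext h)
  obtain ⟨j, hj⟩ := h
  rw [preimage_singleton (LinearEquiv.refl ℂ _) (j := j) hj]
  exact ⟨(P.frame j).finite_fibre _, (P.frame j).ncard_fibre_le _⟩

/-- Almost all fibres lie over the affine line, are unramified and avoid a given finite set. -/
theorem exists_finite_exceptions (L : (Fin 2 → ℂ) ≃ₗ[ℂ] (Fin 2 → ℂ))
    (hnc : ∃ x y, f x ≠ f y) (e : PushforwardIso hf k) {S : Set X} (hS : S.Finite) :
    ∃ Z : Set X, Z.Finite ∧ ∀ x ∉ Z, x ∈ affinePart L f 0 ∧ (f ⁻¹' {f x}).ncard = N ∧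
      f ⁻¹' {f x} ⊆ Sᶜ := by
  have P := framePair_isoFrame L hnc e
  refine ⟨(affinePart L f 0)ᶜ ∪ {x | x ∈ affinePart L f 0 ∧ ∃ z ∈ affinePart L f 0,
      affineCoord L f 0 z = affineCoord L f 0 x ∧ chartDeriv (affineCoord L f 0) z = 0} ∪
      ⋃ s ∈ S, f ⁻¹' {f s},
    (P.finite_compl.union P.finite_branched).union
      (hS.biUnion fun s _ => (fibre_finite_and_ncard_le hnc e _).1), fun x hx => ?_⟩
  simp only [mem_union, not_or, notMem_compl_iff] at hx
  obtain ⟨⟨h1, h2⟩, h3⟩ := hx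
  refine ⟨h1, ?_, fun y hy hyS => h3 (mem_biUnion hyS (show f x = f y from Eq.symm hy))⟩
  rw [preimage_singleton L (j := 0) h1]
  exact (P.frame 0).ncard_fibre_eq _ fun z hz hzx hd => h2 ⟨h1, z, hz, hzx, hd⟩

theorem exists_generic_fibre (hnc : ∃ x y, f x ≠ f y) (e : PushforwardIso hf k)
    {S : Set X} (hS : S.Finite) : ∃ x, (f ⁻¹' {f x}).ncard = N ∧ f ⁻¹' {f x} ⊆ Sᶜ := by
  obtain ⟨Z, hZ, h⟩ := exists_finite_exceptions (LinearEquiv.refl ℂ _) hnc e hS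
  obtain ⟨x, -, hx⟩ := (infinite_univ (X := X)).exists_notMem_finite hZ
  exact ⟨x, (h x hx).2⟩

/-- No fibre has more points than the rank of the push-forward, and unramified fibres attain it. -/
theorem degree_eq (hnc : ∃ x y, f x ≠ f y) (e : PushforwardIso hf k) :
    degree f = N := by
  refine le_antisymm (iSup_le fun q => ?_) ?_
  · obtain ⟨h1, h2⟩ := fibre_finite_and_ncard_le hnc e q
    rw [← h1.cast_ncard_eq]
    exact_mod_cast h2
  · obtain ⟨x, hx, -⟩ := exists_generic_fibre hnc e Set.finite_empty
    rw [← hx, (fibre_finite_and_ncard_le hnc e _).1.cast_ncard_eq]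
    exact le_iSup (fun q => (f ⁻¹' {q}).encard) (f x)

end Fibres

/-! ### From a separating section to a plane model -/

section PlaneMap

variable {X : Type*} [TopologicalSpace X] [T2Space X] [CompactSpace X]
  [ConnectedSpace X] [ChartedSpace ℂ X] [IsManifold 𝓘(ℂ) ω X]
  {f : X → CP 1} {hf : IsHolomorphic f} {N : ℕ} {k : Fin N → ℤ}

/-- A section of the pull-back of `𝒪(1)` separating the points of almost all fibres gives a plane
model of degree `deg f`. -/
theorem exists_planeMap (L : (Fin 2 → ℂ) ≃ₗ[ℂ] (Fin 2 → ℂ)) (hnc : ∃ x y, f x ≠ f y)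
    (e : PushforwardIso hf k) {g : Fin 2 → X → ℂ}
    (hg : IsSection (affinePart L f) (affineCoord L f) g) {S : Set X} (hS : S.Finite)
    (hS0 : (affinePart L f 0)ᶜ ⊆ S) (hinj : InjOn (fun x => (affineCoord L f 0 x, g 0 x)) Sᶜ) :
    ∃ (ν : X → CP 2) (A : (Fin 3 → ℂ) →ₗ[ℂ] (Fin 2 → ℂ)), IsBirationalPlaneMap ν ∧
      IsProjection f ν A ∧ planeDegree (range ν) = N := by
  have P := framePair_isoFrame L hnc e
  -- The product g j · R j does not depend on the trivialization and scales like R₀ and R₁, so it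
  -- can serve as third homogeneous coordinate.
  have hσ : ∀ x, ∃ σ : ℂ, ∀ j, x ∈ affinePart L f j → σ = g j x * homCoord L f x j := by
    intro x
    have h01 : x ∈ affinePart L f 0 → x ∈ affinePart L f 1 →
        g 0 x * homCoord L f x 0 = g 1 x * homCoord L f x 1 := fun h0 h1 => by
      rw [hg.glue x h0 h1]
      change homCoord L f x 1 / homCoord L f x 0 * _ * _ = _
      rw [div_mul_eq_mul_div, div_mul_cancel₀ _ h0, mul_comm]
    by_cases h0 : x ∈ affinePart L f 0
    · refine ⟨g 0 x * homCoord L f x 0, fun j hj => ?_⟩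
      fin_cases j
      · rfl
      · exact h01 h0 hj
    · refine ⟨g 1 x * homCoord L f x 1, fun j hj => ?_⟩
      fin_cases j
      · exact absurd hj h0
      · rfl
  choose σ hσ using hσ
  let r : X → Fin 3 → ℂ := fun x => ![homCoord L f x 0, homCoord L f x 1, σ x]
  have hr : ∀ x, r x ≠ 0 := fun x h => by
    rcases affine_cover L (f := f) x with hx | hx
    · exact hx (congrFun h 0)
    · exact hx (congrFun h 1)
  let ν : X → CP 2 := fun x => Projectivization.mk ℂ (r x) (hr x)
  have hν0 : ∀ x ∈ affinePart L f 0, ∀ (v : Fin 3 → ℂ) (hv : v ≠ 0),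
      ν x = Projectivization.mk ℂ v hv ↔
        v 0 ≠ 0 ∧ affineCoord L f 0 x = v 1 / v 0 ∧ g 0 x = v 2 / v 0 := by
    intro x hx v hv
    rw [mk_eq_mk_iff_div (hr x) hv (i := 0) hx]
    have h2 : r x 2 / r x 0 = g 0 x := by
      change σ x / _ = _
      rw [hσ x 0 hx]
      exact mul_div_cancel_right₀ _ hx
    refine and_congr_right fun hv0 => ⟨fun h => ⟨h 1, h2 ▸ h 2⟩, fun h l => ?_⟩
    fin_cases l
    · change r x 0 / r x 0 = v 0 / v 0
      rw [div_self hv0, div_self (show r x 0 ≠ 0 from hx)]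
    · exact h.1
    · exact h2.trans h.2
  have hν1 : ∀ x ∈ affinePart L f 1, ∀ (v : Fin 3 → ℂ) (hv : v ≠ 0),
      ν x = Projectivization.mk ℂ v hv ↔
        v 1 ≠ 0 ∧ affineCoord L f 1 x = v 0 / v 1 ∧ g 1 x = v 2 / v 1 := by
    intro x hx v hv
    rw [mk_eq_mk_iff_div (hr x) hv (i := 1) hx]
    have h2 : r x 2 / r x 1 = g 1 x := by
      change σ x / _ = _
      rw [hσ x 1 hx]
      exact mul_div_cancel_right₀ _ hx
    refine and_congr_right fun hv0 => ⟨fun h => ⟨h 0, h2 ▸ h 2⟩, fun h l => ?_⟩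
    fin_cases l
    · exact h.1
    · change r x 1 / r x 1 = v 1 / v 1
      rw [div_self hv0, div_self (show r x 1 ≠ 0 from hx)]
    · exact h2.trans h.2
  let A : (Fin 3 → ℂ) →ₗ[ℂ] (Fin 2 → ℂ) :=
    (L.symm : (Fin 2 → ℂ) →ₗ[ℂ] (Fin 2 → ℂ)) ∘ₗ LinearMap.funLeft ℂ ℂ Fin.castSucc
  have hA : ∀ v, A v = L.symm ![v 0, v 1] := fun v => by
    change L.symm _ = _
    congr 1
    ext i
    fin_cases i <;> rfl
  have hAr : ∀ x, A (r x) = (f x).rep := fun x => by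
    rw [hA, LinearEquiv.symm_apply_eq]
    ext i
    fin_cases i <;> rfl
  have hAs : Function.Surjective A := L.symm.surjective.comp
    (LinearMap.funLeft_surjective_of_injective ℂ ℂ _ (Fin.castSucc_injective 2))
  have hνinj : InjOn ν Sᶜ := by
    intro x hx y hy hxy
    have hx0 : x ∈ affinePart L f 0 := not_not.1 fun h => hx (hS0 h)
    have hy0 : y ∈ affinePart L f 0 := not_not.1 fun h => hy (hS0 h)
    obtain ⟨h0, h1, h2⟩ := (hν0 x hx0 (r y) (hr y)).1 hxy
    obtain ⟨-, h3, h4⟩ := (hν0 y hy0 (r y) (hr y)).1 rfl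
    exact hinj hx hy (Prod.ext (h1.trans h3.symm) (h2.trans h4.symm))
  have hbir : IsBirationalPlaneMap ν := by
    refine ⟨isHolomorphic_of_holAt fun x₀ => ?_, S, hS, hνinj⟩
    · obtain ⟨j, hj⟩ : ∃ j, x₀ ∈ affinePart L f j := by
        rcases affine_cover L (f := f) x₀ with h | h
        exacts [⟨0, h⟩, ⟨1, h⟩]
      obtain ⟨G, hG, eG⟩ := exists_lift L hf x₀
      refine ⟨fun y => ![G 0 y, G 1 y, g j y * G j y], fun i => ?_, ?_⟩
      · fin_cases i
        exacts [hG 0, hG 1, (hg.hol j x₀ hj).mul (hG j)]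
      · filter_upwards [eG, (isOpen_affinePart L hf j).mem_nhds hj] with y ⟨c, hc, hy⟩ hyj
        have hry : r y = c • ![G 0 y, G 1 y, g j y * G j y] := by
          ext i
          fin_cases i
          · exact hy 0
          · exact hy 1
          · change σ y = c * (g j y * G j y)
            rw [hσ y j hyj, hy j]
            ring
        have h0 : ![G 0 y, G 1 y, g j y * G j y] ≠ 0 := fun h => hr y (by rw [hry, h, smul_zero])
        exact ⟨h0, (Projectivization.mk_eq_mk_iff' ℂ _ _ _ _).2 ⟨c, hry.symm⟩⟩
  have hproj : IsProjection f ν A := by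
    refine ⟨hAs, fun x v hv hAv h => ?_⟩
    obtain ⟨a, ha⟩ := (Projectivization.mk_eq_mk_iff' ℂ _ _ _ _).1 h
    rw [← Projectivization.mk_rep (f x), Projectivization.mk_eq_mk_iff' ℂ]
    exact ⟨a, by rw [← map_smul, ha, hAr]⟩
  choose M hM using fun j => (P.frame j).exists_mulMatrix (hg.hol j)
  -- Its affine zeros are the eigenvalues of multiplication by `g`, that is, the values of `g` on
  -- the fibres; since F(0, 0, T) = T ^ N, the centre is not on the curve.
  obtain ⟨F, hF, hF2, hF0, hF1⟩ := P.exists_equation hg hM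
  have hvec : ∀ v : Fin 3 → ℂ, v = ![v 0, v 1, v 2] := fun v => by
    ext i
    fin_cases i <;> rfl
  have hEq : IsEquation (range ν) N F := by
    refine ⟨?_, hF, fun v hv => ?_⟩
    · rintro rfl
      simpa using hF2 1
    · by_cases h0 : v 0 = 0
      · by_cases h1 : v 1 = 0
        · have h2 : v 2 ≠ 0 := fun h2 => hv (by rw [hvec v, h0, h1, h2]; simp)
          refine iff_of_false ?_ ?_
          · rintro ⟨x, hx⟩
            rcases affine_cover L (f := f) x with h | h
            · exact ((hν0 x h v hv).1 hx).1 h0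
            · exact ((hν1 x h v hv).1 hx).1 h1
          · rw [hvec v, h0, h1, hF2]
            exact pow_ne_zero _ h2
        · nth_rewrite 2 [hvec v]
          rw [hF1 _ _ _ h1, mul_eq_zero, or_iff_right (pow_ne_zero _ h1),
            (P.frame 1).isRoot_iff (hg.hol 1) (hM 1)]
          constructor
          · rintro ⟨x, hx⟩
            have h : x ∈ affinePart L f 1 := by
              refine (affine_cover L (f := f) x).resolve_left fun h => ?_
              exact ((hν0 x h v hv).1 hx).1 h0
            exact ⟨x, h, ((hν1 x h v hv).1 hx).2⟩
          · rintro ⟨x, h, hx⟩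
            exact ⟨x, (hν1 x h v hv).2 ⟨h1, hx⟩⟩
      · nth_rewrite 2 [hvec v]
        rw [hF0 _ _ _ h0, mul_eq_zero, or_iff_right (pow_ne_zero _ h0),
          (P.frame 0).isRoot_iff (hg.hol 0) (hM 0)]
        constructor
        · rintro ⟨x, hx⟩
          have h : x ∈ affinePart L f 0 := by
            by_contra h
            have h' := P.notMem_zero h
            have h1 := (hν1 x h'.1 v hv).1 hx
            rw [h'.2] at h1
            exact h0 ((div_eq_zero_iff.1 h1.2.1.symm).resolve_right h1.1)
          exact ⟨x, h, ((hν0 x h v hv).1 hx).2⟩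
        · rintro ⟨x, h, hx⟩
          exact ⟨x, (hν0 x h v hv).2 ⟨h0, hx⟩⟩
  -- For the lower bound, the line through the centre over a generic fibre meets the curve in N
  -- distinct points, and no equation vanishes at the centre.
  refine ⟨ν, A, hbir, hproj, le_antisymm (iInf₂_le N ⟨F, hEq⟩) (le_iInf₂ ?_)⟩
  rintro m ⟨G, hG⟩
  have hp : (![0, 0, 1] : Fin 3 → ℂ) ≠ 0 := fun h => by simpa using congrFun h 2
  have hpν : ¬ Projectivization.mk ℂ _ hp ∈ range ν := fun h => by
    have := (hEq.2.2 _ hp).1 h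
    rw [hF2] at this
    simp at this
  have hker : ∀ v, A v = 0 → ∃ c : ℂ, v = c • ![0, 0, 1] := fun v hv => by
    rw [hA, LinearEquiv.map_eq_zero_iff] at hv
    refine ⟨v 2, ?_⟩
    rw [hvec v, show v 0 = 0 from congrFun hv 0, show v 1 = 0 from congrFun hv 1]
    simp
  obtain ⟨x, hxN, hxS⟩ := exists_generic_fibre hnc e hS
  obtain ⟨s, hs, hsG⟩ := exists_roots hproj hp hker (hAr x)
    (fibre_finite_and_ncard_le hnc e _).1 (hνinj.mono hxS) (fun y _ h => hpν ⟨y, h⟩) hG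
  have := ncard_le_of_eval_ne_zero hG.2.1 (fun h => hpν ((hG.2.2 _ hp).2 h)) hsG
  rw [hs, hxN] at this
  exact_mod_cast this

end PlaneMap

/-! ### From a plane model of degree `deg f` to a section -/

section Converse

variable {X : Type*} [TopologicalSpace X] [T2Space X] [CompactSpace X]
  [ConnectedSpace X] [ChartedSpace ℂ X] [IsManifold 𝓘(ℂ) ω X]
  {f : X → CP 1} {hf : IsHolomorphic f} {N : ℕ} {k : Fin N → ℤ}
  {ν : X → CP 2} {A : (Fin 3 → ℂ) →ₗ[ℂ] (Fin 2 → ℂ)}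

/-- A plane model of degree `deg f` does not pass through the centre of the projection. -/
theorem eval_center_ne_zero (hnc : ∃ x y, f x ≠ f y) (e : PushforwardIso hf k) (hN : 0 < N)
    (hν : IsBirationalPlaneMap ν) (hA : IsProjection f ν A) {p : Fin 3 → ℂ} (hp : p ≠ 0)
    (hker : ∀ v, A v = 0 → ∃ c : ℂ, v = c • p) {G : MvPolynomial (Fin 3) ℂ}
    (hG : IsEquation (range ν) N G) : MvPolynomial.eval p G ≠ 0 := by
  intro hpG
  obtain ⟨-, S, hS, hinj⟩ := hν
  let q₀ : CP 2 := Projectivization.mk ℂ p hp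
  -- Off S the map is injective, so at most one further point is sent to the centre. A fibre
  -- avoiding this set gives N intersection points besides p, so its line lies in the curve.
  have hfin : (S ∪ ν ⁻¹' {q₀}).Finite := by
    rw [← union_sdiff_self]
    refine hS.union (Set.Subsingleton.finite fun x hx y hy => ?_)
    exact hinj hx.2 hy.2 (Eq.trans hx.1 (Eq.symm hy.1))
  let L : (Fin 2 → ℂ) ≃ₗ[ℂ] (Fin 2 → ℂ) := LinearEquiv.refl ℂ _
  have P := framePair_isoFrame L hnc e
  obtain ⟨Z, hZ, hgood⟩ := exists_finite_exceptions L hnc e hfin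
  refine hG.1 (eq_zero_of_eval_eq_zero hG.2.1 hA.1 (D := affineCoord L f 0 '' Zᶜ) ?_ ?_)
  · intro hD
    refine infinite_univ (X := X) ((hZ.union
      (hD.biUnion fun w _ => (P.frame 0).finite_fibre w)).subset fun x _ => ?_)
    by_cases hx : x ∈ Z
    · exact Or.inl hx
    · exact Or.inr (mem_biUnion (mem_image_of_mem _ hx) ⟨(hgood x hx).1, rfl⟩)
  · rintro _ ⟨x, hx, rfl⟩ v hv
    obtain ⟨h0, hxN, hxS⟩ := hgood x hx
    have hu : A ((f x).rep 0 • v) = (f x).rep := by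
      rw [map_smul, hv]
      ext i
      fin_cases i
      · simp
      · exact mul_div_cancel₀ _ h0
    obtain ⟨s, hs, hsG⟩ := exists_roots hA hp hker hu
      (fibre_finite_and_ncard_le hnc e _).1
      (hinj.mono fun y hy hyS => hxS hy (Or.inl hyS))
      (fun y hy h => hxS hy (Or.inr h)) hG
    have h1 := eval_eq_zero_of_card hG.2.1 hpG hN hsG (by rw [hs, hxN]) 0
    rw [zero_smul, add_zero, eval_smul_of_isHomogeneous hG.2.1, mul_eq_zero] at h1
    exact h1.resolve_left (pow_ne_zero _ h0)

/-- A plane model of degree `deg f` gives a section of the pull-back of `𝒪(1)` which is not the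
pull-back of a section on `ℂℙ¹`. -/
theorem exists_section_of_planeMap (hnc : ∃ x y, f x ≠ f y) (e : PushforwardIso hf k)
    (hN : 2 ≤ N) (hν : IsBirationalPlaneMap ν) (hA : IsProjection f ν A)
    (hdeg : planeDegree (range ν) = N) :
    ∃ g, IsSection (affinePart (LinearEquiv.refl ℂ _) f) (affineCoord (LinearEquiv.refl ℂ _) f) g ∧
      ¬ IsLinear (affinePart (LinearEquiv.refl ℂ _) f) (affineCoord (LinearEquiv.refl ℂ _) f) g := by
  obtain ⟨G, hG⟩ := exists_of_iInf_eq hdeg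
  obtain ⟨p, hp, -, hker⟩ := exists_ker_generator hA.1
  have hpν : ∀ x, ν x ≠ Projectivization.mk ℂ p hp := fun x h =>
    eval_center_ne_zero hnc e (by omega) hν hA hp hker hG ((hG.2.2 p hp).1 ⟨x, h⟩)
  -- The i-th coordinate is a linear form nonzero at the centre. Together with the two coordinates
  -- of A it determines a vector of ℂ³, and it provides the section.
  obtain ⟨i, hi⟩ : ∃ i, p i ≠ 0 := by
    by_contra! h
    exact hp (funext h)
  let r : X → Fin 3 → ℂ := fun x => (ν x).rep
  have hr : ∀ x, r x ≠ 0 := fun x => Projectivization.rep_nonzero _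
  have hAr : ∀ x, A (r x) ≠ 0 := by
    intro x h
    obtain ⟨c, hc⟩ := hker _ h
    refine hpν x ?_
    rw [← Projectivization.mk_rep (ν x), Projectivization.mk_eq_mk_iff' ℂ]
    exact ⟨c, hc.symm⟩
  have hfr : ∀ x, f x = Projectivization.mk ℂ (A (r x)) (hAr x) := fun x =>
    hA.2 x _ (hr x) (hAr x) (Projectivization.mk_rep _).symm
  have hcoord : ∀ x, ∃ c : ℂ, c ≠ 0 ∧ ∀ j, homCoord (LinearEquiv.refl ℂ _) f x j = c * A (r x) j := by
    intro x
    obtain ⟨c, hc⟩ := Projectivization.exists_smul_eq_mk_rep ℂ (A (r x)) (hAr x)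
    refine ⟨c, c.ne_zero, fun j => ?_⟩
    change (f x).rep j = _
    rw [hfr, ← hc]
    rfl
  have hmem : ∀ x j, x ∈ affinePart (LinearEquiv.refl ℂ _) f j ↔ A (r x) j ≠ 0 := fun x j => by
    obtain ⟨c, hc, h⟩ := hcoord x
    change homCoord (LinearEquiv.refl ℂ _) f x j ≠ 0 ↔ _
    simp [h, hc]
  have haff : ∀ x j, affineCoord (LinearEquiv.refl ℂ _) f j x = A (r x) (1 - j) / A (r x) j :=
    fun x j => by
      obtain ⟨c, hc, h⟩ := hcoord x
      rw [affineCoord, h, h, mul_div_mul_left _ _ hc]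
  refine ⟨fun j x => r x i / A (r x) j, ⟨fun j x hx => ?_, fun x h0 h1 => ?_⟩, ?_⟩
  · obtain ⟨F, hF, eF⟩ := hν.1.exists_holAt x
    have key : ∀ᶠ y in 𝓝 x, ∃ c : ℂ, c ≠ 0 ∧ r y = c • F y := by
      filter_upwards [eF] with y ⟨h0, hy⟩
      obtain ⟨c, hc⟩ := Projectivization.exists_smul_eq_mk_rep ℂ (F y) h0
      exact ⟨c, c.ne_zero, by
        change (ν y).rep = _
        rw [hy, ← hc]
        rfl⟩
    have h0 : A (F x) j ≠ 0 := by
      obtain ⟨c, hc, hx'⟩ := key.self_of_nhds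
      intro h
      refine (hmem x j).1 hx ?_
      rw [hx', map_smul, Pi.smul_apply, h, smul_zero]
    refine ((hF (LinearMap.proj i)).div (hF (LinearMap.proj j ∘ₗ A)) h0).congr ?_
    filter_upwards [key] with y ⟨c, hc, hy⟩
    rw [hy, map_smul]
    exact (mul_div_mul_left _ _ hc).symm
  · rw [haff]
    have h0 := (hmem x 0).1 h0
    have h1 := (hmem x 1).1 h1
    change _ = A (r x) 1 / A (r x) 0 * _
    field_simp
  · rintro ⟨α, β, hl0, hl1⟩
    have hlin : ∀ x, r x i = α * A (r x) 0 + β * A (r x) 1 := by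
      intro x
      rcases affine_cover (LinearEquiv.refl ℂ _) (f := f) x with hx | hx
      · have h := hl0 x hx
        have h0 := (hmem x 0).1 hx
        rw [haff, show (1 : Fin 2) - 0 = 1 from rfl] at h
        field_simp at h
        linear_combination h
      · have h := hl1 x hx
        have h0 := (hmem x 1).1 hx
        rw [haff, show (1 : Fin 2) - 1 = 0 from rfl] at h
        field_simp at h
        linear_combination h
    -- Linearity expresses the i-th coordinate through A, so ν would be determined by `f`; a generic
    -- fibre has N ≥ 2 points, on which ν is injective.
    have hinj : ∀ x y, f x = f y → ν x = ν y := by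
      intro x y hxy
      rw [hfr x, hfr y, Projectivization.mk_eq_mk_iff' ℂ] at hxy
      obtain ⟨c, hc⟩ := hxy
      obtain ⟨d, hd⟩ := hker (r x - c • r y) (by rw [map_sub, map_smul, hc, sub_self])
      have h1 : d * p i = r x i - c * r y i := (congrFun hd i).symm
      have h2 : d = 0 := by
        refine (mul_eq_zero.1 ?_).resolve_right hi
        rw [h1, hlin x, hlin y, ← hc, Pi.smul_apply, Pi.smul_apply, smul_eq_mul, smul_eq_mul]
        ring
      rw [h2, zero_smul, sub_eq_zero] at hd
      rw [← Projectivization.mk_rep (ν x), ← Projectivization.mk_rep (ν y),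
        Projectivization.mk_eq_mk_iff' ℂ]
      exact ⟨c, hd.symm⟩
    obtain ⟨-, S, hS, hSinj⟩ := hν
    obtain ⟨x, hxN, hxS⟩ := exists_generic_fibre hnc e hS
    obtain ⟨y, hy, z, hz, hyz⟩ := (one_lt_ncard (fibre_finite_and_ncard_le hnc e _).1).1
      (show 1 < (f ⁻¹' {f x}).ncard by omega)
    exact hyz (hSinj (hxS hy) (hxS hz) (hinj y z (Eq.trans hy (Eq.symm hz))))

end Converse

end PlanarityDefect

/-! ### The equivalence -/

open PlanarityDefect

theorem mainTheorem9 {X : Type*} [TopologicalSpace X] [T2Space X] [CompactSpace X]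
    [ConnectedSpace X] [ChartedSpace ℂ X] [IsManifold 𝓘(ℂ) ω X]
    (f : X → CP 1) (hf : IsHolomorphic f) (hnc : ∃ x y, f x ≠ f y) (hd : 2 ≤ degree f)
    (hbr : {q : CP 1 | IsComplicatedBranchPoint f q}.Subsingleton)
    {n : ℕ} (a : Fin n → ℤ)
    (hiso : Nonempty (PushforwardIso hf (Fin.cons 0 a : Fin (n + 1) → ℤ))) :
    planarityDefect f = 0 ↔ IsGreatest (Set.range a) (-1) := by
  obtain ⟨e⟩ := hiso
  have hdeg := degree_eq hnc e
  constructor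
  · intro h
    obtain ⟨ν, A, hν, hA, hνd⟩ := exists_of_iInf_eq (m := 0) h
    rw [Nat.cast_zero, add_zero, hdeg] at hνd
    have P := framePair_isoFrame (LinearEquiv.refl ℂ _) hnc e
    -- Index 0 of `Fin.cons 0 a` is the summand 𝒪, of weight 0, and it exhausts the global
    -- functions.
    have hle : ∀ i, a i ≤ -1 := by
      intro i
      by_contra! hi
      exact Fin.succ_ne_zero i (P.eq_of_nonneg (i := i.succ) (i' := 0)
        (by rw [Fin.cons_succ]; omega) (by rw [Fin.cons_zero]))
    refine ⟨?_, ?_⟩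
    · by_contra hno
      obtain ⟨g, hg, hlin⟩ := exists_section_of_planeMap hnc e
        (by rw [hdeg] at hd; exact_mod_cast hd) hν hA hνd
      refine hlin (P.isLinear_of_le_neg_two (i₀ := 0) (Fin.cons_zero _ _) (fun i hi => ?_) hg)
      obtain ⟨i, rfl⟩ := Fin.exists_succ_eq.2 hi
      rw [Fin.cons_succ]
      have h1 := hle i
      have h2 : a i ≠ -1 := fun h => hno ⟨i, h⟩
      omega
    · rintro _ ⟨i, rfl⟩
      exact hle i
  · rintro ⟨⟨i, hi⟩, -⟩
    -- Coordinates in which the only possible complicated branch point is at infinity, where the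
    -- argument tolerates any ramification.
    obtain ⟨L, hL⟩ : ∃ L : (Fin 2 → ℂ) ≃ₗ[ℂ] (Fin 2 → ℂ),
        ∀ x ∈ affinePart L f 0, ¬ IsComplicatedBranchPoint f (f x) := by
      by_cases hq : ∃ q, IsComplicatedBranchPoint f q
      · obtain ⟨q, hq⟩ := hq
        obtain ⟨L, hL⟩ := exists_linearEquiv_apply_eq_zero q
        refine ⟨L, fun x hx h => hx ?_⟩
        change L (f x).rep 0 = 0
        rw [hbr h hq, hL]
      · exact ⟨LinearEquiv.refl ℂ _, fun x _ h => hq ⟨_, h⟩⟩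
    have P := framePair_isoFrame L hnc e
    obtain ⟨g, hg, hlin⟩ := P.exists_not_isLinear (i₀ := 0) (i := i.succ) (Fin.cons_zero _ _)
      (by rw [Fin.cons_succ, hi])
    obtain ⟨S, hS, hS0, hinj⟩ := P.exists_finite_injOn hg hlin fun x hx => by
      have h1 : ¬ ((f ⁻¹' {f x}).encard < degree f ∧ (f ⁻¹' {f x}).encard + 1 ≠ degree f) :=
        hL x hx
      have h2 := fibre_finite_and_ncard_le hnc e (f x)
      rw [hdeg, ← h2.1.cast_ncard_eq] at h1
      -- With deg f = n + 1, a fibre that is not complicated has at least n points, the bound needed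
      -- for simple ramification.
      have h3 : ¬ ((f ⁻¹' {f x}).ncard < n + 1 ∧ (f ⁻¹' {f x}).ncard + 1 ≠ n + 1) := fun h =>
        h1 ⟨by exact_mod_cast h.1, by exact_mod_cast h.2⟩
      rw [preimage_singleton L (j := 0) hx] at h3
      change n + 1 ≤ {x' | x' ∈ affinePart L f 0 ∧
        affineCoord L f 0 x' = L (f x).rep (1 - 0) / L (f x).rep 0}.ncard + 1
      omega
    obtain ⟨ν, A, hν, hA, hνd⟩ := exists_planeMap L hnc e hg hS hS0 hinj
    exact le_antisymm (iInf₂_le 0 ⟨ν, A, hν, hA, by rw [hνd, hdeg, Nat.cast_zero, add_zero]⟩)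
      bot_le
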